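/- **Model.** There are $M$ sources. Packets $i=0,1,2,\dots$ pass through a channel (transmission time $T_i$) and then a server (computation time $C_i$). The $T_i$ are i.i.d., the $C_i$ are i.i.d., the two families are independent, and $T_i, C_i$ are almost surely positive with finite mean. Packet $0$ is generated at $s_0=-T_0-C_0$ and delivered at time $0$; it counts as initial information from every source. For $i\ge 1$, packet $i$ comes from source $m_i\in\{1,\dots,M\}$. Packet $i$ is generated at $s_i$, waits a time $W_i$ in front of the server, and, if it is delivered, is delivered at $r_i=s_i+T_i+W_i+C_i$. Put $Z_i=s_{i+1}-s_i=T_i+W_i+\Theta_i$ with $\Theta_i\ge 0$, where $W_0=0$ and $s_1\ge 0$. In the *non-preemptive* system $W_{i+1}=\max\{0,C_i-\Theta_i-T_{i+1}\}$ and all packets are delivered. In the *preemptive* system $W_i=0$, and packet $i\geq 1$ is delivered if and only if $C_i\le\Theta_i+T_{i+1}$ (otherwise it is dropped when packet $i+1$ arrives at the server). **Policies.** A causal scheduler $\xi$ chooses $m_{i+1}$ when packet $i$ enters service, as a measurable function of $T_i$, of $(T_j,C_j,Z_j,m_{j+1})_{j<i}$ and of private randomness. A causal sampler $\pi$ then chooses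 $\Theta_i\ge0$ as a measurable function of the same data, of $m_{i+1}$, of its own private randomness and, in a non-anticipating way, of $C_i$ (until the computation of packet $i$ ends, the sampler only knows that it has not ended). The private randomness of $\xi$, that of $\pi$, and the times $(T_i,C_i)_i$ are independent. The scheduler $\xi$ has *scheduling frequency vector* $f$ if, under every causal sampler, almost surely $\frac1N\#\{1\le i\le N: m_i=m\}\to f_m$ for every $m$. **Performance.** When packet $i\ge1$ of source $m$ is delivered, the peak age is $P_i=r_i-s_j$, where $j<i$ is the index of the previously delivered packet of source $m$ ($j=0$ if there is none). For weights $w_m>0$ with $\sum_m w_m=1$, the pair $(\xi,\pi)$ has *weighted-sum average peak AoI* $P\in[0,\infty]$ if the limits $$L_m=\lim_{N\to\infty}\frac{\mathbb E\big[\sum_{i\le N,\ m_i=m,\ i\text{ delivered}}P_i\big]}{\mathbb E\big[\#\{1\le i\le N:\ m_i=m,\ i\text{ delivered}\}\big]}\in[0,\infty]$$ exist and $P=\sum_{m}w_mL_m$. The pair *starves no source* if, almost surely, for every $m$, $\ell_m(N)/N\to1$, where $\ell_m(N)$ is the index of the last delivered packet of source $m$ among packets $1,\dots,N$ ($0$ if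 there is none). **Theorem.** Consider either of the two systems. Let $\xi_1,\xi_2$ be causal schedulers with the same scheduling frequency vector $f$, where $f_m>0$ for all $m$. Let $\pi$ be any causal sampler such that $(\xi_1,\pi)$ has weighted-sum average peak AoI $P\in[0,\infty]$; in the preemptive system, assume also that $(\xi_1,\pi)$ starves no source (in the non-preemptive system this is automatic). Then there is a causal sampler $\pi'$ such that $(\xi_2,\pi')$ starves no source and has weighted-sum average peak AoI equal to the same $P$. -/

import Mathlib

open MeasureTheory Filter Topology

namespace PeakAge

/-- The service discipline of the edge server. -/
inductive Mode where
  | nonpreemptive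
  | preemptive

/-- A point of the underlying probability space: the transmission times `T 0, T 1, …`, the
computation times `C 0, C 1, …`, the private seeds of the scheduler, and the private seeds of
the sampler. -/
abbrev Outcome : Type :=
  (ℕ → ℝ) × (ℕ → ℝ) × (ℕ → unitInterval) × (ℕ → unitInterval)

/-- Transmission time of packet `i`. -/
def Outcome.T (ω : Outcome) (i : ℕ) : ℝ := ω.1 i

/-- Computation time of packet `i`. -/
def Outcome.C (ω : Outcome) (i : ℕ) : ℝ := ω.2.1 i

/-- Private randomness of the scheduler. -/
def Outcome.schedSeed (ω : Outcome) : ℕ → unitInterval := ω.2.2.1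

/-- Private randomness of the sampler. -/
def Outcome.sampSeed (ω : Outcome) : ℕ → unitInterval := ω.2.2.2

/-- The transmission times are i.i.d. with law `μT`, the computation times are i.i.d. with law
`μC`, all seeds are i.i.d. uniform on `[0, 1]`, and these families are independent. -/
noncomputable def law (μT μC : Measure ℝ) [IsProbabilityMeasure μT] [IsProbabilityMeasure μC] :
    Measure Outcome :=
  (Measure.infinitePi (fun _ : ℕ => μT)).prod
    ((Measure.infinitePi (fun _ : ℕ => μC)).prod
      ((Measure.infinitePi (fun _ : ℕ => (volume : Measure unitInterval))).prod
        (Measure.infinitePi (fun _ : ℕ => (volume : Measure unitInterval)))))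

/-- What is recorded about packet `j` once it has left the server: `(T j, C j, Z j, m (j + 1))`,
where `Z j` is the time between the generation of packets `j` and `j + 1`, and `m (j + 1)` is the
source of packet `j + 1`. -/
abbrev PacketRecord (M : ℕ) : Type := ℝ × ℝ × ℝ × Fin M

/-- The information available at the instant at which packet `i` enters service: the records of
packets `0, …, i - 1` (so also the sources of the packets `1, …, i`), and the transmission time of
packet `i`. Generation times and waiting times up to packet `i` are functions of these data. -/
abbrev History (M i : ℕ) : Type := (Fin i → PacketRecord M) × ℝ

/-- A causal, possibly randomized, scheduler: when packet `i` enters service, the source of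
packet `i + 1` is chosen from the information available. -/
structure Scheduler (M : ℕ) where
  /-- the source of packet `i + 1` -/
  choose (i : ℕ) : (ℕ → unitInterval) → History M i → Fin M
  measurable_choose (i : ℕ) :
    Measurable fun x : (ℕ → unitInterval) × History M i => choose i x.1 x.2

/-- A causal, possibly randomized, sampler. `delay i seed h m c` is the time `Θ i ≥ 0` between the
instant at which packet `i` enters service and the generation of packet `i + 1`, when `h` is the
history at the first of these instants, `m` is the source chosen for packet `i + 1`, and `c` is the
computation time of packet `i`. The dependence on `c` is non-anticipating: as long as the
computation of packet `i` has not ended, only this fact is known to the sampler. Packet `0` is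
delivered at time `0`, and packet `1` is not generated before time `0`. -/
structure Sampler (M : ℕ) where
  /-- the time from the start of service of packet `i` to the generation of packet `i + 1` -/
  delay (i : ℕ) : (ℕ → unitInterval) → History M i → Fin M → ℝ → ℝ
  measurable_delay (i : ℕ) :
    Measurable fun x : (ℕ → unitInterval) × History M i × Fin M × ℝ =>
      delay i x.1 x.2.1 x.2.2.1 x.2.2.2
  delay_nonneg (i : ℕ) (seed : ℕ → unitInterval) (h : History M i) (m : Fin M) (c : ℝ) :
    0 ≤ delay i seed h m c
  nonanticipating (i : ℕ) (seed : ℕ → unitInterval) (h : History M i) (m : Fin M) (c c' : ℝ) :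
    delay i seed h m c < c → delay i seed h m c < c' → delay i seed h m c' = delay i seed h m c
  initial (seed : ℕ → unitInterval) (h : History M 0) (m : Fin M) (c : ℝ) :
    c ≤ delay 0 seed h m c

section Dynamics

variable {M : ℕ} (mode : Mode) (ξ : Scheduler M) (π : Sampler M) (ω : Outcome)

/-- The records of the packets `0, …, i - 1`, together with the waiting time `W i` of packet `i` in
the queue of the server. Without preemption, packet `i + 1` waits until the computation of packet
`i` ends; with preemption it never waits. -/
noncomputable def state : (i : ℕ) → (Fin i → PacketRecord M) × ℝ
  | 0 => (Fin.elim0, 0)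
  | i + 1 =>
    let past := (state i).1
    let W := (state i).2
    let h : History M i := (past, ω.T i)
    let m := ξ.choose i ω.schedSeed h
    let Θ := π.delay i ω.sampSeed h m (ω.C i)
    (Fin.snoc (α := fun _ => PacketRecord M) past (ω.T i, ω.C i, ω.T i + W + Θ, m),
      match mode with
      | .nonpreemptive => max 0 (ω.C i - Θ - ω.T (i + 1))
      | .preemptive => 0)

/-- The information available when packet `i` enters service. -/
noncomputable def history (i : ℕ) : History M i := ((state mode ξ π ω i).1, ω.T i)

/-- `W i`, the waiting time of packet `i` in the queue of the server. -/
noncomputable def waiting (i : ℕ) : ℝ := (state mode ξ π ω i).2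

/-- The source of packet `i + 1`. (Packet `0` is an initial packet without a source.) -/
noncomputable def nextSource (i : ℕ) : Fin M := ξ.choose i ω.schedSeed (history mode ξ π ω i)

/-- `Θ i`, the time between the start of service of packet `i` and the generation of packet
`i + 1`. -/
noncomputable def delay (i : ℕ) : ℝ :=
  π.delay i ω.sampSeed (history mode ξ π ω i) (nextSource mode ξ π ω i) (ω.C i)

/-- `Z i`, the time between the generation of packet `i` and that of packet `i + 1`. -/
noncomputable def interGeneration (i : ℕ) : ℝ :=
  ω.T i + waiting mode ξ π ω i + delay mode ξ π ω i

/-- `s i`, the generation time of packet `i`. -/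
noncomputable def generationTime (i : ℕ) : ℝ :=
  -ω.T 0 - ω.C 0 + ∑ j ∈ Finset.range i, interGeneration mode ξ π ω j

/-- `r i`, the time at which packet `i` is delivered (if it is not dropped). -/
noncomputable def deliveryTime (i : ℕ) : ℝ :=
  generationTime mode ξ π ω i + ω.T i + waiting mode ξ π ω i + ω.C i

/-- Packet `i` is delivered: always without preemption; with preemption, if its computation ends
no later than packet `i + 1` arrives at the server. -/
def Delivered (i : ℕ) : Prop :=
  match mode with
  | .nonpreemptive => True
  | .preemptive => deliveryTime mode ξ π ω i ≤ generationTime mode ξ π ω (i + 1) + ω.T (i + 1)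

/-- Packet `i + 1` comes from source `m` and is delivered. -/
def DeliveredFrom (m : Fin M) (i : ℕ) : Prop :=
  nextSource mode ξ π ω i = m ∧ Delivered mode ξ π ω (i + 1)

open Classical in
/-- The index of the last packet among `1, …, N` that comes from source `m` and is delivered, and
`0` (the initial packet, which counts as fresh information from every source) if there is none. -/
noncomputable def lastDelivered (m : Fin M) : ℕ → ℕ
  | 0 => 0
  | N + 1 => if DeliveredFrom mode ξ π ω m N then N + 1 else lastDelivered m N

/-- The peak age of source `m` just before the delivery of packet `i + 1`, if that packet comes
from source `m` and is delivered: its delivery time minus the generation time of the previously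
delivered packet of source `m`. -/
noncomputable def peak (m : Fin M) (i : ℕ) : ℝ :=
  deliveryTime mode ξ π ω (i + 1) -
    generationTime mode ξ π ω (lastDelivered mode ξ π ω m i)

open Classical in
/-- The number of packets among `1, …, N` that come from source `m`. -/
noncomputable def scheduledCount (m : Fin M) (N : ℕ) : ℕ :=
  ((Finset.range N).filter fun i => nextSource mode ξ π ω i = m).card

open Classical in
/-- The number of packets among `1, …, N` that come from source `m` and are delivered. -/
noncomputable def deliveredCount (m : Fin M) (N : ℕ) : ℕ :=
  ((Finset.range N).filter fun i => DeliveredFrom mode ξ π ω m i).card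

open Classical in
/-- The sum of the peak ages of source `m` over its delivered packets among `1, …, N`. -/
noncomputable def peakSum (m : Fin M) (N : ℕ) : ENNReal :=
  ∑ i ∈ (Finset.range N).filter fun i => DeliveredFrom mode ξ π ω m i,
    ENNReal.ofReal (peak mode ξ π ω m i)

end Dynamics

section Performance

variable {M : ℕ} (mode : Mode) (μT μC : Measure ℝ)
  [IsProbabilityMeasure μT] [IsProbabilityMeasure μC]

/-- The scheduler `ξ` has scheduling frequency vector `f`: whatever the sampler, almost surely the
fraction of packets that come from source `m` tends to `f m`, for every `m`. -/
def HasSchedulingFrequency (ξ : Scheduler M) (f : Fin M → ℝ) : Prop :=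
  ∀ π : Sampler M, ∀ᵐ ω ∂(law μT μC), ∀ m : Fin M,
    Tendsto (fun N : ℕ => (scheduledCount mode ξ π ω m N : ℝ) / N) atTop (𝓝 (f m))

/-- No source is starved: almost surely, for every source `m`, the index of the last delivered
packet of source `m` among the first `N` packets is `N - o(N)`. -/
def NoStarvation (ξ : Scheduler M) (π : Sampler M) : Prop :=
  ∀ᵐ ω ∂(law μT μC), ∀ m : Fin M,
    Tendsto (fun N : ℕ => (lastDelivered mode ξ π ω m N : ℝ) / N) atTop (𝓝 1)

/-- The average peak age of source `m` exists and equals `L`, which may be `∞`: the expected sum of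
the peak ages at the deliveries among the first `N` packets, divided by the expected number of
these deliveries, tends to `L`. -/
def HasAveragePeakAge (ξ : Scheduler M) (π : Sampler M) (m : Fin M) (L : ENNReal) : Prop :=
  Tendsto (fun N : ℕ =>
      (∫⁻ ω, peakSum mode ξ π ω m N ∂(law μT μC)) /
        (∫⁻ ω, (deliveredCount mode ξ π ω m N : ENNReal) ∂(law μT μC)))
    atTop (𝓝 L)

/-- The weighted sum of the average peak ages of the sources, with weights `w`, exists and equals
`P`. -/
def HasWeightedPeakAge (w : Fin M → ℝ) (ξ : Scheduler M) (π : Sampler M) (P : ENNReal) : Prop :=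
  ∃ L : Fin M → ENNReal, (∀ m, HasAveragePeakAge mode μT μC ξ π m (L m)) ∧
    P = ∑ m, ENNReal.ofReal (w m) * L m

end Performance

end PeakAge

/-! Along each path the peak ages of source m telescope: up to packet N, their sum is the total time
in the system of the delivered packets of m plus the time from s_0 to the generation of the last
delivered packet of m (`peakSum_eq`). If no source is starved and the delays are uniformly
integrable on average, the second part is asymptotically the generation time of packet N, in mean
and up to o(N). Hence L_m = (E T + ∑_{m'} f_{m'} (w_{m'} + a_{m'}) + f_m g_m) / (f_m d_m), where d,
g, w, a are the averages, per packet of a source, of the delivery indicator, the time in the system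
(0 if dropped), the waiting time and the delay. The scheduler enters only through f and these four
averages.

The source of a packet is chosen independently of the times which, together with a single delay,
decide its fate. Therefore the averages over the first N packets of source m equal the performance
of one randomized one-step rule (`exists_rule_value_eq`), whose seed draws a packet number and a
past to replay. Conversely, a sampler that picks its rule according to the source of the packet
being decided realizes the performance of these rules under any scheduler, in particular ξ₂
(`lintegral_mul_sourceFeature_ruleSampler`, `performance_ruleSampler`). It starves no source,
because drop probabilities stay away from 1 (`noStarvation_ruleSampler`).

Two difficulties remain. The averages per source under (ξ₁, π) need not converge, so limits are
taken along an ultrafilter. And part of the mean delay may escape to infinity, so delays are capped,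
and the limiting rules are only known to be at least as good as π (`exists_limit_rules`). Equality
is restored by using, with a small probability, a rule that waits for the end of the computation and
then for a time y: the objective is affine in y with positive slope and starts below P, so some y
gives exactly P (`exists_mixture`). If P = ∞, extra waiting times that grow with the packet number
suffice (`exists_sampler_infinite`). -/

namespace PeakAge

/-! ### Causality of the dynamics, and the data that decide the fate of a packet. -/

section Dynamics

variable {M : ℕ} {mode : Mode} {ξ : Scheduler M} {π : Sampler M}

/-- Causality. Sampler seeds are compared only through the delay functions they induce, because a
`ruleSampler` reads one seed per step and should not notice a change of later seeds. -/
theorem state_congr {ω ω' : Outcome} (hS : ω.schedSeed = ω'.schedSeed) (i : ℕ)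
    (hT : ∀ j ≤ i, ω.T j = ω'.T j) (hC : ∀ j < i, ω.C j = ω'.C j)
    (hπ : ∀ j < i, π.delay j ω.sampSeed = π.delay j ω'.sampSeed) :
    state mode ξ π ω i = state mode ξ π ω' i := by
  induction i with
  | zero => rfl
  | succ i ih =>
    have h := ih (fun j hj => hT j (by omega)) (fun j hj => hC j (by omega))
      (fun j hj => hπ j (by omega))
    simp only [state, h, hS, hT i (by omega), hT (i + 1) le_rfl, hC i (by omega),
      hπ i (by omega)]

theorem history_congr {ω ω' : Outcome} (hS : ω.schedSeed = ω'.schedSeed) (i : ℕ)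
    (hT : ∀ j ≤ i, ω.T j = ω'.T j) (hC : ∀ j < i, ω.C j = ω'.C j)
    (hπ : ∀ j < i, π.delay j ω.sampSeed = π.delay j ω'.sampSeed) :
    history mode ξ π ω i = history mode ξ π ω' i := by
  simp only [history, state_congr hS i hT hC hπ, hT i le_rfl]

theorem nextSource_congr {ω ω' : Outcome} (hS : ω.schedSeed = ω'.schedSeed) (i : ℕ)
    (hT : ∀ j ≤ i, ω.T j = ω'.T j) (hC : ∀ j < i, ω.C j = ω'.C j)
    (hπ : ∀ j < i, π.delay j ω.sampSeed = π.delay j ω'.sampSeed) :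
    nextSource mode ξ π ω i = nextSource mode ξ π ω' i := by
  simp only [nextSource, history_congr hS i hT hC hπ, hS]

theorem delay_congr {ω ω' : Outcome} (hS : ω.schedSeed = ω'.schedSeed) (i : ℕ)
    (hT : ∀ j ≤ i, ω.T j = ω'.T j) (hC : ∀ j ≤ i, ω.C j = ω'.C j)
    (hπ : ∀ j ≤ i, π.delay j ω.sampSeed = π.delay j ω'.sampSeed) :
    delay mode ξ π ω i = delay mode ξ π ω' i := by
  have hC' : ∀ j < i, ω.C j = ω'.C j := fun j hj => hC j hj.le
  have hπ' : ∀ j < i, π.delay j ω.sampSeed = π.delay j ω'.sampSeed := fun j hj => hπ j hj.le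
  simp only [delay, history_congr hS i hT hC' hπ', nextSource_congr hS i hT hC' hπ',
    hC i le_rfl, hπ i le_rfl]

theorem measurable_T (i : ℕ) : Measurable fun ω : Outcome => ω.T i :=
  (measurable_pi_apply i).comp measurable_fst

theorem measurable_C (i : ℕ) : Measurable fun ω : Outcome => ω.C i :=
  (measurable_pi_apply i).comp (measurable_fst.comp measurable_snd)

theorem measurable_schedSeed : Measurable Outcome.schedSeed :=
  measurable_fst.comp (measurable_snd.comp measurable_snd)

theorem measurable_sampSeed : Measurable Outcome.sampSeed :=
  measurable_snd.comp (measurable_snd.comp measurable_snd)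

variable (mode ξ π)

theorem measurable_state (i : ℕ) : Measurable fun ω : Outcome => state mode ξ π ω i := by
  induction i with
  | zero => exact measurable_const
  | succ i ih =>
    have hh : Measurable fun ω : Outcome => (((state mode ξ π ω i).1, ω.T i) : History M i) :=
      (measurable_fst.comp ih).prodMk (measurable_T i)
    have hm : Measurable fun ω : Outcome =>
        ξ.choose i ω.schedSeed ((state mode ξ π ω i).1, ω.T i) :=
      (ξ.measurable_choose i).comp (measurable_schedSeed.prodMk hh)
    have hΘ : Measurable fun ω : Outcome =>
        π.delay i ω.sampSeed ((state mode ξ π ω i).1, ω.T i)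
          (ξ.choose i ω.schedSeed ((state mode ξ π ω i).1, ω.T i)) (ω.C i) :=
      (π.measurable_delay i).comp
        (measurable_sampSeed.prodMk (hh.prodMk (hm.prodMk (measurable_C i))))
    refine Measurable.prodMk ?_ ?_
    · refine measurable_pi_lambda _ fun j => ?_
      refine Fin.lastCases ?_ (fun j => ?_) j
      · simp only [Fin.snoc_last]
        exact (measurable_T i).prodMk ((measurable_C i).prodMk
          ((((measurable_T i).add (measurable_snd.comp ih)).add hΘ).prodMk hm))
      · simp only [Fin.snoc_castSucc]
        exact (measurable_pi_apply j).comp (measurable_fst.comp ih)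
    · cases mode with
      | nonpreemptive =>
        exact measurable_const.max (((measurable_C i).sub hΘ).sub (measurable_T (i + 1)))
      | preemptive => exact measurable_const

theorem measurable_history (i : ℕ) : Measurable fun ω : Outcome => history mode ξ π ω i :=
  (measurable_fst.comp (measurable_state mode ξ π i)).prodMk (measurable_T i)

theorem measurable_waiting (i : ℕ) : Measurable fun ω : Outcome => waiting mode ξ π ω i :=
  measurable_snd.comp (measurable_state mode ξ π i)

theorem measurable_nextSource (i : ℕ) : Measurable fun ω : Outcome => nextSource mode ξ π ω i :=
  (ξ.measurable_choose i).comp (measurable_schedSeed.prodMk (measurable_history mode ξ π i))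

theorem measurable_delay (i : ℕ) : Measurable fun ω : Outcome => delay mode ξ π ω i :=
  (π.measurable_delay i).comp (measurable_sampSeed.prodMk ((measurable_history mode ξ π i).prodMk
    ((measurable_nextSource mode ξ π i).prodMk (measurable_C i))))

theorem measurable_interGeneration (i : ℕ) :
    Measurable fun ω : Outcome => interGeneration mode ξ π ω i :=
  ((measurable_T i).add (measurable_waiting mode ξ π i)).add (measurable_delay mode ξ π i)

theorem delay_nonneg (ω : Outcome) (i : ℕ) : 0 ≤ delay mode ξ π ω i := π.delay_nonneg _ _ _ _ _

theorem waiting_zero (ω : Outcome) : waiting mode ξ π ω 0 = 0 := rfl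

theorem waiting_nonneg (ω : Outcome) (i : ℕ) : 0 ≤ waiting mode ξ π ω i := by
  cases i with
  | zero => exact le_rfl
  | succ i =>
    cases mode with
    | nonpreemptive => exact le_max_left _ _
    | preemptive => exact le_rfl

/-- The step at which the fate of packet `i + 1` is decided: its waiting time results from the
delay after packet `i`, its delivery under preemption from the delay after packet `i + 1`. -/
def stepOf : Mode → ℕ → ℕ
  | .nonpreemptive, i => i
  | .preemptive, i => i + 1

/-- The times that, together with the delay of step `stepOf mode i`, determine the fate of packet
`i + 1`, and that are independent of its source. -/
def fresh (i : ℕ) (ω : Outcome) : ℝ × ℝ × ℝ :=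
  match mode with
  | .nonpreemptive => (ω.C i, ω.T (i + 1), ω.C (i + 1))
  | .preemptive => (ω.T (i + 1), ω.C (i + 1), ω.T (i + 2))

/-- Replace the fresh times of packet `i + 1`. -/
def resample (i : ℕ) (ω : Outcome) (z : ℝ × ℝ × ℝ) : Outcome :=
  match mode with
  | .nonpreemptive => (Function.update ω.1 (i + 1) z.2.1,
      Function.update (Function.update ω.2.1 i z.1) (i + 1) z.2.2, ω.2.2)
  | .preemptive => (Function.update (Function.update ω.1 (i + 1) z.1) (i + 2) z.2.2,
      Function.update ω.2.1 (i + 1) z.2.1, ω.2.2)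

/-- The part of the fresh times that the sampler may see: the transmission time (under preemption)
and the computation time of the packet in service. -/
def observed (z : ℝ × ℝ × ℝ) : ℝ × ℝ :=
  match mode with
  | .nonpreemptive => (0, z.1)
  | .preemptive => (z.1, z.2.1)

/-- Fresh times with a given observed part. -/
def ofObserved (t c : ℝ) : ℝ × ℝ × ℝ :=
  match mode with
  | .nonpreemptive => (c, 0, 0)
  | .preemptive => (t, c, 0)

/-- The fresh transmission time of packet `i + 1`. -/
def freshT (z : ℝ × ℝ × ℝ) : ℝ :=
  match mode with
  | .nonpreemptive => z.2.1
  | .preemptive => z.1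

/-- The fresh computation time of packet `i + 1`. -/
def freshC (z : ℝ × ℝ × ℝ) : ℝ :=
  match mode with
  | .nonpreemptive => z.2.2
  | .preemptive => z.2.1

/-- The indicator of the delivery of a packet, as a function of the fresh times and the delay. -/
noncomputable def deliveredFeature (z : ℝ × ℝ × ℝ) (θ : ℝ) : ENNReal :=
  match mode with
  | .nonpreemptive => 1
  | .preemptive => if z.2.1 ≤ θ + z.2.2 then 1 else 0

/-- The waiting time of a packet, as a function of the fresh times and the delay. -/
noncomputable def waitingFeature (z : ℝ × ℝ × ℝ) (θ : ℝ) : ENNReal :=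
  match mode with
  | .nonpreemptive => ENNReal.ofReal (max 0 (z.1 - θ - z.2.1))
  | .preemptive => 0

/-- The time in the system of a packet if it is delivered, and `0` otherwise. -/
noncomputable def systemFeature (z : ℝ × ℝ × ℝ) (θ : ℝ) : ENNReal :=
  deliveredFeature mode z θ * (ENNReal.ofReal (freshT mode z) + waitingFeature mode z θ +
    ENNReal.ofReal (freshC mode z))

theorem measurable_fresh (i : ℕ) : Measurable (fresh mode i) := by
  cases mode with
  | nonpreemptive => exact (measurable_C _).prodMk ((measurable_T _).prodMk (measurable_C _))
  | preemptive => exact (measurable_T _).prodMk ((measurable_C _).prodMk (measurable_T _))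

theorem measurable_deliveredFeature :
    Measurable fun p : (ℝ × ℝ × ℝ) × ℝ => deliveredFeature mode p.1 p.2 := by
  cases mode with
  | nonpreemptive => exact measurable_const
  | preemptive =>
    exact Measurable.ite (measurableSet_le (by fun_prop) (by fun_prop)) measurable_const
      measurable_const

theorem measurable_waitingFeature :
    Measurable fun p : (ℝ × ℝ × ℝ) × ℝ => waitingFeature mode p.1 p.2 := by
  cases mode with
  | nonpreemptive => simp only [waitingFeature]; fun_prop
  | preemptive => exact measurable_const

theorem measurable_freshT : Measurable (freshT mode) := by
  cases mode
  · exact measurable_fst.comp measurable_snd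
  · exact measurable_fst

theorem measurable_freshC : Measurable (freshC mode) := by
  cases mode
  · exact measurable_snd.comp measurable_snd
  · exact measurable_fst.comp measurable_snd

theorem measurable_systemFeature :
    Measurable fun p : (ℝ × ℝ × ℝ) × ℝ => systemFeature mode p.1 p.2 :=
  (measurable_deliveredFeature mode).mul
    ((((measurable_freshT mode).comp measurable_fst).ennreal_ofReal.add
      (measurable_waitingFeature mode)).add
      ((measurable_freshC mode).comp measurable_fst).ennreal_ofReal)

theorem deliveredFeature_le_one (z : ℝ × ℝ × ℝ) (θ : ℝ) : deliveredFeature mode z θ ≤ 1 := by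
  cases mode with
  | nonpreemptive => exact le_rfl
  | preemptive => simp only [deliveredFeature]; split_ifs <;> simp

theorem ofReal_waiting_succ (ω : Outcome) (i : ℕ) :
    ENNReal.ofReal (waiting mode ξ π ω (i + 1)) =
      waitingFeature mode (fresh mode i ω) (delay mode ξ π ω (stepOf mode i)) := by
  cases mode with
  | nonpreemptive => rfl
  | preemptive => exact ENNReal.ofReal_zero

theorem freshT_fresh (i : ℕ) (ω : Outcome) : freshT mode (fresh mode i ω) = ω.T (i + 1) := by
  cases mode <;> rfl

theorem freshC_fresh (i : ℕ) (ω : Outcome) : freshC mode (fresh mode i ω) = ω.C (i + 1) := by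
  cases mode <;> rfl

-- Generation time, transmission and waiting of packet i + 1 cancel from the delivery condition;
-- under preemption what remains compares its computation time with the following delay and
-- transmission time.
open Classical in
theorem deliveredFeature_fresh (ω : Outcome) (i : ℕ) :
    deliveredFeature mode (fresh mode i ω) (delay mode ξ π ω (stepOf mode i)) =
      if Delivered mode ξ π ω (i + 1) then 1 else 0 := by
  cases mode with
  | nonpreemptive => simp [deliveredFeature, Delivered]
  | preemptive =>
    have : Delivered .preemptive ξ π ω (i + 1) ↔
        ω.C (i + 1) ≤ delay .preemptive ξ π ω (i + 1) + ω.T (i + 2) := by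
      simp only [Delivered, deliveryTime, generationTime, Finset.sum_range_succ _ (i + 1),
        interGeneration]
      constructor <;> intro h <;> linarith
    simp only [deliveredFeature, fresh, stepOf]
    exact if_congr this.symm rfl rfl

theorem resample_sampSeed (i : ℕ) (ω : Outcome) (z : ℝ × ℝ × ℝ) :
    (resample mode i ω z).sampSeed = ω.sampSeed := by
  cases mode <;> rfl

theorem resample_schedSeed (i : ℕ) (ω : Outcome) (z : ℝ × ℝ × ℝ) :
    (resample mode i ω z).schedSeed = ω.schedSeed := by
  cases mode <;> rfl

theorem resample_T (i : ℕ) (ω : Outcome) (z : ℝ × ℝ × ℝ) {j : ℕ} (hj : j ≤ i) :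
    (resample mode i ω z).T j = ω.T j := by
  cases mode <;> simp [resample, Outcome.T, Function.update, show j ≠ i + 1 by omega,
    show j ≠ i + 2 by omega]

theorem resample_C (i : ℕ) (ω : Outcome) (z : ℝ × ℝ × ℝ) {j : ℕ} (hj : j < i) :
    (resample mode i ω z).C j = ω.C j := by
  cases mode <;> simp [resample, Outcome.C, Function.update, show j ≠ i + 1 by omega,
    show j ≠ i by omega]

theorem fresh_resample (i : ℕ) (ω : Outcome) (z : ℝ × ℝ × ℝ) :
    fresh mode i (resample mode i ω z) = z := by
  cases mode <;> simp [fresh, resample, Outcome.C, Outcome.T, Function.update]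

/-- The source of packet i + 1 is fixed when packet i enters service, before any of the resampled
times is revealed. The whole argument rests on this independence. -/
theorem nextSource_resample (i : ℕ) (ω : Outcome) (z : ℝ × ℝ × ℝ) :
    nextSource mode ξ π (resample mode i ω z) i = nextSource mode ξ π ω i :=
  nextSource_congr (resample_schedSeed mode i ω z) i (fun _ hj => resample_T mode i ω z hj)
    (fun _ hj => resample_C mode i ω z hj) (fun _ _ => by rw [resample_sampSeed])

theorem measurable_resample (i : ℕ) :
    Measurable fun p : Outcome × (ℝ × ℝ × ℝ) => resample mode i p.1 p.2 := by
  have hu : ∀ (n : ℕ) (f : Outcome × (ℝ × ℝ × ℝ) → ℕ → ℝ) (g : Outcome × (ℝ × ℝ × ℝ) → ℝ),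
      Measurable f → Measurable g → Measurable fun p => Function.update (f p) n (g p) := by
    intro n f g hf hg
    refine measurable_pi_lambda _ fun j => ?_
    by_cases h : j = n
    · subst h; simpa using hg
    · simpa [Function.update, h, Function.comp_def] using (measurable_pi_apply j).comp hf
  cases mode with
  | nonpreemptive =>
    exact (hu _ _ _ (by fun_prop) (by fun_prop)).prodMk
      ((hu _ _ _ (hu _ _ _ (by fun_prop) (by fun_prop)) (by fun_prop)).prodMk (by fun_prop))
  | preemptive =>
    exact (hu _ _ _ (hu _ _ _ (by fun_prop) (by fun_prop)) (by fun_prop)).prodMk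
      ((hu _ _ _ (by fun_prop) (by fun_prop)).prodMk (by fun_prop))

/-- The delay of step `stepOf mode i` as a function of the observed part of the fresh times. -/
noncomputable def delayGiven (i : ℕ) (ω : Outcome) (t c : ℝ) : ℝ :=
  delay mode ξ π (resample mode i ω (ofObserved mode t c)) (stepOf mode i)

/-- At the deciding step, the only fresh time that can already be in the history is the transmission
time of packet i + 1, in the preemptive system. -/
theorem resample_congr (i : ℕ) (ω : Outcome) {z z' : ℝ × ℝ × ℝ}
    (h : (observed mode z).1 = (observed mode z').1) :
    history mode ξ π (resample mode i ω z) (stepOf mode i) =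
        history mode ξ π (resample mode i ω z') (stepOf mode i) ∧
      nextSource mode ξ π (resample mode i ω z) (stepOf mode i) =
        nextSource mode ξ π (resample mode i ω z') (stepOf mode i) := by
  have hS : (resample mode i ω z).schedSeed = (resample mode i ω z').schedSeed := by
    rw [resample_schedSeed, resample_schedSeed]
  have hT : ∀ j ≤ stepOf mode i, (resample mode i ω z).T j = (resample mode i ω z').T j := by
    intro j hj
    cases mode with
    | nonpreemptive => exact (resample_T _ _ _ _ hj).trans (resample_T _ _ _ _ hj).symm
    | preemptive =>
      rcases Nat.lt_or_eq_of_le hj with hj | rfl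
      · rw [resample_T _ _ _ _ (Nat.lt_succ_iff.1 hj), resample_T _ _ _ _ (Nat.lt_succ_iff.1 hj)]
      · simpa [resample, Outcome.T, Function.update, stepOf, observed] using h
  have hC : ∀ j < stepOf mode i, (resample mode i ω z).C j = (resample mode i ω z').C j := by
    intro j hj
    cases mode with
    | nonpreemptive => exact (resample_C _ _ _ _ hj).trans (resample_C _ _ _ _ hj).symm
    | preemptive =>
      simp [stepOf] at hj
      simp [resample, Outcome.C, Function.update, show j ≠ i + 1 by omega]
  have hπ : ∀ j < stepOf mode i, π.delay j (resample mode i ω z).sampSeed =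
      π.delay j (resample mode i ω z').sampSeed := by
    intro j _
    rw [resample_sampSeed, resample_sampSeed]
  exact ⟨history_congr hS _ hT hC hπ, nextSource_congr hS _ hT hC hπ⟩

theorem resample_C_stepOf (i : ℕ) (ω : Outcome) (z : ℝ × ℝ × ℝ) :
    (resample mode i ω z).C (stepOf mode i) = (observed mode z).2 := by
  cases mode <;> simp [resample, Outcome.C, Function.update, stepOf, observed]

/-- With the rest of the outcome frozen, the deciding delay sees the fresh times only through their
observed part, so each step of a policy is a one-step rule. -/
theorem delay_resample (i : ℕ) (ω : Outcome) (z : ℝ × ℝ × ℝ) :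
    delay mode ξ π (resample mode i ω z) (stepOf mode i) =
      delayGiven mode ξ π i ω (observed mode z).1 (observed mode z).2 := by
  have h : observed mode (ofObserved mode (observed mode z).1 (observed mode z).2) =
      observed mode z := by
    cases mode <;> rfl
  obtain ⟨h1, h2⟩ := resample_congr mode ξ π i ω (z := z)
    (z' := ofObserved mode (observed mode z).1 (observed mode z).2) (by rw [h])
  simp only [delayGiven, delay, h1, h2, resample_sampSeed, resample_C_stepOf, h]

theorem delayGiven_nonneg (i : ℕ) (ω : Outcome) (t c : ℝ) : 0 ≤ delayGiven mode ξ π i ω t c :=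
  delay_nonneg _ _ _ _ _

theorem delayGiven_nonanticipating (i : ℕ) (ω : Outcome) (t c c' : ℝ)
    (h : delayGiven mode ξ π i ω t c < c) (h' : delayGiven mode ξ π i ω t c < c') :
    delayGiven mode ξ π i ω t c' = delayGiven mode ξ π i ω t c := by
  have h0 : ∀ c, (observed mode (ofObserved mode t c)).2 = c := by intro c; cases mode <;> rfl
  obtain ⟨h1, h2⟩ := resample_congr mode ξ π i ω (z := ofObserved mode t c')
    (z' := ofObserved mode t c) (by cases mode <;> rfl)
  simp only [delayGiven, delay, h1, h2, resample_sampSeed, resample_C_stepOf, h0] at h h' ⊢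
  exact π.nonanticipating _ _ _ _ _ _ h h'

theorem measurable_delayGiven (i : ℕ) :
    Measurable fun p : Outcome × ℝ × ℝ => delayGiven mode ξ π i p.1 p.2.1 p.2.2 := by
  refine (measurable_delay mode ξ π (stepOf mode i)).comp
    ((measurable_resample mode i).comp (measurable_fst.prodMk ?_))
  cases mode
  · exact (measurable_snd.comp measurable_snd).prodMk measurable_const
  · exact (measurable_fst.comp measurable_snd).prodMk
      ((measurable_snd.comp measurable_snd).prodMk measurable_const)

end Dynamics


/-! ### Features by source, and the telescoping of the peak ages. -/

section Pathwise

variable {M : ℕ} (mode : Mode) (ξ : Scheduler M) (π : Sampler M)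

/-- A feature of packet `i + 1`, counted only if that packet comes from source `m`. -/
noncomputable def sourceFeature (F : ℝ × ℝ × ℝ → ℝ → ENNReal) (m : Fin M) (i : ℕ) (ω : Outcome) :
    ENNReal :=
  if nextSource mode ξ π ω i = m then F (fresh mode i ω) (delay mode ξ π ω (stepOf mode i)) else 0

theorem measurableSet_nextSource_eq (m : Fin M) (i : ℕ) :
    MeasurableSet {ω | nextSource mode ξ π ω i = m} :=
  measurable_nextSource mode ξ π i (measurableSet_singleton m)

theorem measurable_sourceFeature {F : ℝ × ℝ × ℝ → ℝ → ENNReal}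
    (hF : Measurable fun p : (ℝ × ℝ × ℝ) × ℝ => F p.1 p.2) (m : Fin M) (i : ℕ) :
    Measurable (sourceFeature mode ξ π F m i) :=
  Measurable.ite (measurableSet_nextSource_eq mode ξ π m i)
    (hF.comp ((measurable_fresh mode i).prodMk (measurable_delay mode ξ π _))) measurable_const

theorem sum_sourceFeature (F : ℝ × ℝ × ℝ → ℝ → ENNReal) (i : ℕ) (ω : Outcome) :
    ∑ m, sourceFeature mode ξ π F m i ω =
      F (fresh mode i ω) (delay mode ξ π ω (stepOf mode i)) := by
  simp [sourceFeature]

open Classical in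
theorem sourceFeature_delivered (m : Fin M) (i : ℕ) (ω : Outcome) :
    sourceFeature mode ξ π (deliveredFeature mode) m i ω =
      if DeliveredFrom mode ξ π ω m i then 1 else 0 := by
  simp only [sourceFeature, deliveredFeature_fresh, DeliveredFrom]
  split_ifs <;> simp_all

theorem measurableSet_deliveredFrom (m : Fin M) (i : ℕ) :
    MeasurableSet {ω | DeliveredFrom mode ξ π ω m i} := by
  classical
  have h := measurable_sourceFeature mode ξ π (measurable_deliveredFeature mode) m i
    (measurableSet_singleton 1)
  convert h using 1
  ext ω
  simp [sourceFeature_delivered]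

theorem deliveredCount_eq (m : Fin M) (N : ℕ) (ω : Outcome) :
    (deliveredCount mode ξ π ω m N : ENNReal) =
      ∑ i ∈ Finset.range N, sourceFeature mode ξ π (deliveredFeature mode) m i ω := by
  classical
  simp [deliveredCount, sourceFeature_delivered]

theorem scheduledCount_eq (m : Fin M) (N : ℕ) (ω : Outcome) :
    (scheduledCount mode ξ π ω m N : ENNReal) =
      ∑ i ∈ Finset.range N, sourceFeature mode ξ π (fun _ _ => 1) m i ω := by
  classical
  simp [scheduledCount, sourceFeature]

theorem lastDelivered_le (ω : Outcome) (m : Fin M) (N : ℕ) :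
    lastDelivered mode ξ π ω m N ≤ N := by
  classical
  induction N with
  | zero => exact le_rfl
  | succ N ih =>
    simp only [lastDelivered]
    split_ifs
    · exact le_rfl
    · omega

theorem lt_lastDelivered {ω : Outcome} {m : Fin M} {i N : ℕ} (hi : i < N)
    (h : DeliveredFrom mode ξ π ω m i) : i < lastDelivered mode ξ π ω m N := by
  classical
  induction N with
  | zero => omega
  | succ N ih =>
    simp only [lastDelivered]
    split_ifs with h'
    · exact hi
    · exact ih (lt_of_le_of_ne (Nat.lt_succ_iff.1 hi) (by rintro rfl; exact h' h))

theorem measurable_lastDelivered (m : Fin M) (N : ℕ) :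
    Measurable fun ω => lastDelivered mode ξ π ω m N := by
  classical
  induction N with
  | zero => exact measurable_const
  | succ N ih =>
    simp only [lastDelivered]
    exact Measurable.ite (measurableSet_deliveredFrom mode ξ π m N) measurable_const ih

theorem interGeneration_nonneg {ω : Outcome} (hT : ∀ i, 0 ≤ ω.T i) (i : ℕ) :
    0 ≤ interGeneration mode ξ π ω i :=
  add_nonneg (add_nonneg (hT i) (waiting_nonneg _ _ _ _ _)) (delay_nonneg _ _ _ _ _)

theorem measurable_peakSum (m : Fin M) (N : ℕ) : Measurable fun ω => peakSum mode ξ π ω m N := by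
  classical
  have hg : ∀ i, Measurable fun ω => generationTime mode ξ π ω i := fun i =>
    ((measurable_T 0).neg.sub (measurable_C 0)).add
      (Finset.measurable_sum _ fun j _ => measurable_interGeneration mode ξ π j)
  have hl : ∀ i, Measurable fun ω =>
      generationTime mode ξ π ω (lastDelivered mode ξ π ω m i) := fun i =>
    (measurable_from_prod_countable_left (f := fun p : Outcome × ℕ =>
      generationTime mode ξ π p.1 p.2) hg).comp
      (measurable_id.prodMk (measurable_lastDelivered mode ξ π m i))
  simp only [peakSum, Finset.sum_filter]
  refine Finset.measurable_sum _ fun i _ =>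
    Measurable.ite (measurableSet_deliveredFrom mode ξ π m i) ?_ measurable_const
  exact (((((hg _).add (measurable_T _)).add (measurable_waiting mode ξ π _)).add
    (measurable_C _)).sub (hl i)).ennreal_ofReal

/-- A peak is the time in the system of the delivered packet plus the inter-generation times since
the previously delivered packet of that source; these blocks concatenate. Nonnegativity makes
`ENNReal.ofReal` additive. -/
theorem peakSum_eq {ω : Outcome} (hT : ∀ i, 0 ≤ ω.T i) (hC : ∀ i, 0 ≤ ω.C i) (m : Fin M) (N : ℕ) :
    peakSum mode ξ π ω m N =
      ∑ i ∈ Finset.range N, sourceFeature mode ξ π (systemFeature mode) m i ω +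
      ∑ j ∈ Finset.range (lastDelivered mode ξ π ω m N),
        ENNReal.ofReal (interGeneration mode ξ π ω j) := by
  classical
  have hZ := interGeneration_nonneg mode ξ π hT
  induction N with
  | zero => simp [peakSum, lastDelivered]
  | succ N ih =>
    have hs : peakSum mode ξ π ω m (N + 1) = peakSum mode ξ π ω m N +
        if DeliveredFrom mode ξ π ω m N then ENNReal.ofReal (peak mode ξ π ω m N) else 0 := by
      simp only [peakSum, Finset.sum_filter, Finset.sum_range_succ]
    have hsys : sourceFeature mode ξ π (systemFeature mode) m N ω =
        (if DeliveredFrom mode ξ π ω m N then 1 else 0) *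
          ENNReal.ofReal (ω.T (N + 1) + waiting mode ξ π ω (N + 1) + ω.C (N + 1)) := by
      rw [← sourceFeature_delivered, ENNReal.ofReal_add
        (add_nonneg (hT _) (waiting_nonneg _ _ _ _ _)) (hC _),
        ENNReal.ofReal_add (hT _) (waiting_nonneg _ _ _ _ _), ofReal_waiting_succ]
      simp only [sourceFeature, systemFeature, freshT_fresh, freshC_fresh]
      split_ifs <;> simp
    rw [hs, ih, Finset.sum_range_succ, hsys]
    simp only [lastDelivered]
    split_ifs with h
    · have hle := lastDelivered_le mode ξ π ω m N
      have hpk : peak mode ξ π ω m N =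
          (ω.T (N + 1) + waiting mode ξ π ω (N + 1) + ω.C (N + 1)) +
            ∑ j ∈ Finset.Ico (lastDelivered mode ξ π ω m N) (N + 1),
              interGeneration mode ξ π ω j := by
        simp only [peak, deliveryTime, generationTime]
        rw [← Finset.sum_range_add_sum_Ico _ (show lastDelivered mode ξ π ω m N ≤ N + 1 by omega)]
        ring
      rw [hpk, ENNReal.ofReal_add
        (add_nonneg (add_nonneg (hT _) (waiting_nonneg _ _ _ _ _)) (hC _))
        (Finset.sum_nonneg fun j _ => hZ j), ENNReal.ofReal_sum_of_nonneg (fun j _ => hZ j),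
        ← Finset.sum_range_add_sum_Ico (fun j => ENNReal.ofReal (interGeneration mode ξ π ω j))
          (show lastDelivered mode ξ π ω m N ≤ N + 1 by omega)]
      ring
    · simp

end Pathwise


/-! ### Independence, expressed as invariance of the law under resampling. -/

section Law

/-- The measure `μ` is invariant under the random modification `u`, whose randomness has law `ν`. -/
def ResampleInvariant {A Y : Type*} [MeasurableSpace A] [MeasurableSpace Y] (μ : Measure A)
    (ν : Measure Y) (u : A → Y → A) : Prop :=
  (Measurable fun p : A × Y => u p.1 p.2) ∧
    ∀ H : A → ENNReal, Measurable H → ∫⁻ x, H x ∂μ = ∫⁻ x, ∫⁻ y, H (u x y) ∂ν ∂μ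

theorem ResampleInvariant.fst {A B Y : Type*} [MeasurableSpace A] [MeasurableSpace B]
    [MeasurableSpace Y] {μ : Measure A} {ν : Measure Y} [SFinite μ] [SFinite ν] {u : A → Y → A}
    (h : ResampleInvariant μ ν u) (μ' : Measure B) [SFinite μ'] :
    ResampleInvariant (μ.prod μ') ν fun p y => (u p.1 y, p.2) := by
  have hu := h.1
  have hm : Measurable fun q : (A × B) × Y => (u q.1.1 q.2, q.1.2) :=
    (hu.comp ((measurable_fst.comp measurable_fst).prodMk measurable_snd)).prodMk
      (measurable_snd.comp measurable_fst)
  refine ⟨hm, fun H hH => ?_⟩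
  have hm' : Measurable fun q : (A × B) × Y => H (u q.1.1 q.2, q.1.2) := hH.comp hm
  rw [lintegral_prod_symm _ hH.aemeasurable,
    lintegral_prod_symm _ (Measurable.lintegral_prod_right' hm').aemeasurable]
  exact lintegral_congr fun b => h.2 (fun a => H (a, b)) (hH.comp measurable_prodMk_right)

theorem ResampleInvariant.snd {A B Y : Type*} [MeasurableSpace A] [MeasurableSpace B]
    [MeasurableSpace Y] {μ : Measure A} {ν : Measure Y} [SFinite μ] [SFinite ν] {u : A → Y → A}
    (h : ResampleInvariant μ ν u) (μ' : Measure B) :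
    ResampleInvariant (μ'.prod μ) ν fun p y => (p.1, u p.2 y) := by
  have hu := h.1
  have hm : Measurable fun q : (B × A) × Y => (q.1.1, u q.1.2 q.2) :=
    (measurable_fst.comp measurable_fst).prodMk
      (hu.comp ((measurable_snd.comp measurable_fst).prodMk measurable_snd))
  refine ⟨hm, fun H hH => ?_⟩
  have hm' : Measurable fun q : (B × A) × Y => H (q.1.1, u q.1.2 q.2) := hH.comp hm
  rw [lintegral_prod _ hH.aemeasurable,
    lintegral_prod _ (Measurable.lintegral_prod_right' hm').aemeasurable]
  exact lintegral_congr fun b => h.2 (fun a => H (b, a)) (hH.comp measurable_prodMk_left)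

/-- Allows coordinates to be resampled one at a time, the replacements being independent. -/
theorem ResampleInvariant.trans {A Y Y' : Type*} [MeasurableSpace A]
    [MeasurableSpace Y] [MeasurableSpace Y'] {μ : Measure A} {ν : Measure Y} {ν' : Measure Y'}
    [SFinite ν'] {u : A → Y → A} {u' : A → Y' → A}
    (h : ResampleInvariant μ ν u) (h' : ResampleInvariant μ ν' u') :
    ResampleInvariant μ (ν.prod ν') fun x p => u' (u x p.1) p.2 := by
  have hu := h.1
  have hu' := h'.1
  have hm : Measurable fun q : A × Y × Y' => u' (u q.1 q.2.1) q.2.2 :=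
    hu'.comp ((hu.comp (measurable_fst.prodMk (measurable_fst.comp measurable_snd))).prodMk
      (measurable_snd.comp measurable_snd))
  refine ⟨hm, fun H hH => ?_⟩
  have hm' : Measurable fun q : A × Y' => H (u' q.1 q.2) := hH.comp hu'
  rw [h'.2 H hH, h.2 _ (Measurable.lintegral_prod_right' hm')]
  refine lintegral_congr fun x => ?_
  exact (lintegral_prod (fun p : Y × Y' => H (u' (u x p.1) p.2))
    (hH.comp (hm.comp measurable_prodMk_left)).aemeasurable).symm

/-- A box splits into its constraints off n and the one at n, so an independent copy in place n does
not change the measure of boxes, and these determine the product law. -/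
theorem resampleInvariant_infinitePi {X : Type*} [MeasurableSpace X] (μ : Measure X)
    [IsProbabilityMeasure μ] (n : ℕ) :
    ResampleInvariant (Measure.infinitePi fun _ : ℕ => μ) μ fun x y => Function.update x n y := by
  have hmeas : Measurable fun p : (ℕ → X) × X => Function.update p.1 n p.2 := by
    refine measurable_pi_lambda _ fun j => ?_
    by_cases h : j = n
    · subst h; simpa using measurable_snd
    · simpa [Function.update, h, Function.comp_def] using
        (measurable_pi_apply j).comp measurable_fst
  refine ⟨hmeas, fun H hH => ?_⟩
  have hmap : (Measure.infinitePi fun _ : ℕ => μ) =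
      ((Measure.infinitePi fun _ : ℕ => μ).prod μ).map
        (fun p : (ℕ → X) × X => Function.update p.1 n p.2) := by
    refine (Measure.eq_infinitePi _ fun s t ht => ?_).symm
    rw [Measure.map_apply hmeas (MeasurableSet.pi s.countable_toSet fun i _ => ht i)]
    have hpre : (fun p : (ℕ → X) × X => Function.update p.1 n p.2) ⁻¹' (Set.pi s t) =
        (Set.pi (s.erase n) t) ×ˢ (if n ∈ s then t n else Set.univ) := by
      ext ⟨x, y⟩
      simp only [Set.mem_preimage, Set.mem_pi, Finset.mem_coe, Set.mem_prod, Finset.mem_erase]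
      constructor
      · intro h
        refine ⟨fun i hi => by simpa [Function.update, hi.1] using h i hi.2, ?_⟩
        split_ifs with hn
        · simpa using h n hn
        · trivial
      · rintro ⟨h1, h2⟩ i hi
        by_cases hin : i = n
        · subst hin; simpa [hi] using h2
        · simpa [Function.update, hin] using h1 i ⟨hin, hi⟩
    rw [hpre, Measure.prod_prod, Measure.infinitePi_pi _ (fun i _ => ht i)]
    split_ifs with hn
    · rw [Finset.prod_erase_mul _ _ hn]
    · rw [Finset.erase_eq_of_notMem hn]; simp
  conv_lhs => rw [hmap]
  rw [lintegral_map hH hmeas]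
  exact lintegral_prod (fun p : (ℕ → X) × X => H (Function.update p.1 n p.2))
    (hH.comp hmeas).aemeasurable

variable {M : ℕ} (mode : Mode) (μT μC : Measure ℝ)
  [IsProbabilityMeasure μT] [IsProbabilityMeasure μC]

instance : IsProbabilityMeasure (law μT μC) := by unfold law; infer_instance

/-- The law of the fresh times of a packet. -/
noncomputable def freshLaw : Measure (ℝ × ℝ × ℝ) :=
  match mode with
  | .nonpreemptive => μC.prod (μT.prod μC)
  | .preemptive => μT.prod (μC.prod μT)

instance : IsProbabilityMeasure (freshLaw mode μT μC) := by
  cases mode <;> simp only [freshLaw] <;> infer_instance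

theorem resampleInvariant_T (n : ℕ) : ResampleInvariant (law μT μC) μT
    fun ω t => (Function.update ω.1 n t, ω.2) :=
  (resampleInvariant_infinitePi μT n).fst _

theorem resampleInvariant_C (n : ℕ) : ResampleInvariant (law μT μC) μC
    fun ω c => (ω.1, Function.update ω.2.1 n c, ω.2.2) :=
  ((resampleInvariant_infinitePi μC n).fst _).snd _

theorem resampleInvariant_sampSeed (n : ℕ) :
    ResampleInvariant (law μT μC) (volume : Measure unitInterval)
    fun ω u => (ω.1, ω.2.1, ω.2.2.1, Function.update ω.2.2.2 n u) :=
  (((resampleInvariant_infinitePi (volume : Measure unitInterval) n).snd _).snd _).snd _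

theorem resampleInvariant_resample (i : ℕ) :
    ResampleInvariant (law μT μC) (freshLaw mode μT μC) (resample mode i) := by
  cases mode with
  | nonpreemptive =>
    exact (resampleInvariant_C μT μC i).trans
      ((resampleInvariant_T μT μC (i + 1)).trans (resampleInvariant_C μT μC (i + 1)))
  | preemptive =>
    exact (resampleInvariant_T μT μC (i + 1)).trans
      ((resampleInvariant_C μT μC (i + 1)).trans (resampleInvariant_T μT μC (i + 2)))

/-- Replace the private randomness of the sampler at step `n`. -/
def reseed (n : ℕ) (ω : Outcome) (u : unitInterval) : Outcome :=
  (ω.1, ω.2.1, ω.2.2.1, Function.update ω.2.2.2 n u)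

/-- Replace the private randomness of step `stepOf mode i` and the fresh times of packet `i + 1`. -/
def renew (i : ℕ) (ω : Outcome) (p : unitInterval × (ℝ × ℝ × ℝ)) : Outcome :=
  resample mode i (reseed (stepOf mode i) ω p.1) p.2

theorem resampleInvariant_renew (i : ℕ) :
    ResampleInvariant (law μT μC) ((volume : Measure unitInterval).prod (freshLaw mode μT μC))
      (renew mode i) :=
  (resampleInvariant_sampSeed μT μC _).trans (resampleInvariant_resample mode μT μC i)

theorem map_T_law (i : ℕ) : (law μT μC).map (fun ω => ω.T i) = μT := by
  have h1 : MeasurePreserving (Prod.fst : Outcome → _) (law μT μC)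
      (Measure.infinitePi fun _ : ℕ => μT) := measurePreserving_fst
  exact ((measurePreserving_eval_infinitePi (fun _ : ℕ => μT) i).comp h1).map_eq

theorem map_C_law (i : ℕ) : (law μT μC).map (fun ω => ω.C i) = μC := by
  have h1 : MeasurePreserving (fun ω : Outcome => ω.2) (law μT μC) _ := measurePreserving_snd
  have h2 := (measurePreserving_fst (μ := Measure.infinitePi fun _ : ℕ => μC)
    (ν := (Measure.infinitePi (fun _ : ℕ => (volume : Measure unitInterval))).prod
        (Measure.infinitePi (fun _ : ℕ => (volume : Measure unitInterval))))).comp h1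
  exact ((measurePreserving_eval_infinitePi (fun _ : ℕ => μC) i).comp h2).map_eq

theorem ae_T_pos (hT : ∀ᵐ t ∂μT, 0 < t) : ∀ᵐ ω ∂(law μT μC), ∀ i, 0 < ω.T i := by
  rw [ae_all_iff]
  intro i
  rw [← map_T_law μT μC i] at hT
  exact ae_of_ae_map (measurable_T i).aemeasurable hT

theorem ae_C_pos (hC : ∀ᵐ c ∂μC, 0 < c) : ∀ᵐ ω ∂(law μT μC), ∀ i, 0 < ω.C i := by
  rw [ae_all_iff]
  intro i
  rw [← map_C_law μT μC i] at hC
  exact ae_of_ae_map (measurable_C i).aemeasurable hC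

theorem lintegral_T {h : ℝ → ENNReal} (hh : Measurable h) (i : ℕ) :
    ∫⁻ ω, h (ω.T i) ∂(law μT μC) = ∫⁻ t, h t ∂μT := by
  rw [← lintegral_map hh (measurable_T i), map_T_law]

theorem lintegral_C {h : ℝ → ENNReal} (hh : Measurable h) (i : ℕ) :
    ∫⁻ ω, h (ω.C i) ∂(law μT μC) = ∫⁻ c, h c ∂μC := by
  rw [← lintegral_map hh (measurable_C i), map_C_law]

theorem lintegral_freshT {h : ℝ → ENNReal} (hh : Measurable h) :
    ∫⁻ z, h (freshT mode z) ∂(freshLaw mode μT μC) = ∫⁻ t, h t ∂μT := by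
  cases mode with
  | nonpreemptive =>
    exact ((measurePreserving_fst (μ := μT) (ν := μC)).comp
      (measurePreserving_snd (μ := μC) (ν := μT.prod μC))).lintegral_comp hh
  | preemptive => exact (measurePreserving_fst (μ := μT) (ν := μC.prod μT)).lintegral_comp hh

theorem lintegral_freshC {h : ℝ → ENNReal} (hh : Measurable h) :
    ∫⁻ z, h (freshC mode z) ∂(freshLaw mode μT μC) = ∫⁻ t, h t ∂μC := by
  cases mode with
  | nonpreemptive =>
    exact ((measurePreserving_snd (μ := μT) (ν := μC)).comp
      (measurePreserving_snd (μ := μC) (ν := μT.prod μC))).lintegral_comp hh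
  | preemptive =>
    exact ((measurePreserving_fst (μ := μC) (ν := μT)).comp
      (measurePreserving_snd (μ := μT) (ν := μC.prod μT))).lintegral_comp hh

theorem lintegral_observed {h : ℝ → ENNReal} (hh : Measurable h) :
    ∫⁻ z, h (observed mode z).2 ∂(freshLaw mode μT μC) = ∫⁻ t, h t ∂μC := by
  cases mode with
  | nonpreemptive => exact (measurePreserving_fst (μ := μC) (ν := μT.prod μC)).lintegral_comp hh
  | preemptive =>
    exact ((measurePreserving_fst (μ := μC) (ν := μT)).comp
      (measurePreserving_snd (μ := μT) (ν := μC.prod μT))).lintegral_comp hh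

/-- All the fresh times are positive. -/
def FreshPos (z : ℝ × ℝ × ℝ) : Prop := 0 < z.1 ∧ 0 < z.2.1 ∧ 0 < z.2.2

theorem ae_freshPos (hT : ∀ᵐ t ∂μT, 0 < t) (hC : ∀ᵐ c ∂μC, 0 < c) :
    ∀ᵐ z ∂(freshLaw mode μT μC), FreshPos z := by
  have key : ∀ (μ₁ μ₂ μ₃ : Measure ℝ) [IsProbabilityMeasure μ₁] [IsProbabilityMeasure μ₂]
      [IsProbabilityMeasure μ₃], (∀ᵐ t ∂μ₁, 0 < t) → (∀ᵐ t ∂μ₂, 0 < t) → (∀ᵐ t ∂μ₃, 0 < t) →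
      ∀ᵐ z ∂(μ₁.prod (μ₂.prod μ₃)), FreshPos z := by
    intro μ₁ μ₂ μ₃ _ _ _ h1 h2 h3
    have m1 := measurePreserving_fst (μ := μ₁) (ν := μ₂.prod μ₃)
    have m2 := (measurePreserving_fst (μ := μ₂) (ν := μ₃)).comp
      (measurePreserving_snd (μ := μ₁) (ν := μ₂.prod μ₃))
    have m3 := (measurePreserving_snd (μ := μ₂) (ν := μ₃)).comp
      (measurePreserving_snd (μ := μ₁) (ν := μ₂.prod μ₃))
    filter_upwards [m1.quasiMeasurePreserving.ae h1, m2.quasiMeasurePreserving.ae h2,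
      m3.quasiMeasurePreserving.ae h3] with z a b c
    exact ⟨a, b, c⟩
  cases mode with
  | nonpreemptive => exact key _ _ _ hC hT hC
  | preemptive => exact key _ _ _ hT hC hT

end Law

/-! ### One-step rules: waiting, truncation and mixture. -/

/-- A randomized, non-anticipating rule for a single step: the delay as a function of a uniform
seed, a transmission time and a computation time. -/
structure Rule where
  /-- the delay -/
  act : unitInterval → ℝ → ℝ → ℝ
  measurable_act : Measurable fun p : unitInterval × ℝ × ℝ => act p.1 p.2.1 p.2.2
  act_nonneg (u : unitInterval) (t c : ℝ) : 0 ≤ act u t c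
  act_nonanticipating (u : unitInterval) (t c c' : ℝ) :
    act u t c < c → act u t c < c' → act u t c' = act u t c

namespace Rule

/-- Wait for the end of the computation, and then for a time `y`. -/
noncomputable def full (y : ℝ) (hy : 0 ≤ y) : Rule where
  act _ _ c := max c 0 + y
  measurable_act := by fun_prop
  act_nonneg _ _ c := add_nonneg (le_max_right _ _) hy
  act_nonanticipating _ _ c c' h := by
    have := le_max_left c 0
    linarith

/-- Wait no longer than until the end of the computation or `K`, whichever comes last. -/
noncomputable def trunc (K : ℝ) (hK : 0 ≤ K) (ρ : Rule) : Rule where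
  act u t c := min (ρ.act u t c) (max c K)
  measurable_act := by
    have := ρ.measurable_act
    fun_prop
  act_nonneg u t c := le_min (ρ.act_nonneg u t c) (hK.trans (le_max_right _ _))
  act_nonanticipating u t c c' h h' := by
    have h1 := le_max_left c K
    -- The truncation level is at least c, so a truncated delay below c is the original delay.
    have hlt : ρ.act u t c < c := by
      rcases min_lt_iff.1 h with h | h
      · exact h
      · linarith
    have hle : ρ.act u t c ≤ max c K := hlt.le.trans h1
    rw [min_eq_left hle] at h' ⊢
    rw [ρ.act_nonanticipating u t c c' hlt h', min_eq_left (h'.le.trans (le_max_left _ _))]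

/-- The square with its uniform law is a standard Borel probability space, hence an image of the
uniform law on the interval. A mixture needs one seed for the choice and another for the chosen
rule. -/
theorem exists_measurable_splitting : ∃ ψ : unitInterval → unitInterval × unitInterval,
    Measurable ψ ∧ (volume : Measure unitInterval).map ψ =
      (volume : Measure unitInterval).prod volume :=
  Measure.exists_measurable_map_eq _

/-- Two independent uniform seeds made out of one. -/
noncomputable def splitting : unitInterval → unitInterval × unitInterval :=
  exists_measurable_splitting.choose

theorem measurable_splitting : Measurable splitting := exists_measurable_splitting.choose_spec.1

theorem map_splitting : (volume : Measure unitInterval).map splitting =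
    (volume : Measure unitInterval).prod volume := exists_measurable_splitting.choose_spec.2

/-- Use the rule `ρ₁` with probability `a`, and the rule `ρ₂` otherwise. -/
noncomputable def mix (a : unitInterval) (ρ₁ ρ₂ : Rule) : Rule where
  act u t c := if (splitting u).1 ≤ a then ρ₁.act (splitting u).2 t c
    else ρ₂.act (splitting u).2 t c
  measurable_act := by
    have h0 := measurable_splitting
    have h1 : Measurable fun p : unitInterval × ℝ × ℝ => ((splitting p.1).2, p.2.1, p.2.2) := by
      fun_prop
    exact Measurable.ite (measurableSet_le (by fun_prop) measurable_const)
      (ρ₁.measurable_act.comp h1) (ρ₂.measurable_act.comp h1)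
  act_nonneg u t c := by
    split_ifs
    · exact ρ₁.act_nonneg _ _ _
    · exact ρ₂.act_nonneg _ _ _
  act_nonanticipating u t c c' := by
    split_ifs
    · exact ρ₁.act_nonanticipating _ _ _ _
    · exact ρ₂.act_nonanticipating _ _ _ _

end Rule

/-! ### Performance of a rule. -/

section Value

variable {M : ℕ} (mode : Mode) (μT μC : Measure ℝ)
  [IsProbabilityMeasure μT] [IsProbabilityMeasure μC]

/-- The expectation of a feature under a rule. -/
noncomputable def value (F : ℝ × ℝ × ℝ → ℝ → ENNReal) (ρ : Rule) : ENNReal :=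
  ∫⁻ p, F p.2 (ρ.act p.1 (observed mode p.2).1 (observed mode p.2).2)
    ∂((volume : Measure unitInterval).prod (freshLaw mode μT μC))

theorem measurable_observed : Measurable (observed mode) := by
  cases mode with
  | nonpreemptive => exact measurable_const.prodMk measurable_fst
  | preemptive => exact measurable_fst.prodMk (measurable_fst.comp measurable_snd)

theorem Rule.measurable_act_observed (ρ : Rule) :
    Measurable fun p : unitInterval × (ℝ × ℝ × ℝ) =>
      ρ.act p.1 (observed mode p.2).1 (observed mode p.2).2 := by
  have := measurable_observed mode
  exact ρ.measurable_act.comp (measurable_fst.prodMk (this.comp measurable_snd))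

theorem measurable_feature_act {F : ℝ × ℝ × ℝ → ℝ → ENNReal}
    (hF : Measurable fun p : (ℝ × ℝ × ℝ) × ℝ => F p.1 p.2) (ρ : Rule) :
    Measurable fun p : unitInterval × (ℝ × ℝ × ℝ) =>
      F p.2 (ρ.act p.1 (observed mode p.2).1 (observed mode p.2).2) :=
  hF.comp (measurable_snd.prodMk (ρ.measurable_act_observed mode))

/-- The half of the seed that selects the rule is independent of the half that drives it.
Performance is therefore affine under mixing. -/
theorem value_mix {F : ℝ × ℝ × ℝ → ℝ → ENNReal}
    (hF : Measurable fun p : (ℝ × ℝ × ℝ) × ℝ => F p.1 p.2) (a : unitInterval) (ρ₁ ρ₂ : Rule) :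
    value mode μT μC F (Rule.mix a ρ₁ ρ₂) = ENNReal.ofReal a * value mode μT μC F ρ₁ +
      ENNReal.ofReal (1 - a) * value mode μT μC F ρ₂ := by
  set G : Rule → unitInterval → ENNReal := fun ρ u =>
    ∫⁻ z, F z (ρ.act u (observed mode z).1 (observed mode z).2) ∂(freshLaw mode μT μC) with hG
  have hGm : ∀ ρ, Measurable (G ρ) := fun ρ =>
    (measurable_feature_act mode hF ρ).lintegral_prod_right'
  have hv : ∀ ρ, value mode μT μC F ρ = ∫⁻ u, G ρ u := fun ρ =>
    lintegral_prod _ (measurable_feature_act mode hF ρ).aemeasurable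
  rw [hv, hv, hv]
  have hmix : ∀ u, G (Rule.mix a ρ₁ ρ₂) u =
      (fun q : unitInterval × unitInterval =>
        (if q.1 ≤ a then G ρ₁ q.2 else G ρ₂ q.2)) (Rule.splitting u) := by
    intro u
    simp only [hG, Rule.mix]
    split_ifs <;> rfl
  have hm : Measurable fun q : unitInterval × unitInterval =>
      (if q.1 ≤ a then G ρ₁ q.2 else G ρ₂ q.2) :=
    Measurable.ite (measurableSet_le measurable_fst measurable_const)
      ((hGm _).comp measurable_snd) ((hGm _).comp measurable_snd)
  simp_rw [hmix]
  rw [← lintegral_map hm Rule.measurable_splitting, Rule.map_splitting,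
    lintegral_prod _ hm.aemeasurable]
  have hin : ∀ x : unitInterval, ∫⁻ y, (if x ≤ a then G ρ₁ y else G ρ₂ y) =
      (Set.Iic a).indicator (fun _ => ∫⁻ u, G ρ₁ u) x +
        (Set.Ioi a).indicator (fun _ => ∫⁻ u, G ρ₂ u) x := by
    intro x
    by_cases hx : x ≤ a
    · simp [hx]
    · simp [hx, not_le.1 hx]
  simp_rw [hin]
  rw [lintegral_add_left (measurable_const.indicator measurableSet_Iic),
    lintegral_indicator_const measurableSet_Iic, lintegral_indicator_const measurableSet_Ioi,
    unitInterval.volume_Iic, unitInterval.volume_Ioi, mul_comm, mul_comm (∫⁻ u, G ρ₂ u)]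

/-- A feature that does not change when a delay is truncated at the end of the computation or
later. -/
def TruncInvariant (F : ℝ × ℝ × ℝ → ℝ → ENNReal) : Prop :=
  ∀ z θ K, FreshPos z → F z (min θ (max (observed mode z).2 K)) = F z θ

/-- A delay that reaches the computation time already guarantees delivery, the next transmission
time being positive; shortening it to such a level costs nothing. -/
theorem truncInvariant_delivered : TruncInvariant mode (deliveredFeature mode) := by
  intro z θ K hz
  cases mode with
  | nonpreemptive => rfl
  | preemptive =>
    simp only [deliveredFeature, observed]
    refine if_congr ⟨fun h => h.trans (by gcongr; exact min_le_left _ _), fun h => ?_⟩ rfl rfl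
    rcases le_total θ (max z.2.1 K) with h' | h'
    · rwa [min_eq_left h']
    · rw [min_eq_right h']
      linarith [le_max_left z.2.1 K, hz.2.2]

/-- Likewise, after such a delay the next packet finds the server idle. -/
theorem truncInvariant_waiting : TruncInvariant mode (waitingFeature mode) := by
  intro z θ K hz
  cases mode with
  | nonpreemptive =>
    simp only [waitingFeature, observed]
    rcases le_total θ (max z.1 K) with h' | h'
    · rw [min_eq_left h']
    · have h1 := le_max_left z.1 K
      have h2 := hz.2.1
      rw [min_eq_right h', max_eq_left (by linarith), max_eq_left (by linarith)]
  | preemptive => rfl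

theorem truncInvariant_system : TruncInvariant mode (systemFeature mode) := by
  intro z θ K hz
  simp only [systemFeature, truncInvariant_delivered mode z θ K hz,
    truncInvariant_waiting mode z θ K hz]

theorem ae_freshPos_prod (hT : ∀ᵐ t ∂μT, 0 < t) (hC : ∀ᵐ c ∂μC, 0 < c) :
    ∀ᵐ p ∂((volume : Measure unitInterval).prod (freshLaw mode μT μC)), FreshPos p.2 :=
  (measurePreserving_snd (μ := (volume : Measure unitInterval))
    (ν := freshLaw mode μT μC)).quasiMeasurePreserving.ae (ae_freshPos mode μT μC hT hC)

theorem value_trunc (hT : ∀ᵐ t ∂μT, 0 < t) (hC : ∀ᵐ c ∂μC, 0 < c)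
    {F : ℝ × ℝ × ℝ → ℝ → ENNReal} (hF : TruncInvariant mode F) (K : ℝ) (hK : 0 ≤ K) (ρ : Rule) :
    value mode μT μC F (ρ.trunc K hK) = value mode μT μC F ρ := by
  refine lintegral_congr_ae ?_
  filter_upwards [ae_freshPos_prod mode μT μC hT hC] with p hp
  exact hF p.2 _ K hp

end Value

/-! ### Samplers that apply rules according to the source. -/

section RuleSampler

variable {M : ℕ} (mode : Mode)

/-- The sampler that uses, at step `n ≥ 1`, the rule `ρ n k`, where `k` is the source of the packet
whose fate is being decided: packet `n + 1` without preemption, packet `n` with preemption. -/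
noncomputable def ruleSampler (ρ : ℕ → Fin M → Rule) : Sampler M where
  delay n seed h m c :=
    match n, h with
    -- Packet 1 may not be generated before time 0, the end of the computation of packet 0.
    | 0, _ => max c 0
    | n + 1, h =>
      match mode with
      | .nonpreemptive => (ρ (n + 1) m).act (seed (n + 1)) 0 c
      -- The last record of the history contains the source of the packet now in service.
      | .preemptive => (ρ (n + 1) (h.1 (Fin.last n)).2.2.2).act (seed (n + 1)) h.2 c
  measurable_delay n := by
    cases n with
    | zero => exact (measurable_snd.comp (measurable_snd.comp measurable_snd)).max measurable_const
    | succ n =>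
      have hs : Measurable fun x : (ℕ → unitInterval) × History M (n + 1) × Fin M × ℝ =>
          x.1 (n + 1) := (measurable_pi_apply _).comp measurable_fst
      have hc : Measurable fun x : (ℕ → unitInterval) × History M (n + 1) × Fin M × ℝ =>
          x.2.2.2 := by fun_prop
      have key : Measurable fun x : Fin M × unitInterval × ℝ × ℝ =>
          (ρ (n + 1) x.1).act x.2.1 x.2.2.1 x.2.2.2 :=
        measurable_from_prod_countable_right fun m => (ρ (n + 1) m).measurable_act
      cases mode with
      | nonpreemptive =>
        have hm : Measurable fun x : (ℕ → unitInterval) × History M (n + 1) × Fin M × ℝ =>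
            x.2.2.1 := by fun_prop
        exact key.comp (hm.prodMk (hs.prodMk (measurable_const.prodMk hc)))
      | preemptive =>
        have hm : Measurable fun x : (ℕ → unitInterval) × History M (n + 1) × Fin M × ℝ =>
            (x.2.1.1 (Fin.last n)).2.2.2 := by fun_prop
        have ht : Measurable fun x : (ℕ → unitInterval) × History M (n + 1) × Fin M × ℝ =>
            x.2.1.2 := by fun_prop
        exact key.comp (hm.prodMk (hs.prodMk (ht.prodMk hc)))
  delay_nonneg n seed h m c := by
    cases n with
    | zero => exact le_max_right _ _
    | succ n => cases mode <;> exact (ρ _ _).act_nonneg _ _ _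
  nonanticipating n seed h m c c' := by
    cases n with
    | zero => intro h; exact absurd h (not_lt.2 (le_max_left _ _))
    | succ n => cases mode <;> exact (ρ _ _).act_nonanticipating _ _ _ _
  initial seed h m c := le_max_left _ _

variable (ξ : Scheduler M) (ρ : ℕ → Fin M → Rule)

/-- The condition `h0` makes the forced step 0 an instance of a rule; without preemption that step
decides the wait of packet 1 and cannot be left out. -/
theorem delay_ruleSampler (h0 : ∀ m u t c, (ρ 0 m).act u t c = max c 0) (i : ℕ) (ω : Outcome) :
    delay mode ξ (ruleSampler mode ρ) ω (stepOf mode i) =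
      (ρ (stepOf mode i) (nextSource mode ξ (ruleSampler mode ρ) ω i)).act
        (ω.sampSeed (stepOf mode i)) (observed mode (fresh mode i ω)).1
        (observed mode (fresh mode i ω)).2 := by
  cases mode with
  | nonpreemptive =>
    cases i with
    | zero => exact (h0 _ _ _ _).symm
    | succ i => rfl
  | preemptive =>
    simp only [delay, ruleSampler, stepOf, observed, fresh]
    have : ((history Mode.preemptive ξ (ruleSampler Mode.preemptive ρ) ω (i + 1)).1
        (Fin.last i)).2.2.2 = nextSource Mode.preemptive ξ (ruleSampler Mode.preemptive ρ) ω i := by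
      simp only [history, state, Fin.snoc_last]
      rfl
    simp only [ruleSampler] at this
    rw [this]
    rfl

theorem ruleSampler_delay_congr {n : ℕ} {s s' : ℕ → unitInterval} (h : s n = s' n) :
    (ruleSampler mode ρ).delay n s = (ruleSampler mode ρ).delay n s' := by
  funext h' m c
  cases n with
  | zero => rfl
  | succ n => cases mode <;> simp only [ruleSampler, h]

theorem renew_schedSeed (i : ℕ) (ω : Outcome) (p : unitInterval × (ℝ × ℝ × ℝ)) :
    (renew mode i ω p).schedSeed = ω.schedSeed := by
  rw [renew, resample_schedSeed]; rfl

theorem renew_T (i : ℕ) (ω : Outcome) (p : unitInterval × (ℝ × ℝ × ℝ)) {j : ℕ} (hj : j ≤ i) :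
    (renew mode i ω p).T j = ω.T j := by
  rw [renew, resample_T _ _ _ _ hj]; rfl

theorem renew_C (i : ℕ) (ω : Outcome) (p : unitInterval × (ℝ × ℝ × ℝ)) {j : ℕ} (hj : j < i) :
    (renew mode i ω p).C j = ω.C j := by
  rw [renew, resample_C _ _ _ _ hj]; rfl

theorem renew_sampSeed (i : ℕ) (ω : Outcome) (p : unitInterval × (ℝ × ℝ × ℝ)) :
    (renew mode i ω p).sampSeed = Function.update ω.sampSeed (stepOf mode i) p.1 := by
  rw [renew, resample_sampSeed]; rfl

theorem le_stepOf (i : ℕ) : i ≤ stepOf mode i := by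
  cases mode <;> simp [stepOf]

theorem nextSource_renew (i : ℕ) (ω : Outcome) (p : unitInterval × (ℝ × ℝ × ℝ)) {j : ℕ}
    (hj : j ≤ i) :
    nextSource mode ξ (ruleSampler mode ρ) (renew mode i ω p) j =
      nextSource mode ξ (ruleSampler mode ρ) ω j :=
  nextSource_congr (renew_schedSeed mode i ω p) j
    (fun _ hk => renew_T mode i ω p (hk.trans hj))
    (fun _ hk => renew_C mode i ω p (hk.trans_le hj))
    (fun k hk => ruleSampler_delay_congr mode ρ (by
      have := le_stepOf mode i
      simp [renew_sampSeed, Function.update, show k ≠ stepOf mode i by omega]))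

theorem measurable_feature_fresh_delay {F : ℝ × ℝ × ℝ → ℝ → ENNReal}
    (hF : Measurable fun p : (ℝ × ℝ × ℝ) × ℝ => F p.1 p.2) (π : Sampler M) (i : ℕ) :
    Measurable fun ω => F (fresh mode i ω) (delay mode ξ π ω (stepOf mode i)) :=
  hF.comp ((measurable_fresh mode i).prodMk (measurable_delay mode ξ π _))

theorem sourceFeature_renew (h0 : ∀ m u t c, (ρ 0 m).act u t c = max c 0)
    (F : ℝ × ℝ × ℝ → ℝ → ENNReal) (m : Fin M) (i : ℕ) (ω : Outcome)
    (p : unitInterval × (ℝ × ℝ × ℝ)) :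
    sourceFeature mode ξ (ruleSampler mode ρ) F m i (renew mode i ω p) =
      sourceFeature mode ξ (ruleSampler mode ρ) (fun _ _ => 1) m i ω *
        F p.2 ((ρ (stepOf mode i) m).act p.1 (observed mode p.2).1 (observed mode p.2).2) := by
  have hf : fresh mode i (renew mode i ω p) = p.2 := fresh_resample _ _ _ _
  simp only [sourceFeature, delay_ruleSampler mode ξ ρ h0, nextSource_renew mode ξ ρ i ω p le_rfl,
    hf, renew_sampSeed, Function.update_self]
  split_ifs with h
  · rw [h, one_mul]
  · simp

variable (μT μC : Measure ℝ) [IsProbabilityMeasure μT] [IsProbabilityMeasure μC]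

/-- Renewing the seed and the fresh times of packet i + 1 changes neither its source nor H, while
the feature becomes a function of the renewed data alone; the expectation factors. This replaces
conditioning on the past. -/
theorem lintegral_mul_sourceFeature_ruleSampler
    (h0 : ∀ m u t c, (ρ 0 m).act u t c = max c 0)
    {F : ℝ × ℝ × ℝ → ℝ → ENNReal} (hF : Measurable fun p : (ℝ × ℝ × ℝ) × ℝ => F p.1 p.2)
    {H : Outcome → ENNReal} (hH : Measurable H) (i : ℕ) (hinv : ∀ ω p, H (renew mode i ω p) = H ω)
    (m : Fin M) :
    ∫⁻ ω, H ω * sourceFeature mode ξ (ruleSampler mode ρ) F m i ω ∂(law μT μC) =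
      (∫⁻ ω, H ω * sourceFeature mode ξ (ruleSampler mode ρ) (fun _ _ => 1) m i ω ∂(law μT μC)) *
        value mode μT μC F (ρ (stepOf mode i) m) := by
  rw [(resampleInvariant_renew mode μT μC i).2
    (fun ω => H ω * sourceFeature mode ξ (ruleSampler mode ρ) F m i ω)
    (hH.mul (measurable_sourceFeature mode ξ _ hF m i))]
  simp only [hinv, sourceFeature_renew mode ξ ρ h0, ← mul_assoc]
  have hm : Measurable fun ω =>
      H ω * sourceFeature mode ξ (ruleSampler mode ρ) (fun _ _ => 1) m i ω :=
    hH.mul (measurable_sourceFeature mode ξ _ measurable_const m i)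
  rw [value, ← lintegral_mul_const _ hm]
  exact lintegral_congr fun ω => lintegral_const_mul _ (measurable_feature_act mode hF _)

end RuleSampler

/-! ### Reproducing the averages of a policy by a single rule. -/

section Simulation

variable {M : ℕ} (mode : Mode) (ξ : Scheduler M) (π : Sampler M)
  (μT μC : Measure ℝ) [IsProbabilityMeasure μT] [IsProbabilityMeasure μC]

/-- The expected total of a feature over the packets of source `m` among `1, …, N`. -/
noncomputable def total (F : ℝ × ℝ × ℝ → ℝ → ENNReal) (m : Fin M) (N : ℕ) : ENNReal :=
  ∑ i ∈ Finset.range N, ∫⁻ ω, sourceFeature mode ξ π F m i ω ∂(law μT μC)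

/-- The same resampling for an arbitrary policy: the past fixes a delay function, and the fresh
times keep their law given the source. -/
theorem lintegral_sourceFeature {F : ℝ × ℝ × ℝ → ℝ → ENNReal}
    (hF : Measurable fun p : (ℝ × ℝ × ℝ) × ℝ => F p.1 p.2) (m : Fin M) (i : ℕ) :
    ∫⁻ ω, sourceFeature mode ξ π F m i ω ∂(law μT μC) =
      ∫⁻ ω in {ω | nextSource mode ξ π ω i = m},
        ∫⁻ z, F z (delayGiven mode ξ π i ω (observed mode z).1 (observed mode z).2)
          ∂(freshLaw mode μT μC) ∂(law μT μC) := by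
  rw [(resampleInvariant_resample mode μT μC i).2 _ (measurable_sourceFeature mode ξ π hF m i),
    ← lintegral_indicator (measurableSet_nextSource_eq mode ξ π m i)]
  refine lintegral_congr fun ω => ?_
  simp only [sourceFeature, nextSource_resample, fresh_resample, delay_resample]
  by_cases h : nextSource mode ξ π ω i = m <;> simp [h]

theorem standardBorelSpace_outcome : StandardBorelSpace Outcome := by
  have : StandardBorelSpace (ℕ → unitInterval) := inferInstance
  have : StandardBorelSpace (ℕ → ℝ) := inferInstance
  have : StandardBorelSpace ((ℕ → unitInterval) × (ℕ → unitInterval)) := StandardBorelSpace.prod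
  have : StandardBorelSpace ((ℕ → ℝ) × (ℕ → unitInterval) × (ℕ → unitInterval)) :=
    StandardBorelSpace.prod
  exact StandardBorelSpace.prod

/-- There is a single rule that reproduces the average performance of the first steps of a policy
on the packets of source `m`. -/
theorem exists_rule_value_eq (m : Fin M) (N : ℕ)
    (hN : total mode ξ π μT μC (fun _ _ => 1) m N ≠ 0) :
    ∃ ρ : Rule, ∀ F : ℝ × ℝ × ℝ → ℝ → ENNReal,
      (Measurable fun p : (ℝ × ℝ × ℝ) × ℝ => F p.1 p.2) →
        value mode μT μC F ρ =
          (total mode ξ π μT μC (fun _ _ => 1) m N)⁻¹ * total mode ξ π μT μC F m N := by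
  set κ := total mode ξ π μT μC (fun _ _ => 1) m N with hκ
  have hκi : ∀ i, ∫⁻ ω, sourceFeature mode ξ π (fun _ _ => 1) m i ω ∂(law μT μC) =
      law μT μC {ω | nextSource mode ξ π ω i = m} := by
    intro i
    rw [lintegral_sourceFeature mode ξ π μT μC measurable_const]
    simp
  have hκtop : κ ≠ ⊤ := by
    simp only [hκ, total, hκi]
    exact (ENNReal.sum_lt_top.2 fun i _ => measure_lt_top _ _).ne
  -- The law of a packet number together with an outcome in which that packet comes from m; κ is the
  -- expected number of such packets.
  set ν : Measure (ℕ × Outcome) := κ⁻¹ • ∑ i ∈ Finset.range N,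
    ((law μT μC).restrict {ω | nextSource mode ξ π ω i = m}).map (fun ω => (i, ω)) with hν
  have hp : ∀ i : ℕ, Measurable fun ω : Outcome => (i, ω) := fun i => measurable_prodMk_left
  have hlin : ∀ G : ℕ × Outcome → ENNReal, Measurable G → ∫⁻ x, G x ∂ν =
      κ⁻¹ * ∑ i ∈ Finset.range N, ∫⁻ ω in {ω | nextSource mode ξ π ω i = m}, G (i, ω)
        ∂(law μT μC) := by
    intro G hG
    rw [hν, lintegral_smul_measure, lintegral_finsetSum_measure, smul_eq_mul]
    congr 1
    exact Finset.sum_congr rfl fun i _ => lintegral_map hG (hp i)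
  have : IsProbabilityMeasure ν := by
    constructor
    have := hlin (fun _ => 1) measurable_const
    simp only [lintegral_const, one_mul, Measure.restrict_apply_univ] at this
    rw [this, ← Finset.sum_congr rfl fun i _ => hκi i]
    exact ENNReal.inv_mul_cancel hN hκtop
  have : StandardBorelSpace (ℕ × Outcome) :=
    have := standardBorelSpace_outcome
    StandardBorelSpace.prod
  obtain ⟨φ, hφ, hφν⟩ := Measure.exists_measurable_map_eq ν
  have hdel : Measurable fun q : ℕ × (Outcome × ℝ × ℝ) =>
      delayGiven mode ξ π q.1 q.2.1 q.2.2.1 q.2.2.2 :=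
    measurable_from_prod_countable_right fun i => measurable_delayGiven mode ξ π i
  refine ⟨⟨fun u t c => delayGiven mode ξ π (φ u).1 (φ u).2 t c, ?_, ?_, ?_⟩, ?_⟩
  · exact hdel.comp ((measurable_fst.comp (hφ.comp measurable_fst)).prodMk
      ((measurable_snd.comp (hφ.comp measurable_fst)).prodMk measurable_snd))
  · exact fun u t c => delayGiven_nonneg _ _ _ _ _ _ _
  · exact fun u t c c' => delayGiven_nonanticipating _ _ _ _ _ _ _ _
  · intro F hF
    set G : ℕ × Outcome → ENNReal := fun x =>
      ∫⁻ z, F z (delayGiven mode ξ π x.1 x.2 (observed mode z).1 (observed mode z).2)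
        ∂(freshLaw mode μT μC) with hGdef
    have hGm' : Measurable fun y : (ℕ × Outcome) × (ℝ × ℝ × ℝ) =>
        F y.2 (delayGiven mode ξ π y.1.1 y.1.2 (observed mode y.2).1 (observed mode y.2).2) :=
      hF.comp (measurable_snd.prodMk (hdel.comp ((measurable_fst.comp measurable_fst).prodMk
        ((measurable_snd.comp measurable_fst).prodMk
          ((measurable_observed mode).comp measurable_snd)))))
    have hG : Measurable G := hGm'.lintegral_prod_right'
    rw [value, lintegral_prod _ (by exact (hGm'.comp ((hφ.comp measurable_fst).prodMk
      measurable_snd)).aemeasurable)]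
    change ∫⁻ u, G (φ u) = _
    rw [← lintegral_map hG hφ, hφν, hlin G hG]
    simp only [total, lintegral_sourceFeature mode ξ π μT μC hF, hGdef]

end Simulation


/-! ### Weighted averages and negligible tails. -/

section Averages

/-- Since the weights are at most 1, p (v - V) tends to 0, and so do its Cesàro means. -/
theorem tendsto_average_mul {p v : ℕ → ℝ} {f V : ℝ} (hp0 : ∀ i, 0 ≤ p i) (hp1 : ∀ i, p i ≤ 1)
    (hp : Tendsto (fun N : ℕ => (∑ i ∈ Finset.range N, p i) / N) atTop (𝓝 f))
    (hv : Tendsto v atTop (𝓝 V)) :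
    Tendsto (fun N : ℕ => (∑ i ∈ Finset.range N, p i * v i) / N) atTop (𝓝 (f * V)) := by
  have h0 : Tendsto (fun i => p i * (v i - V)) atTop (𝓝 0) := by
    have hv' : Tendsto (fun i => |v i - V|) atTop (𝓝 0) := by
      have := (hv.sub_const V).abs
      simpa using this
    refine squeeze_zero_norm (fun i => ?_) hv'
    rw [norm_mul, Real.norm_eq_abs, Real.norm_eq_abs, abs_of_nonneg (hp0 i)]
    exact mul_le_of_le_one_left (abs_nonneg _) (hp1 i)
  have h1 := h0.cesaro.add (hp.mul_const V)
  rw [zero_add] at h1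
  refine h1.congr fun N => ?_
  simp only [mul_sub, Finset.sum_sub_distrib, ← Finset.sum_mul]
  ring

theorem exists_lintegral_tsub_le {X : Type*} [MeasurableSpace X] {μ : Measure X} {h : X → ENNReal}
    (hm : Measurable h) (hi : ∫⁻ x, h x ∂μ ≠ ⊤) {ε : ENNReal} (hε : ε ≠ 0) :
    ∃ B : ENNReal, B ≠ ⊤ ∧ ∫⁻ x, (h x - B) ∂μ ≤ ε := by
  have hlim : Tendsto (fun n : ℕ => ∫⁻ x, (h x - n) ∂μ) atTop (𝓝 (∫⁻ _, 0 ∂μ)) := by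
    refine tendsto_lintegral_of_dominated_convergence h (fun n => hm.sub measurable_const)
      (fun n => ae_of_all _ fun x => tsub_le_self) hi ?_
    filter_upwards [ae_lt_top hm hi] with x hx
    obtain ⟨n, hn⟩ := ENNReal.exists_nat_gt hx.ne
    refine tendsto_const_nhds.congr' ?_
    filter_upwards [eventually_ge_atTop n] with k hk
    exact (tsub_eq_zero_of_le (hn.le.trans (by exact_mod_cast hk))).symm
  rw [lintegral_zero] at hlim
  obtain ⟨n, hn⟩ := (ENNReal.tendsto_nhds_zero.1 hlim ε (pos_iff_ne_zero.2 hε)).exists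
  exact ⟨n, ENNReal.natCast_ne_top n, hn⟩

/-- If the random index `R N ≤ N` is `N - o(N)` almost surely and the `X j` are uniformly integrable
on average, then the part of the sum of the `X j` between `R N` and `N` is negligible. -/
theorem tendsto_lintegral_tail {Ω : Type*} [MeasurableSpace Ω] {μ : Measure Ω}
    [IsProbabilityMeasure μ] {X : ℕ → Ω → ENNReal} (hX : ∀ j, Measurable (X j))
    {R : ℕ → Ω → ℕ} (hRm : ∀ N, Measurable (R N)) (hRle : ∀ N ω, R N ω ≤ N)
    (hR : ∀ᵐ ω ∂μ, Tendsto (fun N : ℕ => (R N ω : ℝ) / N) atTop (𝓝 1))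
    (hUI : ∀ ε : ENNReal, ε ≠ 0 → ∃ B : ENNReal, B ≠ ⊤ ∧ ∀ᶠ N : ℕ in atTop,
      ∑ j ∈ Finset.range N, ∫⁻ ω, (X j ω - B) ∂μ ≤ ε * N) :
    Tendsto (fun N : ℕ => (∫⁻ ω, ∑ j ∈ Finset.Ico (R N ω) N, X j ω ∂μ) / N) atTop (𝓝 0) := by
  have hRm' : ∀ N, Measurable fun ω => ((N - R N ω : ℕ) : ENNReal) := fun N =>
    (measurable_of_countable (fun n : ℕ => ((N - n : ℕ) : ENNReal))).comp (hRm N)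
  -- The relative gap is bounded by 1, so its almost sure convergence passes to the mean.
  have hgap : Tendsto (fun N : ℕ => ∫⁻ ω, ((N - R N ω : ℕ) : ENNReal) / N ∂μ) atTop (𝓝 0) := by
    have : Tendsto (fun N : ℕ => ∫⁻ ω, ((N - R N ω : ℕ) : ENNReal) / N ∂μ) atTop
        (𝓝 (∫⁻ _, 0 ∂μ)) := by
      refine tendsto_lintegral_of_dominated_convergence (fun _ => 1)
        (fun N => (hRm' N).div_const _)
        (fun N => ae_of_all _ fun ω => ENNReal.div_le_of_le_mul ?_) (by simp) ?_
      · rw [one_mul]; exact_mod_cast Nat.sub_le _ _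
      · filter_upwards [hR] with ω hω
        have h1 : Tendsto (fun N : ℕ => ENNReal.ofReal (1 - (R N ω : ℝ) / N)) atTop (𝓝 0) := by
          have := ENNReal.tendsto_ofReal (hω.const_sub 1)
          simpa using this
        refine h1.congr' ?_
        filter_upwards [eventually_gt_atTop 0] with N hN
        have hN' : (0 : ℝ) < N := by exact_mod_cast hN
        rw [one_sub_div hN'.ne', ENNReal.ofReal_div_of_pos hN', ← Nat.cast_sub (hRle N ω),
          ENNReal.ofReal_natCast, ENNReal.ofReal_natCast]
    simpa using this
  rw [ENNReal.tendsto_nhds_zero]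
  intro ε hε
  have hε2 : ε / 2 ≠ 0 := (ENNReal.half_pos hε.ne').ne'
  obtain ⟨B, hB, hBN⟩ := hUI (ε / 2) hε2
  have hBgap : Tendsto (fun N : ℕ => B * ∫⁻ ω, ((N - R N ω : ℕ) : ENNReal) / N ∂μ) atTop (𝓝 0) := by
    have := ENNReal.Tendsto.const_mul hgap (Or.inr hB)
    simpa using this
  filter_upwards [ENNReal.tendsto_nhds_zero.1 hBgap (ε / 2) (pos_iff_ne_zero.2 hε2), hBN,
    eventually_gt_atTop 0] with N h1 h2 hN
  have hN0 : (N : ENNReal) ≠ 0 := by exact_mod_cast hN.ne'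
  have hNt : (N : ENNReal) ≠ ⊤ := ENNReal.natCast_ne_top N
  -- Bound each term by B plus its excess over B: the gap controls the first part, uniform
  -- integrability the second.
  have hpt : ∀ ω, ∑ j ∈ Finset.Ico (R N ω) N, X j ω ≤
      B * ((N - R N ω : ℕ) : ENNReal) + ∑ j ∈ Finset.range N, (X j ω - B) := by
    intro ω
    calc ∑ j ∈ Finset.Ico (R N ω) N, X j ω
        ≤ ∑ j ∈ Finset.Ico (R N ω) N, (B + (X j ω - B)) :=
          Finset.sum_le_sum fun j _ => le_add_tsub
      _ = B * ((N - R N ω : ℕ) : ENNReal) + ∑ j ∈ Finset.Ico (R N ω) N, (X j ω - B) := by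
          rw [Finset.sum_add_distrib, Finset.sum_const, Nat.card_Ico, nsmul_eq_mul, mul_comm]
      _ ≤ _ := by
          gcongr
          intro j hj
          exact Finset.mem_range.2 (Finset.mem_Ico.1 hj).2
  have hXB : ∀ j ∈ Finset.range N, Measurable fun ω => X j ω - B :=
    fun j _ => (hX j).sub measurable_const
  calc (∫⁻ ω, ∑ j ∈ Finset.Ico (R N ω) N, X j ω ∂μ) / N
      ≤ (∫⁻ ω, (B * ((N - R N ω : ℕ) : ENNReal) + ∑ j ∈ Finset.range N, (X j ω - B)) ∂μ) / N := by
        gcongr with ω; exact hpt ω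
    _ = B * (∫⁻ ω, ((N - R N ω : ℕ) : ENNReal) / N ∂μ) +
          (∑ j ∈ Finset.range N, ∫⁻ ω, (X j ω - B) ∂μ) / N := by
        rw [lintegral_add_left ((hRm' N).const_mul _), lintegral_const_mul _ (hRm' N),
          lintegral_finsetSum _ hXB, ENNReal.add_div]
        simp only [div_eq_mul_inv]
        rw [lintegral_mul_const _ (hRm' N), mul_assoc]
    _ ≤ ε / 2 + ε / 2 := add_le_add h1 (ENNReal.div_le_of_le_mul h2)
    _ = ε := ENNReal.add_halves ε

end Averages

/-! ### Densities and windows of proportional length. -/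

section Gaps

/-- A set of positive density has many elements in any window that is a fixed fraction of `N`. -/
theorem exists_eventually_lt_card_window {f : ℝ} (hf : 0 < f) {k : ℕ} (hk : 2 ≤ k) :
    ∃ s : ℕ, 0 < s ∧ ∀ (A : ℕ → Prop) [DecidablePred A],
      (Tendsto (fun N : ℕ => (((Finset.range N).filter A).card : ℝ) / N) atTop (𝓝 f) →
        ∀ᶠ N : ℕ in atTop, 2 * (N / s) < ((Finset.Ico (N - N / k) N).filter A).card) := by
  have hk' : (0 : ℝ) < k := by exact_mod_cast (by omega : 0 < k)
  -- The window contains about f N / k elements; this s gives 2 / s < f / k.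
  obtain ⟨s, hs⟩ := exists_nat_gt (2 * k / f)
  have hs0 : (0 : ℝ) < s := lt_of_le_of_lt (by positivity) hs
  refine ⟨s, by exact_mod_cast hs0, fun A _ hA => ?_⟩
  set a : ℕ → ℝ := fun N => (((Finset.range N).filter A).card : ℝ) with ha
  have hdiv : Tendsto (fun N : ℕ => ((N - N / k : ℕ) : ℝ) / N) atTop (𝓝 (1 - 1 / k)) := by
    have h1 : Tendsto (fun N : ℕ => (⌊(1 / k : ℝ) * (N : ℝ)⌋₊ : ℝ) / N) atTop (𝓝 (1 / k)) :=
      (tendsto_nat_floor_mul_div_atTop (by positivity)).comp tendsto_natCast_atTop_atTop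
    refine (h1.const_sub 1).congr' ?_
    filter_upwards [eventually_gt_atTop 0] with N hN
    have hN' : (N : ℝ) ≠ 0 := by positivity
    rw [one_div_mul_eq_div, Nat.floor_div_eq_div, Nat.cast_sub (Nat.div_le_self _ _), sub_div,
      div_self hN']
  have hn : Tendsto (fun N : ℕ => N - N / k) atTop atTop := by
    refine tendsto_atTop_mono (fun N => ?_) (Nat.tendsto_div_const_atTop (n := 2) (by norm_num))
    have : N / k ≤ N / 2 := Nat.div_le_div_left hk (by norm_num)
    omega
  have hlim : Tendsto (fun N : ℕ => (a N - a (N - N / k)) / N) atTop (𝓝 (f / k)) := by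
    have h2 := hA.sub ((hA.comp hn).mul hdiv)
    rw [show f - f * (1 - 1 / k) = f / k by ring] at h2
    refine h2.congr' ?_
    filter_upwards [hn.eventually_gt_atTop 0] with N hN
    have : ((N - N / k : ℕ) : ℝ) ≠ 0 := by positivity
    simp only [Function.comp, ha]
    field_simp
  have h2s : 2 / (s : ℝ) < f / k := by
    rw [div_lt_div_iff₀ hs0 hk']
    rw [div_lt_iff₀ hf] at hs
    linarith
  filter_upwards [hlim.eventually_const_lt h2s, eventually_gt_atTop 0] with N h1 hN
  have hN' : (0 : ℝ) < N := by exact_mod_cast hN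
  have hcard : a N - a (N - N / k) = (((Finset.Ico (N - N / k) N).filter A).card : ℝ) := by
    simp only [ha, Finset.card_filter]
    rw [← Finset.sum_range_add_sum_Ico _ (Nat.sub_le N (N / k))]
    push_cast
    ring
  rw [hcard, lt_div_iff₀ hN'] at h1
  have h3 : ((2 * (N / s) : ℕ) : ℝ) ≤ 2 / s * N := by
    push_cast
    have := Nat.cast_div_le (α := ℝ) (m := N) (n := s)
    calc (2 : ℝ) * ((N / s : ℕ) : ℝ) ≤ 2 * ((N : ℝ) / s) := by gcongr
      _ = _ := by ring
  exact_mod_cast h3.trans_lt h1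

theorem tendsto_div_one_of_windows {R : ℕ → ℕ} (hR : ∀ N, R N ≤ N)
    (h : ∀ k : ℕ, 2 ≤ k → ∀ᶠ N : ℕ in atTop, N - N / k ≤ R N) :
    Tendsto (fun N : ℕ => (R N : ℝ) / N) atTop (𝓝 1) := by
  rw [Metric.tendsto_atTop]
  intro ε hε
  obtain ⟨k, hk⟩ := exists_nat_gt (1 / ε + 2)
  have hk2 : 2 ≤ k := by
    have h1 : (2 : ℝ) < k := lt_of_le_of_lt (by have := one_div_pos.2 hε; linarith) hk
    exact_mod_cast h1.le
  have hk0 : (0 : ℝ) < k := by exact_mod_cast (by omega : 0 < k)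
  obtain ⟨N₀, hN₀⟩ := eventually_atTop.1 (h k hk2)
  refine ⟨N₀ + 1, fun N hN => ?_⟩
  have h1 := hN₀ N (by omega)
  have hN' : (0 : ℝ) < N := by exact_mod_cast (by omega : 0 < N)
  have h2 : (N : ℝ) - N / k ≤ R N := by
    have h3 : ((N / k : ℕ) : ℝ) ≤ (N : ℝ) / k := Nat.cast_div_le
    have h4 : (N : ℝ) ≤ R N + ((N / k : ℕ) : ℝ) := by exact_mod_cast (by omega : N ≤ R N + N / k)
    linarith
  have h5 : (R N : ℝ) ≤ N := by exact_mod_cast hR N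
  have hkε : 1 / (k : ℝ) < ε := by
    rw [div_lt_iff₀ hk0]
    have : 1 / ε < k := by linarith
    rwa [div_lt_iff₀ hε, mul_comm] at this
  rw [Real.dist_eq, abs_sub_comm, abs_of_nonneg (by rw [sub_nonneg]; exact (div_le_one hN').2 h5)]
  have h6 : 1 - 1 / (k : ℝ) ≤ R N / N := by
    rw [le_div_iff₀ hN']
    calc (1 - 1 / (k : ℝ)) * N = N - N / k := by ring
      _ ≤ _ := h2
  linarith

end Gaps


/-! ### Absence of starvation. -/

section Starvation

variable {M : ℕ} {mode : Mode} {μT μC : Measure ℝ}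
  [IsProbabilityMeasure μT] [IsProbabilityMeasure μC] {ξ : Scheduler M}

/-- Every packet is delivered, and a positive frequency puts packets of each source into every late
window of proportional length. -/
theorem noStarvation_nonpreemptive {f : Fin M → ℝ} (hf : ∀ m, 0 < f m)
    (hξ : HasSchedulingFrequency .nonpreemptive μT μC ξ f) (π : Sampler M) :
    NoStarvation .nonpreemptive μT μC ξ π := by
  classical
  filter_upwards [hξ π] with ω hω m
  refine tendsto_div_one_of_windows (lastDelivered_le _ ξ π ω m) fun k hk => ?_
  obtain ⟨s, -, hs⟩ := exists_eventually_lt_card_window (hf m) hk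
  filter_upwards [hs (fun i => nextSource .nonpreemptive ξ π ω i = m) (hω m)] with N hN
  obtain ⟨i, hi⟩ := Finset.card_pos.1 ((Nat.zero_le _).trans_lt hN)
  rw [Finset.mem_filter, Finset.mem_Ico] at hi
  exact hi.1.1.trans (lt_lastDelivered _ ξ π hi.1.2 ⟨hi.2, trivial⟩).le

variable (ρ : ℕ → Fin M → Rule)

/-- Neighbouring packets share a fresh time, hence the distance 2. -/
theorem fresh_renew {i j : ℕ} (hj : j + 2 ≤ i) (ω : Outcome)
    (p : unitInterval × (ℝ × ℝ × ℝ)) : fresh mode j (renew mode i ω p) = fresh mode j ω := by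
  have hT : ∀ k ≤ j + 2, (renew mode i ω p).T k = ω.T k :=
    fun k hk => renew_T mode i ω p (by omega)
  have hC : ∀ k ≤ j + 1, (renew mode i ω p).C k = ω.C k :=
    fun k hk => renew_C mode i ω p (by omega)
  cases mode <;> simp [fresh, hT, hC]

theorem stepOf_le (i : ℕ) : stepOf mode i ≤ i + 1 := by
  cases mode <;> simp [stepOf]

theorem delay_renew {i j : ℕ} (hj : j + 2 ≤ i) (ω : Outcome)
    (p : unitInterval × (ℝ × ℝ × ℝ)) :
    delay mode ξ (ruleSampler mode ρ) (renew mode i ω p) (stepOf mode j) =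
      delay mode ξ (ruleSampler mode ρ) ω (stepOf mode j) := by
  have hs := stepOf_le (mode := mode) j
  refine delay_congr (renew_schedSeed mode i ω p) _
    (fun k hk => renew_T mode i ω p (by omega))
    (fun k hk => renew_C mode i ω p (by omega))
    (fun k hk => ruleSampler_delay_congr mode ρ ?_)
  have := le_stepOf mode i
  simp [renew_sampSeed, Function.update, show k ≠ stepOf mode i by omega]

variable (mode ξ) in
/-- The factor `1 / q` for a packet of source `m` that is dropped, `0` for one that is delivered,
and `1` for a packet of another source. -/
noncomputable def dropFactor (q : ENNReal) (m : Fin M) (j : ℕ) (ω : Outcome) : ENNReal :=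
  if nextSource mode ξ (ruleSampler mode ρ) ω j = m then
    q⁻¹ * (1 - deliveredFeature mode (fresh mode j ω)
      (delay mode ξ (ruleSampler mode ρ) ω (stepOf mode j)))
  else 1

theorem measurable_dropFactor (q : ENNReal) (m : Fin M) (j : ℕ) :
    Measurable (dropFactor mode ξ ρ q m j) :=
  Measurable.ite (measurableSet_nextSource_eq mode ξ _ m j)
    (measurable_const.mul (measurable_const.sub (measurable_feature_fresh_delay mode ξ
      (measurable_deliveredFeature mode) _ j))) measurable_const

-- Given the past, a packet of source m is dropped with probability at most q, so the factor has
-- conditional mean at most 1: its products behave like a supermartingale.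
variable (μT μC) in
theorem lintegral_mul_dropFactor_le (h0 : ∀ m u t c, (ρ 0 m).act u t c = max c 0)
    {q : ENNReal} (hq0 : q ≠ 0) (hqt : q ≠ ⊤) (m : Fin M) (i : ℕ)
    (hq : 1 ≤ q + value mode μT μC (deliveredFeature mode) (ρ (stepOf mode i) m))
    {H : Outcome → ENNReal} (hH : Measurable H) (hinv : ∀ ω p, H (renew mode i ω p) = H ω) :
    ∫⁻ ω, H ω * dropFactor mode ξ ρ q m i ω ∂(law μT μC) ≤ ∫⁻ ω, H ω ∂(law μT μC) := by
  classical
  set F : ℝ × ℝ × ℝ → ℝ → ENNReal := fun z θ => 1 - deliveredFeature mode z θ with hFdef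
  have hF : Measurable fun p : (ℝ × ℝ × ℝ) × ℝ => F p.1 p.2 :=
    measurable_const.sub (measurable_deliveredFeature mode)
  have hval : value mode μT μC F (ρ (stepOf mode i) m) ≤ q := by
    have hsum : value mode μT μC F (ρ (stepOf mode i) m) +
        value mode μT μC (deliveredFeature mode) (ρ (stepOf mode i) m) = 1 := by
      rw [value, value, ← lintegral_add_left (measurable_feature_act mode hF _)]
      simp only [hFdef, tsub_add_cancel_of_le (deliveredFeature_le_one _ _ _)]
      simp
    have hfin : value mode μT μC (deliveredFeature mode) (ρ (stepOf mode i) m) ≠ ⊤ :=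
      ne_top_of_le_ne_top ENNReal.one_ne_top (hsum ▸ le_add_self)
    exact (ENNReal.add_le_add_iff_right hfin).1 (hsum ▸ hq)
  set e : Outcome → ENNReal := fun ω =>
    if nextSource mode ξ (ruleSampler mode ρ) ω i = m then 0 else 1 with he
  have hem : Measurable e :=
    Measurable.ite (measurableSet_nextSource_eq mode ξ _ m i) measurable_const measurable_const
  have hφ : ∀ ω, dropFactor mode ξ ρ q m i ω =
      e ω + q⁻¹ * sourceFeature mode ξ (ruleSampler mode ρ) F m i ω := by
    intro ω
    simp only [dropFactor, he, sourceFeature, hFdef]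
    split_ifs <;> simp
  have hone : ∀ ω, e ω + sourceFeature mode ξ (ruleSampler mode ρ) (fun _ _ => 1) m i ω = 1 := by
    intro ω
    simp only [he, sourceFeature]
    split_ifs <;> simp
  have hs1 : Measurable fun ω =>
      H ω * sourceFeature mode ξ (ruleSampler mode ρ) F m i ω :=
    hH.mul (measurable_sourceFeature mode ξ _ hF m i)
  calc ∫⁻ ω, H ω * dropFactor mode ξ ρ q m i ω ∂(law μT μC)
      = ∫⁻ ω, (H ω * e ω + q⁻¹ * (H ω * sourceFeature mode ξ (ruleSampler mode ρ) F m i ω))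
          ∂(law μT μC) := by
        refine lintegral_congr fun ω => ?_
        rw [hφ, mul_add]
        ring
    _ = ∫⁻ ω, H ω * e ω ∂(law μT μC) + q⁻¹ *
          ((∫⁻ ω, H ω * sourceFeature mode ξ (ruleSampler mode ρ) (fun _ _ => 1) m i ω
            ∂(law μT μC)) * value mode μT μC F (ρ (stepOf mode i) m)) := by
        have hHe : Measurable fun ω => H ω * e ω := hH.mul hem
        rw [lintegral_add_left hHe, lintegral_const_mul _ hs1,
          lintegral_mul_sourceFeature_ruleSampler mode ξ ρ μT μC h0 hF hH i hinv]
    _ ≤ ∫⁻ ω, H ω * e ω ∂(law μT μC) +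
          ∫⁻ ω, H ω * sourceFeature mode ξ (ruleSampler mode ρ) (fun _ _ => 1) m i ω
            ∂(law μT μC) := by
        gcongr
        rw [mul_left_comm]
        refine mul_le_of_le_one_right zero_le ?_
        calc q⁻¹ * value mode μT μC F (ρ (stepOf mode i) m) ≤ q⁻¹ * q := by gcongr
          _ = 1 := ENNReal.inv_mul_cancel hq0 hqt
    _ = ∫⁻ ω, H ω ∂(law μT μC) := by
        have hHe : Measurable fun ω => H ω * e ω := hH.mul hem
        rw [← lintegral_add_left hHe]
        refine lintegral_congr fun ω => ?_
        rw [← mul_add, hone, mul_one]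

-- With indices of one parity only, distinct factors are at least two steps apart, and renewing the
-- last one leaves the others unchanged.
variable (μT μC) in
theorem lintegral_prod_dropFactor_le (h0 : ∀ m u t c, (ρ 0 m).act u t c = max c 0)
    {q : ENNReal} (hq0 : q ≠ 0) (hqt : q ≠ ⊤) (m : Fin M) (n : ℕ)
    (hq : ∀ i, n ≤ i → 1 ≤ q + value mode μT μC (deliveredFeature mode) (ρ i m))
    (r N : ℕ) :
    ∫⁻ ω, ∏ j ∈ (Finset.Ico n N).filter (fun j => j % 2 = r), dropFactor mode ξ ρ q m j ω
      ∂(law μT μC) ≤ 1 := by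
  induction N with
  | zero => simp
  | succ N ih =>
    by_cases hN : n ≤ N ∧ N % 2 = r
    · have hset : (Finset.Ico n (N + 1)).filter (fun j => j % 2 = r) =
          insert N ((Finset.Ico n N).filter (fun j => j % 2 = r)) := by
        ext j
        simp only [Finset.mem_filter, Finset.mem_Ico, Finset.mem_insert]
        omega
      rw [hset]
      have hnot : N ∉ (Finset.Ico n N).filter (fun j => j % 2 = r) := by simp
      simp_rw [Finset.prod_insert hnot, mul_comm (dropFactor mode ξ ρ q m N _)]
      refine (lintegral_mul_dropFactor_le μT μC ρ h0 hq0 hqt m N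
        (hq _ (hN.1.trans (le_stepOf mode N)))
        (Finset.measurable_prod _ fun j _ => measurable_dropFactor ρ q m j) ?_).trans ih
      intro ω p
      refine Finset.prod_congr rfl fun j hj => ?_
      rw [Finset.mem_filter, Finset.mem_Ico] at hj
      have hj2 : j + 2 ≤ N := by omega
      simp only [dropFactor, fresh_renew hj2, delay_renew ρ hj2,
        nextSource_renew mode ξ ρ N ω p hj.1.2.le]
    · have hset : (Finset.Ico n (N + 1)).filter (fun j => j % 2 = r) =
          (Finset.Ico n N).filter (fun j => j % 2 = r) := by
        ext j
        simp only [Finset.mem_filter, Finset.mem_Ico]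
        constructor
        · rintro ⟨⟨h1, h2⟩, h3⟩
          refine ⟨⟨h1, lt_of_le_of_ne (Nat.lt_succ_iff.1 h2) ?_⟩, h3⟩
          rintro rfl
          exact hN ⟨h1, h3⟩
        · rintro ⟨⟨h1, h2⟩, h3⟩
          exact ⟨⟨h1, by omega⟩, h3⟩
      rw [hset]
      exact ih

variable (mode ξ) in
open Classical in
/-- In the window from `n` to `N`, more than `2 κ` packets of source `m` are scheduled, but none of
them is delivered. -/
def dropEvent (m : Fin M) (n N κ : ℕ) : Set Outcome :=
  {ω | (∀ i ∈ Finset.Ico n N, ¬ DeliveredFrom mode ξ (ruleSampler mode ρ) ω m i) ∧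
    2 * κ < ((Finset.Ico n N).filter
      fun i => nextSource mode ξ (ruleSampler mode ρ) ω i = m).card}

-- On this event every factor of a source-m packet is 1/q, and one parity class has at least κ of
-- them. The sum of the two products, of mean at most 2, is then at least q^(-κ), and Markov's
-- inequality applies.
variable (μT μC) in
theorem law_dropEvent_le (h0 : ∀ m u t c, (ρ 0 m).act u t c = max c 0)
    {q : ENNReal} (hq0 : q ≠ 0) (hq1 : q ≤ 1) (m : Fin M) (n : ℕ)
    (hq : ∀ i, n ≤ i → 1 ≤ q + value mode μT μC (deliveredFeature mode) (ρ i m))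
    (N κ : ℕ) : law μT μC (dropEvent mode ξ ρ m n N κ) ≤ 2 * q ^ κ := by
  classical
  have hqt : q ≠ ⊤ := ne_top_of_le_ne_top ENNReal.one_ne_top hq1
  set Y : ℕ → Outcome → ENNReal := fun r ω =>
    ∏ j ∈ (Finset.Ico n N).filter (fun j => j % 2 = r), dropFactor mode ξ ρ q m j ω with hY
  have hYm : ∀ r, Measurable (Y r) := fun r =>
    Finset.measurable_prod _ fun j _ => measurable_dropFactor ρ q m j
  have hsub : dropEvent mode ξ ρ m n N κ ⊆ {ω | (q ^ κ)⁻¹ ≤ Y 0 ω + Y 1 ω} := by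
    rintro ω ⟨hd, hc⟩
    have hfac : ∀ j ∈ Finset.Ico n N, dropFactor mode ξ ρ q m j ω =
        if nextSource mode ξ (ruleSampler mode ρ) ω j = m then q⁻¹ else 1 := by
      intro j hj
      simp only [dropFactor]
      split_ifs with hs
      · have hnd : ¬ Delivered mode ξ (ruleSampler mode ρ) ω (j + 1) := fun h => hd j hj ⟨hs, h⟩
        simp [deliveredFeature_fresh, hnd]
      · rfl
    have hYr : ∀ r, Y r ω = q⁻¹ ^ (((Finset.Ico n N).filter (fun j => j % 2 = r)).filter
        fun i => nextSource mode ξ (ruleSampler mode ρ) ω i = m).card := by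
      intro r
      simp only [hY]
      rw [Finset.prod_congr rfl fun j hj => hfac j (Finset.mem_filter.1 hj).1,
        Finset.prod_ite, Finset.prod_const, Finset.prod_const_one, mul_one]
    have hsplit : ((Finset.Ico n N).filter
          fun i => nextSource mode ξ (ruleSampler mode ρ) ω i = m).card ≤
        (((Finset.Ico n N).filter (fun j => j % 2 = 0)).filter
          fun i => nextSource mode ξ (ruleSampler mode ρ) ω i = m).card +
        (((Finset.Ico n N).filter (fun j => j % 2 = 1)).filter
          fun i => nextSource mode ξ (ruleSampler mode ρ) ω i = m).card := by
      refine (Finset.card_le_card ?_).trans (Finset.card_union_le _ _)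
      intro j hj
      simp only [Finset.mem_filter, Finset.mem_union] at hj ⊢
      have : j % 2 = 0 ∨ j % 2 = 1 := by omega
      tauto
    have hinv : 1 ≤ q⁻¹ := ENNReal.one_le_inv.2 hq1
    simp only [Set.mem_ofPred_eq, hYr, ENNReal.inv_pow]
    rcases (by omega : κ ≤ (((Finset.Ico n N).filter (fun j => j % 2 = 0)).filter
          fun i => nextSource mode ξ (ruleSampler mode ρ) ω i = m).card ∨
        κ ≤ (((Finset.Ico n N).filter (fun j => j % 2 = 1)).filter
          fun i => nextSource mode ξ (ruleSampler mode ρ) ω i = m).card) with h | h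
    · exact (pow_le_pow_right₀ hinv h).trans le_self_add
    · exact (pow_le_pow_right₀ hinv h).trans le_add_self
  have hpow0 : q ^ κ ≠ 0 := pow_ne_zero _ hq0
  have hpowt : q ^ κ ≠ ⊤ := ENNReal.pow_ne_top hqt
  have hm := mul_meas_ge_le_lintegral (μ := law μT μC) ((hYm 0).add (hYm 1)) (q ^ κ)⁻¹
  have hint : ∫⁻ ω, (Y 0 + Y 1) ω ∂(law μT μC) ≤ 2 := by
    simp only [Pi.add_apply]
    rw [lintegral_add_left (hYm 0), ← one_add_one_eq_two]
    exact add_le_add (lintegral_prod_dropFactor_le μT μC ρ h0 hq0 hqt m n hq 0 N)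
      (lintegral_prod_dropFactor_le μT μC ρ h0 hq0 hqt m n hq 1 N)
  have h1 : (q ^ κ)⁻¹ * law μT μC (dropEvent mode ξ ρ m n N κ) ≤ 2 := by
    refine le_trans ?_ (hm.trans hint)
    gcongr
    exact hsub
  calc law μT μC (dropEvent mode ξ ρ m n N κ)
      = q ^ κ * ((q ^ κ)⁻¹ * law μT μC (dropEvent mode ξ ρ m n N κ)) := by
        rw [← mul_assoc, ENNReal.mul_inv_cancel hpow0 hpowt, one_mul]
    _ ≤ q ^ κ * 2 := by gcongr
    _ = _ := mul_comm _ _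

theorem tsum_pow_div_ne_top {q : ENNReal} (hq : q < 1) {s : ℕ} (hs : 0 < s) :
    ∑' N : ℕ, q ^ (N / s) ≠ ⊤ := by
  have : NeZero s := ⟨hs.ne'⟩
  have h1 : ∑' N : ℕ, q ^ (N / s) = ∑' p : ℕ × Fin s, q ^ p.1 := by
    rw [← (Nat.divModEquiv s).tsum_eq]
    rfl
  rw [h1, ENNReal.tsum_prod']
  simp only [tsum_fintype, Finset.sum_const, Finset.card_univ, Fintype.card_fin, nsmul_eq_mul]
  rw [ENNReal.tsum_mul_left, ENNReal.tsum_geometric]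
  refine ENNReal.mul_ne_top (ENNReal.natCast_ne_top s) (ENNReal.inv_ne_top.2 ?_)
  exact (tsub_pos_of_lt hq).ne'

/-- Eventually each window holds enough packets of each source, and the probability that all of them
are dropped is summable in N; Borel–Cantelli concludes. -/
theorem noStarvation_ruleSampler {f : Fin M → ℝ} (hf : ∀ m, 0 < f m)
    (hξ : HasSchedulingFrequency mode μT μC ξ f)
    (h0 : ∀ m u t c, (ρ 0 m).act u t c = max c 0) {q : ENNReal} (hq0 : q ≠ 0) (hq1 : q < 1)
    (hq : ∀ᶠ i in atTop, ∀ m, 1 ≤ q + value mode μT μC (deliveredFeature mode) (ρ i m)) :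
    NoStarvation mode μT μC ξ (ruleSampler mode ρ) := by
  classical
  obtain ⟨n₀, hn₀⟩ := eventually_atTop.1 hq
  choose s hs0 hs using fun (m : Fin M) (k : {k : ℕ // 2 ≤ k}) =>
    exists_eventually_lt_card_window (hf m) k.2
  have hbc : ∀ᵐ ω ∂(law μT μC), ∀ (m : Fin M) (k : {k : ℕ // 2 ≤ k}), ∀ᶠ N : ℕ in atTop,
      ω ∉ dropEvent mode ξ ρ m (N - N / k) N (N / s m k) := by
    rw [ae_all_iff]
    intro m
    rw [ae_all_iff]
    intro k
    -- As k ≥ 2, the window starts in the second half, so the shift by 2 n₀ places it after n₀,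
    -- where the bound on drops is valid.
    have hn : ∀ N, n₀ ≤ N + 2 * n₀ - (N + 2 * n₀) / k := by
      intro N
      have : (N + 2 * n₀) / k ≤ (N + 2 * n₀) / 2 := Nat.div_le_div_left k.2 (by norm_num)
      omega
    have hsum : ∑' N : ℕ, law μT μC (dropEvent mode ξ ρ m
        (N + 2 * n₀ - (N + 2 * n₀) / k) (N + 2 * n₀) ((N + 2 * n₀) / s m k)) ≠ ⊤ := by
      refine ne_top_of_le_ne_top (ENNReal.mul_ne_top ENNReal.ofNat_ne_top
        (tsum_pow_div_ne_top hq1 (hs0 m k)) : 2 * ∑' N : ℕ, q ^ (N / s m k) ≠ ⊤) ?_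
      rw [← ENNReal.tsum_mul_left]
      refine ENNReal.tsum_le_tsum fun N => ?_
      refine (law_dropEvent_le μT μC ρ h0 hq0 hq1.le m _
        (fun i hi => hn₀ i ((hn N).trans hi) m) _ _).trans ?_
      gcongr 2 * ?_
      exact pow_le_pow_of_le_one zero_le hq1.le
        (Nat.div_le_div_right (Nat.le_add_right _ _))
    filter_upwards [ae_eventually_notMem hsum] with ω hω
    rw [← Filter.map_add_atTop_eq_nat (2 * n₀)]
    exact hω
  filter_upwards [hbc, hξ (ruleSampler mode ρ)] with ω hω hfreq m
  refine tendsto_div_one_of_windows (lastDelivered_le _ ξ _ ω m) fun k hk => ?_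
  filter_upwards [hω m ⟨k, hk⟩, hs m ⟨k, hk⟩
    (fun i => nextSource mode ξ (ruleSampler mode ρ) ω i = m) (hfreq m)] with N h1 h2
  by_contra hlt
  refine h1 ⟨fun i hi hd => hlt ?_, h2⟩
  rw [Finset.mem_Ico] at hi
  exact hi.1.trans (lt_lastDelivered mode ξ _ hi.2 hd).le

end Starvation


/-! ### Expected peak sums and the time until the last delivery. -/

section Expectations

variable {M : ℕ} (mode : Mode) (μT μC : Measure ℝ)
  [IsProbabilityMeasure μT] [IsProbabilityMeasure μC] (ξ : Scheduler M) (π : Sampler M)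

/-- The mean of a law on the positive half-line. -/
noncomputable def mean (μ : Measure ℝ) : ENNReal := ∫⁻ t, ENNReal.ofReal t ∂μ

/-- The delay, capped at a level `L ∈ [0, ∞]`. -/
noncomputable def delayFeature (L : ENNReal) (_ : ℝ × ℝ × ℝ) (θ : ℝ) : ENNReal :=
  min (ENNReal.ofReal θ) L

theorem measurable_delayFeature (L : ENNReal) :
    Measurable fun p : (ℝ × ℝ × ℝ) × ℝ => delayFeature L p.1 p.2 := by
  unfold delayFeature; fun_prop

theorem measurable_sum_range_lastDelivered {X : ℕ → Outcome → ENNReal}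
    (hX : ∀ j, Measurable (X j)) (m : Fin M) (N : ℕ) :
    Measurable fun ω => ∑ j ∈ Finset.range (lastDelivered mode ξ π ω m N), X j ω :=
  (measurable_from_prod_countable_left
    (f := fun p : Outcome × ℕ => ∑ j ∈ Finset.range p.2, X j p.1)
    fun n => Finset.measurable_sum (Finset.range n) fun j _ => hX j).comp
    (measurable_id.prodMk (measurable_lastDelivered mode ξ π m N))

/-- The expected time from the generation of packet `0` to that of the last delivered packet of
source `m` among `1, …, N`. -/
noncomputable def lastTime (m : Fin M) (N : ℕ) : ENNReal :=
  ∫⁻ ω, ∑ j ∈ Finset.range (lastDelivered mode ξ π ω m N),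
    ENNReal.ofReal (interGeneration mode ξ π ω j) ∂(law μT μC)

theorem lintegral_deliveredCount (m : Fin M) (N : ℕ) :
    ∫⁻ ω, (deliveredCount mode ξ π ω m N : ENNReal) ∂(law μT μC) =
      total mode ξ π μT μC (deliveredFeature mode) m N := by
  simp only [deliveredCount_eq]
  rw [lintegral_finsetSum _ fun i _ =>
    measurable_sourceFeature mode ξ π (measurable_deliveredFeature mode) m i]
  rfl

variable {μT μC}

theorem lintegral_peakSum (hT : ∀ᵐ t ∂μT, 0 < t) (hC : ∀ᵐ c ∂μC, 0 < c) (m : Fin M) (N : ℕ) :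
    ∫⁻ ω, peakSum mode ξ π ω m N ∂(law μT μC) =
      total mode ξ π μT μC (systemFeature mode) m N + lastTime mode μT μC ξ π m N := by
  have hms : ∀ i ∈ Finset.range N, Measurable (sourceFeature mode ξ π (systemFeature mode) m i) :=
    fun i _ => measurable_sourceFeature mode ξ π (measurable_systemFeature mode) m i
  have hae : ∀ᵐ ω ∂(law μT μC), peakSum mode ξ π ω m N =
      ∑ i ∈ Finset.range N, sourceFeature mode ξ π (systemFeature mode) m i ω +
      ∑ j ∈ Finset.range (lastDelivered mode ξ π ω m N),
        ENNReal.ofReal (interGeneration mode ξ π ω j) := by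
    filter_upwards [ae_T_pos μT μC hT, ae_C_pos μT μC hC] with ω h1 h2
    exact peakSum_eq mode ξ π (fun i => (h1 i).le) (fun i => (h2 i).le) m N
  rw [lintegral_congr_ae hae, lintegral_add_left (Finset.measurable_sum _ hms),
    lintegral_finsetSum _ hms]
  rfl

theorem ofReal_waiting_succ_le {ω : Outcome} (hT : ∀ i, 0 ≤ ω.T i) (hC : ∀ i, 0 ≤ ω.C i) (i : ℕ) :
    ENNReal.ofReal (waiting mode ξ π ω (i + 1)) ≤ ENNReal.ofReal (ω.C i) := by
  refine ENNReal.ofReal_le_ofReal ?_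
  cases mode with
  | nonpreemptive =>
    refine max_le (hC i) ?_
    have h1 := delay_nonneg .nonpreemptive ξ π ω i
    simp only [delay, nextSource, history] at h1
    linarith [hT (i + 1)]
  | preemptive => exact hC i

theorem lintegral_waiting_le (hT : ∀ᵐ t ∂μT, 0 < t) (hC : ∀ᵐ c ∂μC, 0 < c) (i : ℕ) :
    ∫⁻ ω, ENNReal.ofReal (waiting mode ξ π ω i) ∂(law μT μC) ≤ mean μC := by
  cases i with
  | zero => simp [waiting_zero]
  | succ i =>
    rw [mean, ← lintegral_C μT μC ENNReal.measurable_ofReal i]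
    refine lintegral_mono_ae ?_
    filter_upwards [ae_T_pos μT μC hT, ae_C_pos μT μC hC] with ω h1 h2
    exact ofReal_waiting_succ_le mode ξ π (fun i => (h1 i).le) (fun i => (h2 i).le) i

theorem sum_total {F : ℝ × ℝ × ℝ → ℝ → ENNReal}
    (hF : Measurable fun p : (ℝ × ℝ × ℝ) × ℝ => F p.1 p.2) (N : ℕ) :
    ∑ m, total mode ξ π μT μC F m N =
      ∑ i ∈ Finset.range N, ∫⁻ ω, F (fresh mode i ω) (delay mode ξ π ω (stepOf mode i))
        ∂(law μT μC) := by
  simp only [total]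
  rw [Finset.sum_comm]
  refine Finset.sum_congr rfl fun i _ => ?_
  rw [← lintegral_finsetSum _ fun m _ => measurable_sourceFeature mode ξ π hF m i]
  exact lintegral_congr fun ω => sum_sourceFeature mode ξ π F i ω

variable {mode ξ π}

/-- The transmission times share one integrable law and a waiting time is at most the preceding
computation time; only the remaining summand Y needs an assumption. -/
theorem tendsto_lintegral_tail_policy (hT : ∀ᵐ t ∂μT, 0 < t) (hC : ∀ᵐ c ∂μC, 0 < c)
    (hτ : mean μT ≠ ⊤) (hκ : mean μC ≠ ⊤) (hNS : NoStarvation mode μT μC ξ π)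
    {Y : ℕ → Outcome → ENNReal} (hY : ∀ j, Measurable (Y j))
    (hUI : ∀ ε : ENNReal, ε ≠ 0 → ∃ B : ENNReal, B ≠ ⊤ ∧ ∀ᶠ N : ℕ in atTop,
      ∑ j ∈ Finset.range N, ∫⁻ ω, (Y j ω - B) ∂(law μT μC) ≤ ε * N) (m : Fin M) :
    Tendsto (fun N : ℕ => (∫⁻ ω, ∑ j ∈ Finset.Ico (lastDelivered mode ξ π ω m N) N,
      (ENNReal.ofReal (ω.T j) + ENNReal.ofReal (waiting mode ξ π ω j) + Y j ω)
        ∂(law μT μC)) / N) atTop (𝓝 0) := by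
  have hWm : ∀ j, Measurable fun ω : Outcome => ENNReal.ofReal (waiting mode ξ π ω j) :=
    fun j => (measurable_waiting mode ξ π j).ennreal_ofReal
  have hTm : ∀ j, Measurable fun ω : Outcome => ENNReal.ofReal (ω.T j) :=
    fun j => (measurable_T j).ennreal_ofReal
  refine tendsto_lintegral_tail (fun j => ((hTm j).add (hWm j)).add (hY j))
    (measurable_lastDelivered mode ξ π m) (fun N ω => lastDelivered_le mode ξ π ω m N)
    (hNS.mono fun ω h => h m) fun ε hε => ?_
  have hε3 : ε / 3 ≠ 0 := (ENNReal.div_pos hε (by norm_num)).ne'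
  obtain ⟨B1, hB1, h1⟩ := exists_lintegral_tsub_le ENNReal.measurable_ofReal hτ hε3
  obtain ⟨B2, hB2, h2⟩ := exists_lintegral_tsub_le ENNReal.measurable_ofReal hκ hε3
  obtain ⟨B3, hB3, h3⟩ := hUI (ε / 3) hε3
  refine ⟨B1 + B2 + B3, by simp [hB1, hB2, hB3], ?_⟩
  filter_upwards [h3] with N hN
  have hTj : ∀ j, ∫⁻ ω, (ENNReal.ofReal (ω.T j) - B1) ∂(law μT μC) ≤ ε / 3 := fun j => by
    rw [lintegral_T μT μC (h := fun t => ENNReal.ofReal t - B1) (by fun_prop)]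
    exact h1
  have hWj : ∀ j, ∫⁻ ω, (ENNReal.ofReal (waiting mode ξ π ω j) - B2) ∂(law μT μC) ≤ ε / 3 := by
    intro j
    cases j with
    | zero => simp [waiting_zero]
    | succ j =>
      refine le_trans ?_ h2
      rw [← lintegral_C μT μC (h := fun t => ENNReal.ofReal t - B2) (by fun_prop) j]
      refine lintegral_mono_ae ?_
      filter_upwards [ae_T_pos μT μC hT, ae_C_pos μT μC hC] with ω h1 h2
      exact tsub_le_tsub_right (ofReal_waiting_succ_le mode ξ π (fun i => (h1 i).le)
        (fun i => (h2 i).le) j) _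
  have hsub : ∀ a b c : ENNReal, a + b + c - (B1 + B2 + B3) ≤ (a - B1) + (b - B2) + (c - B3) :=
    fun a b c => (add_tsub_add_le_tsub_add_tsub).trans
      (add_le_add_left add_tsub_add_le_tsub_add_tsub _)
  calc ∑ j ∈ Finset.range N, ∫⁻ ω, (ENNReal.ofReal (ω.T j) +
          ENNReal.ofReal (waiting mode ξ π ω j) + Y j ω - (B1 + B2 + B3)) ∂(law μT μC)
      ≤ ∑ j ∈ Finset.range N, (ε / 3 + ε / 3 + ∫⁻ ω, (Y j ω - B3) ∂(law μT μC)) := by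
        refine Finset.sum_le_sum fun j _ => ?_
        have m1 : Measurable fun ω : Outcome => ENNReal.ofReal (ω.T j) - B1 :=
          (hTm j).sub measurable_const
        have m2 : Measurable fun ω : Outcome => ENNReal.ofReal (waiting mode ξ π ω j) - B2 :=
          (hWm j).sub measurable_const
        refine (lintegral_mono fun ω => hsub _ _ _).trans ?_
        rw [lintegral_add_left (by exact m1.add m2), lintegral_add_left m1]
        gcongr
        · exact hTj j
        · exact hWj j
    _ ≤ ε * N := by
        rw [Finset.sum_add_distrib, Finset.sum_const, Finset.card_range, nsmul_eq_mul]
        calc (N : ENNReal) * (ε / 3 + ε / 3) + _ ≤ N * (ε / 3 + ε / 3) + ε / 3 * N := by gcongr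
          _ = (ε / 3 + ε / 3 + ε / 3) * N := by ring
          _ = ε * N := by rw [ENNReal.add_thirds]

/-- The main lower bound on the time until the last delivery: all the delays, capped at the level
`L`, contribute to it asymptotically. -/
theorem exists_total_le_lastTime (hT : ∀ᵐ t ∂μT, 0 < t) (hC : ∀ᵐ c ∂μC, 0 < c)
    (hτ : mean μT ≠ ⊤) (hκ : mean μC ≠ ⊤) (hNS : NoStarvation mode μT μC ξ π) (L : ℕ)
    (m : Fin M) :
    ∃ e : ℕ → ENNReal, Tendsto e atTop (𝓝 0) ∧ ∀ N : ℕ, 0 < N →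
      mean μT + ∑ m', total mode ξ π μT μC (waitingFeature mode) m' N / N +
        ∑ m', total mode ξ π μT μC (delayFeature L) m' N / N ≤
      lastTime mode μT μC ξ π m N / N + e N := by
  set Y : ℕ → Outcome → ENNReal := fun j ω =>
    min (ENNReal.ofReal (delay mode ξ π ω j)) L with hYdef
  have hY : ∀ j, Measurable (Y j) := fun j =>
    (measurable_delay mode ξ π j).ennreal_ofReal.min measurable_const
  have hWm : ∀ j, Measurable fun ω : Outcome => ENNReal.ofReal (waiting mode ξ π ω j) :=
    fun j => (measurable_waiting mode ξ π j).ennreal_ofReal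
  have hTm : ∀ j, Measurable fun ω : Outcome => ENNReal.ofReal (ω.T j) :=
    fun j => (measurable_T j).ennreal_ofReal
  -- Capped delays have no excess over B = L.
  have htail := tendsto_lintegral_tail_policy hT hC hτ hκ hNS hY (fun ε _ =>
    ⟨L, ENNReal.natCast_ne_top L, Eventually.of_forall fun N => by
      simp [hYdef, tsub_eq_zero_of_le (min_le_right _ _)]⟩) m
  have hrest : Tendsto (fun N : ℕ => (mean μC + L) / (N : ENNReal)) atTop (𝓝 0) :=
    ENNReal.Tendsto.const_div ENNReal.tendsto_nat_nhds_top (Or.inr (by simp [hκ])) |>.trans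
      (by simp)
  refine ⟨_, by simpa using htail.add hrest, fun N hN => ?_⟩
  have hN0 : (N : ENNReal) ≠ 0 := by exact_mod_cast hN.ne'
  have hNt : (N : ENNReal) ≠ ⊤ := ENNReal.natCast_ne_top N
  have hsplit : ∑ j ∈ Finset.range N, ∫⁻ ω, (ENNReal.ofReal (ω.T j) +
        ENNReal.ofReal (waiting mode ξ π ω j) + Y j ω) ∂(law μT μC) ≤
      lastTime mode μT μC ξ π m N +
        ∫⁻ ω, ∑ j ∈ Finset.Ico (lastDelivered mode ξ π ω m N) N,
          (ENNReal.ofReal (ω.T j) + ENNReal.ofReal (waiting mode ξ π ω j) + Y j ω)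
            ∂(law μT μC) := by
    have hm : ∀ j ∈ Finset.range N, Measurable fun ω : Outcome =>
        ENNReal.ofReal (ω.T j) + ENNReal.ofReal (waiting mode ξ π ω j) + Y j ω :=
      fun j _ => ((hTm j).add (hWm j)).add (hY j)
    rw [← lintegral_finsetSum _ hm, lastTime]
    rw [← lintegral_add_left (measurable_sum_range_lastDelivered mode ξ π (fun j =>
      (measurable_interGeneration mode ξ π j).ennreal_ofReal) m N)]
    refine lintegral_mono_ae ?_
    filter_upwards [ae_T_pos μT μC hT] with ω h1
    rw [← Finset.sum_range_add_sum_Ico _ (lastDelivered_le mode ξ π ω m N)]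
    gcongr with j hj
    rw [interGeneration, ENNReal.ofReal_add (add_nonneg (h1 j).le (waiting_nonneg _ _ _ _ _))
      (delay_nonneg _ _ _ _ _), ENNReal.ofReal_add (h1 j).le (waiting_nonneg _ _ _ _ _)]
    gcongr
    exact min_le_left _ _
  have hTsum : ∑ j ∈ Finset.range N, ∫⁻ ω, ENNReal.ofReal (ω.T j) ∂(law μT μC) =
      N * mean μT := by
    simp only [lintegral_T μT μC ENNReal.measurable_ofReal]
    simp [mean]
  -- The totals run over W 1, …, W N, the inter-generation times over W 0, …, W (N - 1); the extra
  -- term has mean at most `mean μC`.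
  have hWsum : ∑ m', total mode ξ π μT μC (waitingFeature mode) m' N ≤
      ∑ j ∈ Finset.range N, ∫⁻ ω, ENNReal.ofReal (waiting mode ξ π ω j) ∂(law μT μC) +
        mean μC := by
    rw [sum_total mode ξ π (measurable_waitingFeature mode)]
    simp only [← ofReal_waiting_succ]
    calc _ ≤ ∑ i ∈ Finset.range (N + 1),
          ∫⁻ ω, ENNReal.ofReal (waiting mode ξ π ω i) ∂(law μT μC) := by
          rw [Finset.sum_range_succ']; exact le_self_add
      _ ≤ _ := by
          rw [Finset.sum_range_succ]
          gcongr
          exact lintegral_waiting_le mode ξ π hT hC N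
  have hYsum : ∑ m', total mode ξ π μT μC (delayFeature L) m' N ≤
      ∑ j ∈ Finset.range N, ∫⁻ ω, Y j ω ∂(law μT μC) + L := by
    have hYL : ∀ j, ∫⁻ ω, Y j ω ∂(law μT μC) ≤ L := fun j =>
      (lintegral_mono fun ω => min_le_right _ _).trans (by simp)
    rw [sum_total mode ξ π (measurable_delayFeature L)]
    change ∑ i ∈ Finset.range N, ∫⁻ ω, Y (stepOf mode i) ω ∂(law μT μC) ≤ _
    -- With preemption the deciding step is i + 1, which shifts the sum by one; the extra capped
    -- delay is at most L.
    cases mode with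
    | nonpreemptive => exact le_self_add
    | preemptive =>
      calc _ ≤ ∑ i ∈ Finset.range (N + 1), ∫⁻ ω, Y i ω ∂(law μT μC) := by
            rw [Finset.sum_range_succ']; exact le_self_add
        _ ≤ _ := by
            rw [Finset.sum_range_succ]
            gcongr
            exact hYL N
  have hall : N * mean μT + ∑ m', total mode ξ π μT μC (waitingFeature mode) m' N +
        ∑ m', total mode ξ π μT μC (delayFeature L) m' N ≤
      lastTime mode μT μC ξ π m N +
        ∫⁻ ω, ∑ j ∈ Finset.Ico (lastDelivered mode ξ π ω m N) N,
          (ENNReal.ofReal (ω.T j) + ENNReal.ofReal (waiting mode ξ π ω j) + Y j ω)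
            ∂(law μT μC) + (mean μC + L) := by
    calc _ ≤ N * mean μT + (∑ j ∈ Finset.range N,
            ∫⁻ ω, ENNReal.ofReal (waiting mode ξ π ω j) ∂(law μT μC) + mean μC) +
            (∑ j ∈ Finset.range N, ∫⁻ ω, Y j ω ∂(law μT μC) + L) := by gcongr
      _ = ∑ j ∈ Finset.range N, ∫⁻ ω, (ENNReal.ofReal (ω.T j) +
            ENNReal.ofReal (waiting mode ξ π ω j) + Y j ω) ∂(law μT μC) + (mean μC + L) := by
          have : ∀ j, ∫⁻ ω, (ENNReal.ofReal (ω.T j) +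
              ENNReal.ofReal (waiting mode ξ π ω j) + Y j ω) ∂(law μT μC) =
              ∫⁻ ω, ENNReal.ofReal (ω.T j) ∂(law μT μC) +
              ∫⁻ ω, ENNReal.ofReal (waiting mode ξ π ω j) ∂(law μT μC) +
              ∫⁻ ω, Y j ω ∂(law μT μC) := fun j => by
            rw [lintegral_add_right _ (hY j), lintegral_add_right _ (hWm j)]
          simp only [this, Finset.sum_add_distrib, hTsum]
          ring
      _ ≤ _ := by gcongr
  have hdiv := ENNReal.div_le_div_right hall (N : ENNReal)
  simp only [ENNReal.add_div] at hdiv ⊢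
  rw [mul_comm, ENNReal.mul_div_cancel_right hN0 hNt] at hdiv
  simp only [div_eq_mul_inv, Finset.sum_mul] at hdiv ⊢
  rwa [← add_assoc]

end Expectations


/-! ### Averages with values in [0, ∞]. -/

section ENNRealAverages

theorem tendsto_ennreal_average_of_shift {x : ℕ → ENNReal} {a : ENNReal} (h0 : x 0 ≠ ⊤)
    (h : Tendsto (fun N : ℕ => (∑ i ∈ Finset.range N, x (i + 1)) / N) atTop (𝓝 a)) :
    Tendsto (fun N : ℕ => (∑ i ∈ Finset.range N, x i) / N) atTop (𝓝 a) := by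
  rw [← tendsto_add_atTop_iff_nat 1]
  have h1 : Tendsto (fun N : ℕ => (N : ENNReal) / ((N + 1 : ℕ) : ENNReal)) atTop (𝓝 1) := by
    have := ENNReal.tendsto_ofReal (tendsto_natCast_div_add_atTop (1 : ℝ))
    rw [ENNReal.ofReal_one] at this
    refine this.congr fun N => ?_
    rw [ENNReal.ofReal_div_of_pos (by positivity)]
    congr 1
    · exact ENNReal.ofReal_natCast N
    · exact_mod_cast ENNReal.ofReal_natCast (N + 1)
  have h2 : Tendsto (fun N : ℕ => x 0 / ((N + 1 : ℕ) : ENNReal)) atTop (𝓝 0) := by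
    have : Tendsto (fun N : ℕ => x 0 / (N : ENNReal)) atTop (𝓝 (x 0 / ⊤)) :=
      ENNReal.Tendsto.const_div ENNReal.tendsto_nat_nhds_top (Or.inr h0)
    rw [ENNReal.div_top] at this
    exact this.comp (tendsto_add_atTop_nat 1)
  have h3 := (ENNReal.Tendsto.mul h (Or.inr ENNReal.one_ne_top) h1 (Or.inl one_ne_zero)).add h2
  rw [mul_one, add_zero] at h3
  refine h3.congr' ?_
  filter_upwards [eventually_gt_atTop 0] with N hN
  have hN0 : (N : ENNReal) ≠ 0 := by exact_mod_cast hN.ne'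
  rw [Finset.sum_range_succ', ENNReal.add_div]
  congr 1
  simp only [div_eq_mul_inv]
  rw [← mul_assoc, mul_assoc _ ((N : ENNReal)⁻¹) _,
    ENNReal.inv_mul_cancel hN0 (ENNReal.natCast_ne_top N), mul_one]

theorem eventually_sum_le_of_eventually_le {x : ℕ → ENNReal} (hx : ∀ i, x i ≠ ⊤) {ε : ENNReal}
    (hε : ε ≠ 0) (h : ∀ᶠ i in atTop, x i ≤ ε / 2) :
    ∀ᶠ N : ℕ in atTop, ∑ i ∈ Finset.range N, x i ≤ ε * N := by
  obtain ⟨n, hn⟩ := eventually_atTop.1 h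
  set K := ∑ i ∈ Finset.range n, x i with hK
  have hKt : K ≠ ⊤ := (ENNReal.sum_lt_top.2 fun i _ => (hx i).lt_top).ne
  have hlim : Tendsto (fun N : ℕ => K / (N : ENNReal)) atTop (𝓝 (K / ⊤)) :=
    ENNReal.Tendsto.const_div ENNReal.tendsto_nat_nhds_top (Or.inr hKt)
  rw [ENNReal.div_top] at hlim
  filter_upwards [ENNReal.tendsto_nhds_zero.1 hlim (ε / 2) (ENNReal.half_pos hε),
    eventually_ge_atTop n, eventually_gt_atTop 0] with N h1 h2 hN
  have hN0 : (N : ENNReal) ≠ 0 := by exact_mod_cast hN.ne'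
  rw [ENNReal.div_le_iff hN0 (ENNReal.natCast_ne_top N)] at h1
  calc ∑ i ∈ Finset.range N, x i = K + ∑ i ∈ Finset.Ico n N, x i :=
        (Finset.sum_range_add_sum_Ico _ h2).symm
    _ ≤ ε / 2 * N + ∑ i ∈ Finset.Ico n N, ε / 2 := by
        gcongr with i hi
        exact hn i (Finset.mem_Ico.1 hi).1
    _ ≤ ε / 2 * N + ε / 2 * N := by
        rw [Finset.sum_const, Nat.card_Ico, nsmul_eq_mul, mul_comm (_ : ENNReal) (ε / 2)]
        gcongr
        exact Nat.sub_le _ _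
    _ = ε * N := by rw [← add_mul, ENNReal.add_halves]

end ENNRealAverages

/-! ### Uniform bounds on the performance of rules. -/

section Bounds

variable {mode : Mode} {μT μC : Measure ℝ}
  [IsProbabilityMeasure μT] [IsProbabilityMeasure μC]

theorem waitingFeature_le {z : ℝ × ℝ × ℝ} (hz : FreshPos z) {θ : ℝ} (hθ : 0 ≤ θ) :
    waitingFeature mode z θ ≤ ENNReal.ofReal (observed mode z).2 := by
  obtain ⟨h1, h2, -⟩ := hz
  cases mode with
  | nonpreemptive =>
    exact ENNReal.ofReal_le_ofReal (max_le h1.le (by simp only [observed]; linarith))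
  | preemptive => exact zero_le

theorem systemFeature_le {z : ℝ × ℝ × ℝ} (hz : FreshPos z) {θ : ℝ} (hθ : 0 ≤ θ) :
    systemFeature mode z θ ≤ ENNReal.ofReal (freshT mode z) +
      ENNReal.ofReal (observed mode z).2 + ENNReal.ofReal (freshC mode z) := by
  refine (mul_le_of_le_one_left zero_le (deliveredFeature_le_one mode z θ)).trans ?_
  gcongr
  exact waitingFeature_le hz hθ

theorem value_delivered_le (ρ : Rule) : value mode μT μC (deliveredFeature mode) ρ ≤ 1 :=
  (lintegral_mono fun _ => deliveredFeature_le_one _ _ _).trans (by simp)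

theorem lintegral_prod_fresh {h : ℝ × ℝ × ℝ → ENNReal} (hh : Measurable h) :
    ∫⁻ p, h p.2 ∂((volume : Measure unitInterval).prod (freshLaw mode μT μC)) =
      ∫⁻ z, h z ∂(freshLaw mode μT μC) :=
  (measurePreserving_snd (μ := (volume : Measure unitInterval))
    (ν := freshLaw mode μT μC)).lintegral_comp hh

theorem lintegral_bound :
    ∫⁻ z, (ENNReal.ofReal (freshT mode z) + ENNReal.ofReal (observed mode z).2 +
      ENNReal.ofReal (freshC mode z)) ∂(freshLaw mode μT μC) = mean μT + mean μC + mean μC := by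
  have h1 : Measurable fun z => ENNReal.ofReal (freshT mode z) :=
    (measurable_freshT mode).ennreal_ofReal
  have h2 : Measurable fun z => ENNReal.ofReal (observed mode z).2 :=
    (measurable_snd.comp (measurable_observed mode)).ennreal_ofReal
  have h12 : Measurable fun z => ENNReal.ofReal (freshT mode z) +
    ENNReal.ofReal (observed mode z).2 := h1.add h2
  rw [lintegral_add_left h12, lintegral_add_left h1,
    lintegral_freshT mode μT μC ENNReal.measurable_ofReal,
    lintegral_observed mode μT μC ENNReal.measurable_ofReal,
    lintegral_freshC mode μT μC ENNReal.measurable_ofReal]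
  rfl

theorem value_system_le (hT : ∀ᵐ t ∂μT, 0 < t) (hC : ∀ᵐ c ∂μC, 0 < c) (ρ : Rule) :
    value mode μT μC (systemFeature mode) ρ ≤ mean μT + mean μC + mean μC := by
  have hm : Measurable fun z => ENNReal.ofReal (freshT mode z) +
      ENNReal.ofReal (observed mode z).2 + ENNReal.ofReal (freshC mode z) :=
    ((measurable_freshT mode).ennreal_ofReal.add
      (measurable_snd.comp (measurable_observed mode)).ennreal_ofReal).add
      (measurable_freshC mode).ennreal_ofReal
  rw [← lintegral_bound (mode := mode), ← lintegral_prod_fresh hm]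
  refine lintegral_mono_ae ?_
  filter_upwards [ae_freshPos_prod mode μT μC hT hC] with p hp
  exact systemFeature_le hp (ρ.act_nonneg _ _ _)

theorem value_waiting_le (hT : ∀ᵐ t ∂μT, 0 < t) (hC : ∀ᵐ c ∂μC, 0 < c) (ρ : Rule) :
    value mode μT μC (waitingFeature mode) ρ ≤ mean μC := by
  have h := lintegral_observed mode μT μC ENNReal.measurable_ofReal
  have hm : Measurable fun z => ENNReal.ofReal (observed mode z).2 :=
    (measurable_snd.comp (measurable_observed mode)).ennreal_ofReal
  rw [mean, ← h, ← lintegral_prod_fresh hm]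
  refine lintegral_mono_ae ?_
  filter_upwards [ae_freshPos_prod mode μT μC hT hC] with p hp
  exact waitingFeature_le hp (ρ.act_nonneg _ _ _)

end Bounds

/-! ### Average peak ages of rule-based samplers. -/

section Evaluation

variable {M : ℕ} {mode : Mode} {μT μC : Measure ℝ}
  [IsProbabilityMeasure μT] [IsProbabilityMeasure μC] {ξ : Scheduler M}

theorem lintegral_sourceFeature_one_le (π : Sampler M) (m : Fin M) (i : ℕ) :
    ∫⁻ ω, sourceFeature mode ξ π (fun _ _ => 1) m i ω ∂(law μT μC) ≤ 1 := by
  refine (lintegral_mono (g := fun _ => 1) fun ω => ?_).trans (by simp)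
  simp only [sourceFeature]
  split_ifs <;> simp

/-- The almost sure frequencies are bounded by 1, so their means converge as well. -/
theorem tendsto_total_one {f : Fin M → ℝ} (hξ : HasSchedulingFrequency mode μT μC ξ f)
    (π : Sampler M) (m : Fin M) :
    Tendsto (fun N : ℕ => total mode ξ π μT μC (fun _ _ => 1) m N / N) atTop
      (𝓝 (ENNReal.ofReal (f m))) := by
  have hm : ∀ i, Measurable (sourceFeature mode ξ π (fun _ _ => 1) m i) := fun i =>
    measurable_sourceFeature mode ξ π measurable_const m i
  have heq : ∀ N : ℕ, total mode ξ π μT μC (fun _ _ => 1) m N / N =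
      ∫⁻ ω, (scheduledCount mode ξ π ω m N : ENNReal) / N ∂(law μT μC) := by
    intro N
    simp only [scheduledCount_eq, div_eq_mul_inv]
    rw [lintegral_mul_const _ (Finset.measurable_sum _ fun i _ => hm i),
      lintegral_finsetSum _ fun i _ => hm i]
    rfl
  have hlim : Tendsto (fun N : ℕ => ∫⁻ ω, (scheduledCount mode ξ π ω m N : ENNReal) / N
      ∂(law μT μC)) atTop (𝓝 (∫⁻ _, ENNReal.ofReal (f m) ∂(law μT μC))) := by
    refine tendsto_lintegral_of_dominated_convergence (fun _ => 1) (fun N => ?_)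
      (fun N => ae_of_all _ fun ω => ENNReal.div_le_of_le_mul ?_) (by simp) ?_
    · simp only [scheduledCount_eq]
      exact (Finset.measurable_sum _ fun i _ => hm i).div_const _
    · rw [one_mul]
      have : scheduledCount mode ξ π ω m N ≤ N := by
        classical
        exact (Finset.card_filter_le _ _).trans (by simp)
      exact_mod_cast this
    · filter_upwards [hξ π] with ω hω
      refine (ENNReal.tendsto_ofReal (hω m)).congr' ?_
      filter_upwards [eventually_gt_atTop 0] with N hN
      rw [ENNReal.ofReal_div_of_pos (by exact_mod_cast hN), ENNReal.ofReal_natCast,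
        ENNReal.ofReal_natCast]
  simp only [heq]
  simpa using hlim

variable {ρ : ℕ → Fin M → Rule}

theorem lintegral_sourceFeature_ruleSampler
    (h0 : ∀ m u t c, (ρ 0 m).act u t c = max c 0)
    {F : ℝ × ℝ × ℝ → ℝ → ENNReal} (hF : Measurable fun p : (ℝ × ℝ × ℝ) × ℝ => F p.1 p.2) (i : ℕ)
    (m : Fin M) :
    ∫⁻ ω, sourceFeature mode ξ (ruleSampler mode ρ) F m i ω ∂(law μT μC) =
      (∫⁻ ω, sourceFeature mode ξ (ruleSampler mode ρ) (fun _ _ => 1) m i ω ∂(law μT μC)) *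
        value mode μT μC F (ρ (stepOf mode i) m) := by
  have := lintegral_mul_sourceFeature_ruleSampler mode ξ ρ μT μC h0 hF
    (H := fun _ => 1) measurable_const i (fun _ _ => rfl) m
  simpa using this

theorem lintegral_feature_ruleSampler_le
    (h0 : ∀ m u t c, (ρ 0 m).act u t c = max c 0)
    {F : ℝ × ℝ × ℝ → ℝ → ENNReal} (hF : Measurable fun p : (ℝ × ℝ × ℝ) × ℝ => F p.1 p.2) (i : ℕ)
    {B : ENNReal} (hB : ∀ m, value mode μT μC F (ρ (stepOf mode i) m) ≤ B) :
    ∫⁻ ω, F (fresh mode i ω) (delay mode ξ (ruleSampler mode ρ) ω (stepOf mode i))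
      ∂(law μT μC) ≤ B := by
  set π := ruleSampler mode ρ
  have hsum : ∀ G : ℝ × ℝ × ℝ → ℝ → ENNReal, (Measurable fun p : (ℝ × ℝ × ℝ) × ℝ => G p.1 p.2) →
      ∫⁻ ω, G (fresh mode i ω) (delay mode ξ π ω (stepOf mode i)) ∂(law μT μC) =
        ∑ m, ∫⁻ ω, sourceFeature mode ξ π G m i ω ∂(law μT μC) := by
    intro G hG
    rw [← lintegral_finsetSum _ fun m _ => measurable_sourceFeature mode ξ π hG m i]
    exact lintegral_congr fun ω => (sum_sourceFeature mode ξ π G i ω).symm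
  rw [hsum F hF]
  calc ∑ m, ∫⁻ ω, sourceFeature mode ξ π F m i ω ∂(law μT μC)
      ≤ ∑ m, (∫⁻ ω, sourceFeature mode ξ π (fun _ _ => 1) m i ω ∂(law μT μC)) * B := by
        refine Finset.sum_le_sum fun m _ => ?_
        rw [lintegral_sourceFeature_ruleSampler h0 hF]
        gcongr
        exact hB m
    _ = B := by
        rw [← Finset.sum_mul, ← hsum _ measurable_const]
        simp

/-- Each summand is the probability that the packet comes from m times the value of the rule in
force. The values converge; the probabilities need only converge in the Cesàro sense. -/
theorem tendsto_total_ruleSampler {f : Fin M → ℝ} (hf : ∀ m, 0 < f m)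
    (hξ : HasSchedulingFrequency mode μT μC ξ f)
    (h0 : ∀ m u t c, (ρ 0 m).act u t c = max c 0)
    {F : ℝ × ℝ × ℝ → ℝ → ENNReal} (hF : Measurable fun p : (ℝ × ℝ × ℝ) × ℝ => F p.1 p.2)
    (m : Fin M) (hfin : ∀ n, value mode μT μC F (ρ n m) ≠ ⊤) {v : ℝ} (hv0 : 0 ≤ v)
    (hv : Tendsto (fun n => value mode μT μC F (ρ n m)) atTop (𝓝 (ENNReal.ofReal v))) :
    Tendsto (fun N : ℕ => total mode ξ (ruleSampler mode ρ) μT μC F m N / N) atTop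
      (𝓝 (ENNReal.ofReal (f m * v))) := by
  set π := ruleSampler mode ρ with hπ
  set p : ℕ → ENNReal := fun i =>
    ∫⁻ ω, sourceFeature mode ξ π (fun _ _ => 1) m i ω ∂(law μT μC) with hp
  have hp1 : ∀ i, p i ≤ 1 := fun i => lintegral_sourceFeature_one_le π m i
  have hpt : ∀ i, p i ≠ ⊤ := fun i => ne_top_of_le_ne_top ENNReal.one_ne_top (hp1 i)
  have hpf : Tendsto (fun N : ℕ => (∑ i ∈ Finset.range N, (p i).toReal) / N) atTop (𝓝 (f m)) := by
    have := (ENNReal.tendsto_toReal ENNReal.ofReal_ne_top).comp (tendsto_total_one hξ π m)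
    rw [ENNReal.toReal_ofReal (hf m).le] at this
    refine this.congr fun N => ?_
    simp only [Function.comp, total, ENNReal.toReal_div, ENNReal.toReal_natCast]
    rw [ENNReal.toReal_sum fun i _ => hpt i]
  have hst : Tendsto (fun i => stepOf mode i) atTop atTop :=
    tendsto_atTop_mono (le_stepOf mode) tendsto_id
  have hvr : Tendsto (fun i => (value mode μT μC F (ρ (stepOf mode i) m)).toReal) atTop (𝓝 v) := by
    have := ((ENNReal.tendsto_toReal ENNReal.ofReal_ne_top).comp hv).comp hst
    rwa [ENNReal.toReal_ofReal hv0] at this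
  have hmain := ENNReal.tendsto_ofReal (tendsto_average_mul (fun i => ENNReal.toReal_nonneg)
    (fun i => ENNReal.toReal_le_of_le_ofReal zero_le_one (by simpa using hp1 i)) hpf hvr)
  refine hmain.congr' ?_
  filter_upwards [eventually_gt_atTop 0] with N hN
  rw [ENNReal.ofReal_div_of_pos (by exact_mod_cast hN), ENNReal.ofReal_natCast,
    ENNReal.ofReal_sum_of_nonneg fun i _ => mul_nonneg ENNReal.toReal_nonneg ENNReal.toReal_nonneg]
  congr 1
  refine Finset.sum_congr rfl fun i _ => ?_
  rw [lintegral_sourceFeature_ruleSampler h0 hF, ENNReal.ofReal_mul ENNReal.toReal_nonneg,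
    ENNReal.ofReal_toReal (hpt i), ENNReal.ofReal_toReal (hfin _)]

/-- A sampler that applies a convergent, uniformly integrable sequence of rules starves no source,
and its average peak ages are given by the limiting performance of the rules. -/
theorem performance_ruleSampler (hT : ∀ᵐ t ∂μT, 0 < t) (hC : ∀ᵐ c ∂μC, 0 < c)
    (hτ : mean μT ≠ ⊤) (hκ : mean μC ≠ ⊤) {f : Fin M → ℝ} (hf : ∀ m, 0 < f m)
    (hξ : HasSchedulingFrequency mode μT μC ξ f)
    (h0 : ∀ m u t c, (ρ 0 m).act u t c = max c 0)
    {d g w a : Fin M → ℝ} (hd0 : ∀ m, 0 < d m) (hg0 : ∀ m, 0 ≤ g m) (hw0 : ∀ m, 0 ≤ w m)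
    (ha0 : ∀ m, 0 ≤ a m)
    (hd : ∀ m, Tendsto (fun n => value mode μT μC (deliveredFeature mode) (ρ n m)) atTop
      (𝓝 (ENNReal.ofReal (d m))))
    (hg : ∀ m, Tendsto (fun n => value mode μT μC (systemFeature mode) (ρ n m)) atTop
      (𝓝 (ENNReal.ofReal (g m))))
    (hw : ∀ m, Tendsto (fun n => value mode μT μC (waitingFeature mode) (ρ n m)) atTop
      (𝓝 (ENNReal.ofReal (w m))))
    (ha : ∀ m, Tendsto (fun n => value mode μT μC (delayFeature ⊤) (ρ n m)) atTop
      (𝓝 (ENNReal.ofReal (a m))))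
    (hfin : ∀ n m, value mode μT μC (delayFeature ⊤) (ρ n m) ≠ ⊤)
    (hUI : ∀ ε : ENNReal, ε ≠ 0 → ∃ B : ENNReal, B ≠ ⊤ ∧ ∀ᶠ n in atTop, ∀ m,
      value mode μT μC (fun _ θ => ENNReal.ofReal θ - B) (ρ n m) ≤ ε) :
    NoStarvation mode μT μC ξ (ruleSampler mode ρ) ∧
      ∀ m, HasAveragePeakAge mode μT μC ξ (ruleSampler mode ρ) m
        (ENNReal.ofReal (((mean μT).toReal + ∑ m', f m' * (w m' + a m') + f m * g m) /
          (f m * d m))) := by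
  set π := ruleSampler mode ρ with hπ
  have hNS : NoStarvation mode μT μC ξ π := by
    -- Take q = 1 - δ with δ below 1 and below every limiting delivery probability.
    obtain ⟨q, hq0, hq1, hqd⟩ : ∃ q : ENNReal, q ≠ 0 ∧ q < 1 ∧
        ∀ m, 1 < q + ENNReal.ofReal (d m) := by
      have hev : ∀ᶠ δ : ℝ in 𝓝[>] 0, 0 < δ ∧ δ < 1 ∧ ∀ m, δ < d m := by
        refine (eventually_mem_nhdsWithin (a := (0 : ℝ)) (s := Set.Ioi 0)).and
          (((eventually_lt_nhds one_pos).filter_mono nhdsWithin_le_nhds).and ?_)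
        exact (eventually_all.2 fun m => eventually_lt_nhds (hd0 m)).filter_mono
          nhdsWithin_le_nhds
      obtain ⟨δ, hδ0, hδ1, hδ⟩ := hev.exists
      refine ⟨ENNReal.ofReal (1 - δ), (ENNReal.ofReal_pos.2 (by linarith)).ne', ?_, fun m => ?_⟩
      · rw [ENNReal.ofReal_lt_one]; linarith
      · rw [← ENNReal.ofReal_add (by linarith) (hd0 m).le, ENNReal.one_lt_ofReal]
        linarith [hδ m]
    refine noStarvation_ruleSampler ρ hf hξ h0 hq0 hq1 (eventually_all.2 fun m => ?_)
    filter_upwards [((hd m).const_add q).eventually_const_lt (hqd m)] with i hi using hi.le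
  refine ⟨hNS, fun m => ?_⟩
  have hW := fun j => (measurable_waiting mode ξ π j).ennreal_ofReal
  have hTm := fun j => (measurable_T j).ennreal_ofReal
  set Y : ℕ → Outcome → ENNReal := fun j ω => ENNReal.ofReal (delay mode ξ π ω j) with hYdef
  have hY : ∀ j, Measurable (Y j) := fun j => (measurable_delay mode ξ π j).ennreal_ofReal
  -- Every step after step 0 decides the fate of some packet, so its delay is controlled by the
  -- values of the rules.
  have hst : ∀ j, 0 < j → ∃ i, stepOf mode i = j := by
    intro j hj
    cases mode with
    | nonpreemptive => exact ⟨j, rfl⟩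
    | preemptive => exact ⟨j - 1, by simp only [stepOf]; omega⟩
  have hYfin : ∀ j, ∫⁻ ω, Y j ω ∂(law μT μC) ≠ ⊤ := by
    intro j
    rcases Nat.eq_zero_or_pos j with rfl | hj
    · have : ∫⁻ ω, Y 0 ω ∂(law μT μC) = mean μC := by
        rw [mean, ← lintegral_C μT μC ENNReal.measurable_ofReal 0]
        refine lintegral_congr fun ω => ?_
        change ENNReal.ofReal (max (ω.C 0) 0) = _
        simp
      rwa [this]
    · obtain ⟨i, rfl⟩ := hst j hj
      refine ne_top_of_le_ne_top (ENNReal.sum_lt_top.2 fun m _ => (hfin (stepOf mode i) m).lt_top).ne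
        (le_trans (le_of_eq ?_) (lintegral_feature_ruleSampler_le (ξ := ξ) h0
          (measurable_delayFeature ⊤) i (fun m => Finset.single_le_sum
            (f := fun m => value mode μT μC (delayFeature ⊤) (ρ (stepOf mode i) m))
            (fun _ _ => zero_le) (Finset.mem_univ m))))
      simp [hYdef, delayFeature, hπ]
  have hUIY : ∀ ε : ENNReal, ε ≠ 0 → ∃ B : ENNReal, B ≠ ⊤ ∧ ∀ᶠ N : ℕ in atTop,
      ∑ j ∈ Finset.range N, ∫⁻ ω, (Y j ω - B) ∂(law μT μC) ≤ ε * N := by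
    intro ε hε
    obtain ⟨B, hB, hBn⟩ := hUI (ε / 2) (ENNReal.half_pos hε).ne'
    refine ⟨B, hB, eventually_sum_le_of_eventually_le (fun j => ne_top_of_le_ne_top (hYfin j)
      (lintegral_mono fun ω => tsub_le_self)) hε ?_⟩
    filter_upwards [hBn, eventually_gt_atTop 0] with j h1 hj
    obtain ⟨i, rfl⟩ := hst j hj
    exact lintegral_feature_ruleSampler_le (ξ := ξ) (F := fun _ θ => ENNReal.ofReal θ - B) h0
      (by fun_prop) i h1
  have htail := tendsto_lintegral_tail_policy hT hC hτ hκ hNS hY hUIY m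
  have hsumtot : ∀ {F : ℝ × ℝ × ℝ → ℝ → ENNReal} {v : Fin M → ℝ}, (∀ m, 0 ≤ v m) →
      (Measurable fun p : (ℝ × ℝ × ℝ) × ℝ => F p.1 p.2) →
      (∀ n m, value mode μT μC F (ρ n m) ≠ ⊤) →
      (∀ m, Tendsto (fun n => value mode μT μC F (ρ n m)) atTop (𝓝 (ENNReal.ofReal (v m)))) →
      Tendsto (fun N : ℕ => (∑ i ∈ Finset.range N, ∫⁻ ω, F (fresh mode i ω)
        (delay mode ξ π ω (stepOf mode i)) ∂(law μT μC)) / N) atTop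
        (𝓝 (ENNReal.ofReal (∑ m', f m' * v m'))) := by
    intro F v hv0 hF hFfin hFv
    rw [ENNReal.ofReal_sum_of_nonneg fun m _ => mul_nonneg (hf m).le (hv0 m)]
    refine (tendsto_finsetSum Finset.univ fun m _ => tendsto_total_ruleSampler hf hξ h0 hF m
      (fun n => hFfin n m) (hv0 m) (hFv m)).congr fun N => ?_
    rw [← sum_total mode ξ π hF]
    simp only [div_eq_mul_inv, Finset.sum_mul]
    rfl
  have hbd : mean μT + mean μC + mean μC ≠ ⊤ := by simp [hτ, hκ]
  have hWlim : Tendsto (fun N : ℕ => (∑ j ∈ Finset.range N,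
      ∫⁻ ω, ENNReal.ofReal (waiting mode ξ π ω j) ∂(law μT μC)) / N) atTop
      (𝓝 (ENNReal.ofReal (∑ m', f m' * w m'))) := by
    refine tendsto_ennreal_average_of_shift (by simp [waiting_zero]) ?_
    simp only [ofReal_waiting_succ]
    exact hsumtot hw0 (measurable_waitingFeature mode)
      (fun n m => ne_top_of_le_ne_top hκ (value_waiting_le hT hC _)) hw
  have hYlim : Tendsto (fun N : ℕ => (∑ j ∈ Finset.range N, ∫⁻ ω, Y j ω ∂(law μT μC)) / N) atTop
      (𝓝 (ENNReal.ofReal (∑ m', f m' * a m'))) := by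
    have h1 := hsumtot ha0 (measurable_delayFeature ⊤) hfin ha
    simp only [delayFeature, min_top_right] at h1
    cases mode with
    | nonpreemptive => exact h1
    | preemptive => exact tendsto_ennreal_average_of_shift (hYfin 0) h1
  set A : ℝ := (mean μT).toReal + ∑ m', f m' * (w m' + a m') with hA
  have hA0 : 0 ≤ A := add_nonneg ENNReal.toReal_nonneg
    (Finset.sum_nonneg fun m _ => mul_nonneg (hf m).le (add_nonneg (hw0 m) (ha0 m)))
  have hfull : Tendsto (fun N : ℕ => (∑ j ∈ Finset.range N, ∫⁻ ω, (ENNReal.ofReal (ω.T j) +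
      ENNReal.ofReal (waiting mode ξ π ω j) + Y j ω) ∂(law μT μC)) / N) atTop
      (𝓝 (ENNReal.ofReal A)) := by
    have hlim := ((tendsto_const_nhds (x := mean μT)).add hWlim).add hYlim
    have hval : mean μT + ENNReal.ofReal (∑ m', f m' * w m') +
        ENNReal.ofReal (∑ m', f m' * a m') = ENNReal.ofReal A := by
      have e1 : 0 ≤ ∑ m', f m' * w m' :=
        Finset.sum_nonneg fun m _ => mul_nonneg (hf m).le (hw0 m)
      have e2 : 0 ≤ ∑ m', f m' * a m' :=
        Finset.sum_nonneg fun m _ => mul_nonneg (hf m).le (ha0 m)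
      conv_lhs => rw [← ENNReal.ofReal_toReal hτ]
      rw [← ENNReal.ofReal_add ENNReal.toReal_nonneg e1,
        ← ENNReal.ofReal_add (add_nonneg ENNReal.toReal_nonneg e1) e2, hA]
      simp only [mul_add, Finset.sum_add_distrib]
      rw [add_assoc]
    rw [hval] at hlim
    refine hlim.congr' ?_
    filter_upwards [eventually_gt_atTop 0] with N hN
    have hN0 : (N : ENNReal) ≠ 0 := by exact_mod_cast hN.ne'
    have : ∀ j, ∫⁻ ω, (ENNReal.ofReal (ω.T j) +
        ENNReal.ofReal (waiting mode ξ π ω j) + Y j ω) ∂(law μT μC) =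
        ∫⁻ ω, ENNReal.ofReal (ω.T j) ∂(law μT μC) +
        ∫⁻ ω, ENNReal.ofReal (waiting mode ξ π ω j) ∂(law μT μC) +
        ∫⁻ ω, Y j ω ∂(law μT μC) := fun j => by
      rw [lintegral_add_right _ (hY j), lintegral_add_right _ (hW j)]
    have hTsum : (∑ j ∈ Finset.range N, ∫⁻ ω, ENNReal.ofReal (ω.T j) ∂(law μT μC)) / N =
        mean μT := by
      simp only [lintegral_T μT μC ENNReal.measurable_ofReal]
      rw [Finset.sum_const, Finset.card_range, nsmul_eq_mul, mul_comm]
      exact ENNReal.mul_div_cancel_right hN0 (ENNReal.natCast_ne_top N)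
    simp only [this, Finset.sum_add_distrib, ENNReal.add_div, hTsum]
  have hZ : ∀ᵐ ω ∂(law μT μC), ∀ j, ENNReal.ofReal (interGeneration mode ξ π ω j) =
      ENNReal.ofReal (ω.T j) + ENNReal.ofReal (waiting mode ξ π ω j) + Y j ω := by
    filter_upwards [ae_T_pos μT μC hT] with ω h1 j
    rw [interGeneration, ENNReal.ofReal_add (add_nonneg (h1 j).le (waiting_nonneg _ _ _ _ _))
      (delay_nonneg _ _ _ _ _), ENNReal.ofReal_add (h1 j).le (waiting_nonneg _ _ _ _ _)]
  have hsplit : ∀ N : ℕ, lastTime mode μT μC ξ π m N +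
        ∫⁻ ω, ∑ j ∈ Finset.Ico (lastDelivered mode ξ π ω m N) N,
          (ENNReal.ofReal (ω.T j) + ENNReal.ofReal (waiting mode ξ π ω j) + Y j ω)
            ∂(law μT μC) =
      ∑ j ∈ Finset.range N, ∫⁻ ω, (ENNReal.ofReal (ω.T j) +
        ENNReal.ofReal (waiting mode ξ π ω j) + Y j ω) ∂(law μT μC) := by
    intro N
    have hm : ∀ j ∈ Finset.range N, Measurable fun ω : Outcome =>
        ENNReal.ofReal (ω.T j) + ENNReal.ofReal (waiting mode ξ π ω j) + Y j ω :=
      fun j _ => ((hTm j).add (hW j)).add (hY j)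
    rw [← lintegral_finsetSum _ hm, lastTime,
      ← lintegral_add_left (measurable_sum_range_lastDelivered mode ξ π (fun j =>
      (measurable_interGeneration mode ξ π j).ennreal_ofReal) m N)]
    refine lintegral_congr_ae ?_
    filter_upwards [hZ] with ω h1
    simp only [h1]
    exact Finset.sum_range_add_sum_Ico _ (lastDelivered_le mode ξ π ω m N)
  -- Squeeze: the part after the last delivery is nonnegative, and negligible by `htail`.
  have hlast : Tendsto (fun N : ℕ => lastTime mode μT μC ξ π m N / N) atTop
      (𝓝 (ENNReal.ofReal A)) := by
    have hlow := ENNReal.Tendsto.sub hfull htail (Or.inl ENNReal.ofReal_ne_top)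
    rw [tsub_zero] at hlow
    refine tendsto_of_tendsto_of_tendsto_of_le_of_le hlow hfull (fun N => ?_) fun N => ?_
    · simp only
      rw [tsub_le_iff_right, ← ENNReal.add_div, hsplit]
    · simp only
      rw [← hsplit]
      exact ENNReal.div_le_div_right le_self_add _
  have hD := tendsto_total_ruleSampler hf hξ h0 (measurable_deliveredFeature mode) m
    (fun n => ne_top_of_le_ne_top ENNReal.one_ne_top (value_delivered_le _)) (hd0 m).le (hd m)
  have hG := tendsto_total_ruleSampler hf hξ h0 (measurable_systemFeature mode) m
    (fun n => ne_top_of_le_ne_top hbd (value_system_le hT hC _)) (hg0 m) (hg m)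
  have hfd : 0 < f m * d m := mul_pos (hf m) (hd0 m)
  have hquot := ENNReal.Tendsto.div (hG.add hlast)
    (Or.inr (ENNReal.ofReal_pos.2 hfd).ne') hD (Or.inl ENNReal.ofReal_ne_top)
  rw [← ENNReal.ofReal_add (mul_nonneg (hf m).le (hg0 m)) hA0, ← ENNReal.ofReal_div_of_pos hfd,
    add_comm (f m * g m)] at hquot
  refine hquot.congr' ?_
  filter_upwards [eventually_gt_atTop 0] with N hN
  have hN0 : (N : ENNReal) ≠ 0 := by exact_mod_cast hN.ne'
  rw [lintegral_peakSum mode ξ π hT hC, lintegral_deliveredCount, ← ENNReal.add_div,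
    div_eq_mul_inv (_ + _) (N : ENNReal), div_eq_mul_inv (total _ _ _ _ _ _ _ _) (N : ENNReal)]
  exact ENNReal.mul_div_mul_right _ _ (ENNReal.inv_ne_zero.2 (ENNReal.natCast_ne_top N))
    (ENNReal.inv_ne_top.2 hN0)

end Evaluation


/-! ### Limiting averages of a given policy along an ultrafilter. -/

section Limits

variable {M : ℕ} {mode : Mode} {μT μC : Measure ℝ}
  [IsProbabilityMeasure μT] [IsProbabilityMeasure μC] {ξ : Scheduler M} {π : Sampler M}

theorem lintegral_sourceFeature_le (F : ℝ × ℝ × ℝ → ℝ → ENNReal) (m : Fin M) (i : ℕ) :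
    ∫⁻ ω, sourceFeature mode ξ π F m i ω ∂(law μT μC) ≤
      ∫⁻ ω, F (fresh mode i ω) (delay mode ξ π ω (stepOf mode i)) ∂(law μT μC) := by
  refine lintegral_mono fun ω => ?_
  simp only [sourceFeature]
  split_ifs
  · exact le_rfl
  · exact zero_le

theorem lintegral_sourceFeature_system_le (hT : ∀ᵐ t ∂μT, 0 < t) (hC : ∀ᵐ c ∂μC, 0 < c)
    (m : Fin M) (i : ℕ) :
    ∫⁻ ω, sourceFeature mode ξ π (systemFeature mode) m i ω ∂(law μT μC) ≤
      mean μT + mean μC + mean μC := by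
  have hTm : Measurable fun ω : Outcome => ENNReal.ofReal (ω.T (i + 1)) :=
    (measurable_T _).ennreal_ofReal
  have hCm : Measurable fun ω : Outcome => ENNReal.ofReal (ω.C (i + 1)) :=
    (measurable_C _).ennreal_ofReal
  calc ∫⁻ ω, sourceFeature mode ξ π (systemFeature mode) m i ω ∂(law μT μC)
      ≤ ∫⁻ ω, (ENNReal.ofReal (ω.T (i + 1)) + ENNReal.ofReal (waiting mode ξ π ω (i + 1)) +
          ENNReal.ofReal (ω.C (i + 1))) ∂(law μT μC) := by
        refine (lintegral_sourceFeature_le _ m i).trans (lintegral_mono fun ω => ?_)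
        simp only [systemFeature, freshT_fresh, freshC_fresh, ofReal_waiting_succ]
        exact mul_le_of_le_one_left zero_le (deliveredFeature_le_one _ _ _)
    _ ≤ mean μT + mean μC + mean μC := by
        rw [lintegral_add_right _ hCm, lintegral_add_left hTm,
          lintegral_T μT μC ENNReal.measurable_ofReal,
          lintegral_C μT μC ENNReal.measurable_ofReal]
        gcongr
        · exact le_rfl
        · exact lintegral_waiting_le mode ξ π hT hC (i + 1)
        · exact le_rfl

theorem total_div_le {F : ℝ × ℝ × ℝ → ℝ → ENNReal} {m : Fin M} {B : ENNReal}
    (hB : ∀ i, ∫⁻ ω, sourceFeature mode ξ π F m i ω ∂(law μT μC) ≤ B) (N : ℕ) :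
    total mode ξ π μT μC F m N / N ≤ B := by
  refine ENNReal.div_le_of_le_mul ?_
  calc total mode ξ π μT μC F m N ≤ ∑ i ∈ Finset.range N, B := Finset.sum_le_sum fun i _ => hB i
    _ = B * N := by rw [Finset.sum_const, Finset.card_range, nsmul_eq_mul, mul_comm]

/-- The averages may oscillate, but [0, ∞] is compact and the uniform bound keeps the limit finite.
One ultrafilter serves all sources and features at once. -/
theorem exists_tendsto_hyperfilter {F : ℝ × ℝ × ℝ → ℝ → ENNReal} {m : Fin M} {B : ENNReal}
    (hBt : B ≠ ⊤) (hB : ∀ i, ∫⁻ ω, sourceFeature mode ξ π F m i ω ∂(law μT μC) ≤ B) :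
    ∃ v : ℝ, 0 ≤ v ∧ Tendsto (fun N : ℕ => total mode ξ π μT μC F m N / N) (hyperfilter ℕ)
      (𝓝 (ENNReal.ofReal v)) := by
  obtain ⟨x, -, hx⟩ := isCompact_univ.ultrafilter_le_nhds
    ((hyperfilter ℕ).map fun N : ℕ => total mode ξ π μT μC F m N / N) (by simp)
  have hx' : Tendsto (fun N : ℕ => total mode ξ π μT μC F m N / N) (hyperfilter ℕ) (𝓝 x) := hx
  have hxB : x ≤ B := le_of_tendsto' hx' (total_div_le hB)
  refine ⟨x.toReal, ENNReal.toReal_nonneg, ?_⟩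
  rwa [ENNReal.ofReal_toReal (ne_top_of_le_ne_top hBt hxB)]

theorem mean_ne_zero {μ : Measure ℝ} [IsProbabilityMeasure μ] (h : ∀ᵐ t ∂μ, 0 < t) :
    mean μ ≠ 0 := by
  intro h0
  rw [mean, lintegral_eq_zero_iff ENNReal.measurable_ofReal] at h0
  have : ∀ᵐ t ∂μ, False := by
    filter_upwards [h, h0] with t h1 h2
    exact (ENNReal.ofReal_pos.2 h1).ne' h2
  rw [eventually_false_iff_eq_bot, ae_eq_bot] at this
  exact IsProbabilityMeasure.ne_zero μ this

/-- If the expected number of deliveries is 0, there are almost surely no peaks, so the identity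
survives the degenerate quotient. -/
theorem lintegral_peakSum_eq_div_mul (m : Fin M) (N : ℕ) :
    (∫⁻ ω, peakSum mode ξ π ω m N ∂(law μT μC)) / N =
      (∫⁻ ω, peakSum mode ξ π ω m N ∂(law μT μC)) /
        (∫⁻ ω, (deliveredCount mode ξ π ω m N : ENNReal) ∂(law μT μC)) *
        (total mode ξ π μT μC (deliveredFeature mode) m N / N) := by
  classical
  rw [lintegral_deliveredCount]
  by_cases h0 : total mode ξ π μT μC (deliveredFeature mode) m N = 0
  · have hz : ∫⁻ ω, peakSum mode ξ π ω m N ∂(law μT μC) = 0 := by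
      have hm : Measurable fun ω => (deliveredCount mode ξ π ω m N : ENNReal) := by
        simp only [deliveredCount_eq]
        exact Finset.measurable_sum _ fun i _ =>
          measurable_sourceFeature mode ξ π (measurable_deliveredFeature mode) m i
      rw [← lintegral_deliveredCount, lintegral_eq_zero_iff hm] at h0
      rw [lintegral_eq_zero_iff (measurable_peakSum mode ξ π m N)]
      filter_upwards [h0] with ω hω
      have : deliveredCount mode ξ π ω m N = 0 := by simpa using hω
      rw [deliveredCount, Finset.card_eq_zero] at this
      simp [peakSum, this]
    simp [hz]
  · have ht : total mode ξ π μT μC (deliveredFeature mode) m N ≠ ⊤ := by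
      refine (ENNReal.sum_lt_top.2 fun i _ => lt_of_le_of_lt ?_ ENNReal.one_lt_top).ne
      refine (lintegral_sourceFeature_le _ m i).trans
        ((lintegral_mono fun ω => deliveredFeature_le_one _ _ _).trans (by simp))
    rw [← mul_div_assoc, ENNReal.div_mul_cancel h0 ht]

/-- The average peak age of a source is bounded from below by the limiting averages of the
features. -/
theorem limits_le (hT : ∀ᵐ t ∂μT, 0 < t) (hC : ∀ᵐ c ∂μC, 0 < c)
    (hτ : mean μT ≠ ⊤) (hκ : mean μC ≠ ⊤) (hNS : NoStarvation mode μT μC ξ π)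
    {m : Fin M} {A : ENNReal} (hAt : A ≠ ⊤) (hA : HasAveragePeakAge mode μT μC ξ π m A)
    {δ γ : ℝ} {w α : Fin M → ℝ} (hw0 : ∀ m, 0 ≤ w m) (hα0 : ∀ m, 0 ≤ α m) (hδ0 : 0 ≤ δ)
    (hγ0 : 0 ≤ γ)
    (L : ℕ)
    (hδ : Tendsto (fun N : ℕ => total mode ξ π μT μC (deliveredFeature mode) m N / N)
      (hyperfilter ℕ) (𝓝 (ENNReal.ofReal δ)))
    (hγ : Tendsto (fun N : ℕ => total mode ξ π μT μC (systemFeature mode) m N / N)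
      (hyperfilter ℕ) (𝓝 (ENNReal.ofReal γ)))
    (hw : ∀ m', Tendsto (fun N : ℕ => total mode ξ π μT μC (waitingFeature mode) m' N / N)
      (hyperfilter ℕ) (𝓝 (ENNReal.ofReal (w m'))))
    (hα : ∀ m', Tendsto (fun N : ℕ => total mode ξ π μT μC (delayFeature L) m' N / N)
      (hyperfilter ℕ) (𝓝 (ENNReal.ofReal (α m')))) :
    (mean μT).toReal + ∑ m', (w m' + α m') + γ ≤ A.toReal * δ := by
  have hle : (hyperfilter ℕ : Filter ℕ) ≤ atTop := by
    rw [← Nat.cofinite_eq_atTop]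
    exact hyperfilter_le_cofinite
  obtain ⟨e, he, hineq⟩ := exists_total_le_lastTime hT hC hτ hκ hNS L m
  have h1 := (((tendsto_const_nhds (x := mean μT)).add
    (tendsto_finsetSum Finset.univ fun m' _ => hw m')).add
    (tendsto_finsetSum Finset.univ fun m' _ => hα m')).add hγ
  -- Multiplying by the delivery rate avoids a division by δ, which is not yet known to be positive.
  have h2 := (ENNReal.Tendsto.mul (hA.mono_left hle) (Or.inr ENNReal.ofReal_ne_top) hδ
    (Or.inr hAt)).add (he.mono_left hle)
  rw [add_zero] at h2
  have h3 := le_of_tendsto_of_tendsto h1 h2 (by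
    filter_upwards [hle (eventually_gt_atTop 0)] with N hN
    rw [← lintegral_peakSum_eq_div_mul, lintegral_peakSum mode ξ π hT hC, ENNReal.add_div]
    refine (add_le_add (hineq N hN) le_rfl).trans_eq ?_
    ring)
  rw [← ENNReal.ofReal_sum_of_nonneg (fun m' _ => hw0 m'),
    ← ENNReal.ofReal_sum_of_nonneg (fun m' _ => hα0 m'), ← ENNReal.ofReal_toReal hτ,
    ← ENNReal.ofReal_toReal hAt, ← ENNReal.ofReal_mul ENNReal.toReal_nonneg,
    ← ENNReal.ofReal_add ENNReal.toReal_nonneg (Finset.sum_nonneg fun m' _ => hw0 m'),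
    ← ENNReal.ofReal_add (add_nonneg ENNReal.toReal_nonneg
      (Finset.sum_nonneg fun m' _ => hw0 m')) (Finset.sum_nonneg fun m' _ => hα0 m'),
    ← ENNReal.ofReal_add (add_nonneg (add_nonneg ENNReal.toReal_nonneg
      (Finset.sum_nonneg fun m' _ => hw0 m')) (Finset.sum_nonneg fun m' _ => hα0 m')) hγ0,
    ENNReal.ofReal_le_ofReal_iff (mul_nonneg ENNReal.toReal_nonneg hδ0)] at h3
  rw [Finset.sum_add_distrib, ← add_assoc]
  exact h3

open Classical in
/-- A rule with the average performance of the first `N` steps of a policy on source `m`. -/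
noncomputable def averageRule (mode : Mode) (ξ : Scheduler M) (π : Sampler M) (μT μC : Measure ℝ)
    [IsProbabilityMeasure μT] [IsProbabilityMeasure μC] (N : ℕ) (m : Fin M) : Rule :=
  if h : total mode ξ π μT μC (fun _ _ => 1) m N ≠ 0 then
    (exists_rule_value_eq mode ξ π μT μC m N h).choose
  else Rule.full 0 le_rfl

/-- The rule averages over the packets of m, the totals are divided by the number of all packets;
the ratio of the two normalizations tends to f m. -/
theorem tendsto_value_averageRule {f : Fin M → ℝ} (hf : ∀ m, 0 < f m)
    (hξ : HasSchedulingFrequency mode μT μC ξ f) {F : ℝ × ℝ × ℝ → ℝ → ENNReal}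
    (hF : Measurable fun p : (ℝ × ℝ × ℝ) × ℝ => F p.1 p.2) {m : Fin M} {v : ℝ}
    (hv : Tendsto (fun N : ℕ => total mode ξ π μT μC F m N / N) (hyperfilter ℕ)
      (𝓝 (ENNReal.ofReal v))) :
    Tendsto (fun N => value mode μT μC F (averageRule mode ξ π μT μC N m)) (hyperfilter ℕ)
      (𝓝 (ENNReal.ofReal (v / f m))) := by
  have hle : (hyperfilter ℕ : Filter ℕ) ≤ atTop := by
    rw [← Nat.cofinite_eq_atTop]
    exact hyperfilter_le_cofinite
  have h1 := (tendsto_total_one hξ π m).mono_left hle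
  have hf0 : ENNReal.ofReal (f m) ≠ 0 := (ENNReal.ofReal_pos.2 (hf m)).ne'
  have hdiv := ENNReal.Tendsto.div hv (Or.inr hf0) h1 (Or.inl ENNReal.ofReal_ne_top)
  rw [← ENNReal.ofReal_div_of_pos (hf m)] at hdiv
  refine hdiv.congr' ?_
  filter_upwards [hle (eventually_gt_atTop 0), h1.eventually_ne hf0] with N hN hne
  have hN0 : (N : ENNReal) ≠ 0 := by exact_mod_cast hN.ne'
  have ht : total mode ξ π μT μC (fun _ _ => 1) m N ≠ 0 := by
    intro h
    rw [h, ENNReal.zero_div] at hne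
    exact hne rfl
  rw [averageRule, dif_pos ht, (exists_rule_value_eq mode ξ π μT μC m N ht).choose_spec F hF,
    div_eq_mul_inv _ (N : ENNReal), div_eq_mul_inv _ (N : ENNReal),
    ENNReal.mul_div_mul_right _ _ (ENNReal.inv_ne_zero.2 (ENNReal.natCast_ne_top N))
    (ENNReal.inv_ne_top.2 hN0), div_eq_mul_inv, mul_comm]

end Limits


/-! ### Truncated rules and uniform integrability. -/

section TruncatedRules

theorem value_mono {mode : Mode} {μT μC : Measure ℝ}
    {F G : ℝ × ℝ × ℝ → ℝ → ENNReal} {ρ₁ ρ₂ : Rule}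
    (h : ∀ z u, F z (ρ₁.act u (observed mode z).1 (observed mode z).2) ≤
      G z (ρ₂.act u (observed mode z).1 (observed mode z).2)) :
    value mode μT μC F ρ₁ ≤ value mode μT μC G ρ₂ :=
  lintegral_mono fun p => h p.2 p.1

/-- The mean excess of the computation time over a level `K`. -/
noncomputable def excessMean (μC : Measure ℝ) (K : ENNReal) : ENNReal :=
  ∫⁻ c, (ENNReal.ofReal c - K) ∂μC

theorem tendsto_excessMean {μC : Measure ℝ} (hκ : mean μC ≠ ⊤) :
    Tendsto (fun K : ℕ => excessMean μC K) atTop (𝓝 0) := by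
  rw [ENNReal.tendsto_nhds_zero]
  intro ε hε
  obtain ⟨B, hB, h⟩ := exists_lintegral_tsub_le ENNReal.measurable_ofReal hκ hε.ne'
  obtain ⟨n, hn⟩ := ENNReal.exists_nat_gt hB
  filter_upwards [eventually_ge_atTop n] with K hK
  refine le_trans (lintegral_mono fun c => tsub_le_tsub_left ?_ _) h
  exact hn.le.trans (by exact_mod_cast hK)

theorem ofReal_trunc_act (K : ℕ) (ρ : Rule) (u : unitInterval) (t c : ℝ) :
    ENNReal.ofReal ((ρ.trunc K (Nat.cast_nonneg K)).act u t c) =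
      min (ENNReal.ofReal (ρ.act u t c)) (max (ENNReal.ofReal c) K) := by
  simp only [Rule.trunc, ENNReal.ofReal_min, ENNReal.ofReal_max, ENNReal.ofReal_natCast]

theorem value_delay_le_trunc {mode : Mode} {μT μC : Measure ℝ} (K : ℕ) (ρ : Rule) :
    value mode μT μC (delayFeature K) ρ ≤
      value mode μT μC (delayFeature ⊤) (ρ.trunc K (Nat.cast_nonneg K)) := by
  refine value_mono fun z u => ?_
  simp only [delayFeature, ofReal_trunc_act, min_top_right]
  exact min_le_min_left _ (le_max_right _ _)

variable {mode : Mode} {μT μC : Measure ℝ}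
  [IsProbabilityMeasure μT] [IsProbabilityMeasure μC]

theorem value_add_excess {F : ℝ × ℝ × ℝ → ℝ → ENNReal}
    (hF : Measurable fun p : (ℝ × ℝ × ℝ) × ℝ => F p.1 p.2) (K : ENNReal) (ρ : Rule) :
    value mode μT μC (fun z θ => F z θ + (ENNReal.ofReal (observed mode z).2 - K)) ρ =
      value mode μT μC F ρ + excessMean μC K := by
  have hm : Measurable fun z => ENNReal.ofReal (observed mode z).2 - K :=
    (measurable_snd.comp (measurable_observed mode)).ennreal_ofReal.sub measurable_const
  rw [value, lintegral_add_left (measurable_feature_act mode hF ρ), lintegral_prod_fresh hm,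
    lintegral_observed mode μT μC (h := fun c => ENNReal.ofReal c - K) (by fun_prop)]
  rfl

theorem min_max_le_add (x c K : ENNReal) : min x (max c K) ≤ min x K + (c - K) := by
  rcases le_total c K with h | h
  · simp [max_eq_right h]
  · rw [max_eq_left h]
    rcases le_total x K with h' | h'
    · rw [min_eq_left h']
      exact (min_le_left _ _).trans le_self_add
    · rw [min_eq_right h', add_tsub_cancel_of_le h]
      exact min_le_right _ _

/-- The truncation level exceeds K only by the excess of the computation time, whose mean vanishes
as K grows. With `value_delay_le_trunc`, truncating the rule amounts asymptotically to capping the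
feature. -/
theorem value_delay_trunc_le (K : ℕ) (ρ : Rule) :
    value mode μT μC (delayFeature ⊤) (ρ.trunc K (Nat.cast_nonneg K)) ≤
      value mode μT μC (delayFeature K) ρ + excessMean μC K := by
  rw [← value_add_excess (measurable_delayFeature K)]
  refine value_mono fun z u => ?_
  simp only [delayFeature, ofReal_trunc_act, min_top_right]
  exact min_max_le_add _ _ _

theorem value_delay_le (L : ENNReal) (ρ : Rule) : value mode μT μC (delayFeature L) ρ ≤ L :=
  (lintegral_mono fun _ => min_le_right _ _).trans (by simp)

/-- The source of uniform integrability: above L, a truncated delay carries only what the capped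
delay gains between L and K, up to a vanishing excess. -/
theorem value_excess_trunc_le {L K : ℕ} (hLK : L ≤ K) (ρ : Rule) :
    value mode μT μC (fun _ θ => ENNReal.ofReal θ - L) (ρ.trunc K (Nat.cast_nonneg K)) ≤
      value mode μT μC (delayFeature K) ρ - value mode μT μC (delayFeature L) ρ +
        excessMean μC K := by
  have hsub : value mode μT μC (fun z θ => delayFeature K z θ - delayFeature L z θ) ρ =
      value mode μT μC (delayFeature K) ρ - value mode μT μC (delayFeature L) ρ :=
    lintegral_sub (measurable_feature_act mode (measurable_delayFeature L) ρ)
      (ne_top_of_le_ne_top (ENNReal.natCast_ne_top L) (value_delay_le _ _))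
      (ae_of_all _ fun p => min_le_min_left _ (by exact_mod_cast hLK))
  rw [← hsub, ← value_add_excess ((measurable_delayFeature K).sub (measurable_delayFeature L))]
  refine value_mono fun z u => ?_
  simp only [delayFeature, ofReal_trunc_act]
  rw [tsub_le_iff_right]
  refine (min_max_le_add _ _ _).trans ?_
  set x := ENNReal.ofReal (ρ.act u (observed mode z).1 (observed mode z).2)
  calc min x K + _ ≤ (min x K - min x L + min x L) + _ := by gcongr; exact le_tsub_add
    _ ≤ (min x K - min x L + L) + _ := by gcongr; exact min_le_right _ _
    _ = _ := by ring

end TruncatedRules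

theorem tendsto_ofReal_of_abs_lt {x : ℕ → ENNReal} (hx : ∀ K, x K ≠ ⊤) {v : ℕ → ℝ} {l : ℝ}
    (hv : Tendsto v atTop (𝓝 l)) (k : ℕ)
    (h : ∀ K, k ≤ K → |(x K).toReal - v K| < 1 / ((K : ℝ) + 1)) :
    Tendsto x atTop (𝓝 (ENNReal.ofReal l)) := by
  have h0 : Tendsto (fun K => (x K).toReal - v K) atTop (𝓝 0) := by
    refine squeeze_zero_norm' ?_ (tendsto_one_div_add_atTop_nhds_zero_nat (𝕜 := ℝ))
    filter_upwards [eventually_ge_atTop k] with K hK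
    exact (h K hK).le
  have h1 := h0.add hv
  simp only [sub_add_cancel, zero_add] at h1
  refine (ENNReal.tendsto_ofReal h1).congr fun K => ENNReal.ofReal_toReal (hx K)

/-! ### Rules extracted from a policy with finite peak ages. -/

section LimitRules

variable {M : ℕ} {mode : Mode} {μT μC : Measure ℝ}
  [IsProbabilityMeasure μT] [IsProbabilityMeasure μC] {ξ : Scheduler M} {π : Sampler M}

/-- Given a policy with finite average peak ages, there is a convergent, uniformly integrable
sequence of rules whose limiting performance is at least as good. -/
theorem exists_limit_rules (hT : ∀ᵐ t ∂μT, 0 < t) (hC : ∀ᵐ c ∂μC, 0 < c)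
    (hτ : mean μT ≠ ⊤) (hκ : mean μC ≠ ⊤) {f : Fin M → ℝ} (hf : ∀ m, 0 < f m)
    (hξ : HasSchedulingFrequency mode μT μC ξ f) (hNS : NoStarvation mode μT μC ξ π)
    {A : Fin M → ENNReal} (hAt : ∀ m, A m ≠ ⊤)
    (hA : ∀ m, HasAveragePeakAge mode μT μC ξ π m (A m)) :
    ∃ (d g w a : Fin M → ℝ) (ρ : ℕ → Fin M → Rule), (∀ m, 0 < d m) ∧ (∀ m, 0 ≤ g m) ∧
      (∀ m, 0 ≤ w m) ∧ (∀ m, 0 ≤ a m) ∧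
      (∀ m, Tendsto (fun n => value mode μT μC (deliveredFeature mode) (ρ n m)) atTop
        (𝓝 (ENNReal.ofReal (d m)))) ∧
      (∀ m, Tendsto (fun n => value mode μT μC (systemFeature mode) (ρ n m)) atTop
        (𝓝 (ENNReal.ofReal (g m)))) ∧
      (∀ m, Tendsto (fun n => value mode μT μC (waitingFeature mode) (ρ n m)) atTop
        (𝓝 (ENNReal.ofReal (w m)))) ∧
      (∀ m, Tendsto (fun n => value mode μT μC (delayFeature ⊤) (ρ n m)) atTop
        (𝓝 (ENNReal.ofReal (a m)))) ∧
      (∀ n m, value mode μT μC (delayFeature ⊤) (ρ n m) ≠ ⊤) ∧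
      (∀ ε : ENNReal, ε ≠ 0 → ∃ B : ENNReal, B ≠ ⊤ ∧ ∀ᶠ n in atTop, ∀ m,
        value mode μT μC (fun _ θ => ENNReal.ofReal θ - B) (ρ n m) ≤ ε) ∧
      ∀ m, (mean μT).toReal + ∑ m', f m' * (w m' + a m') + f m * g m ≤
        (A m).toReal * (f m * d m) := by
  have hbd : mean μT + mean μC + mean μC ≠ ⊤ := by simp [hτ, hκ]
  choose δ hδ0 hδ using fun m : Fin M => exists_tendsto_hyperfilter (mode := mode) (ξ := ξ)
    (π := π) (μT := μT) (μC := μC) (F := deliveredFeature mode) (m := m) ENNReal.one_ne_top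
    (fun i => (lintegral_sourceFeature_le _ m i).trans
      ((lintegral_mono fun ω => deliveredFeature_le_one _ _ _).trans (by simp)))
  choose γ hγ0 hγ using fun m : Fin M => exists_tendsto_hyperfilter hbd
    (lintegral_sourceFeature_system_le (mode := mode) (ξ := ξ) (π := π) hT hC m)
  choose ν hν0 hν using fun m : Fin M => exists_tendsto_hyperfilter (mode := mode) (ξ := ξ)
    (π := π) (μT := μT) (F := waitingFeature mode) (m := m) hκ
    (fun i => (lintegral_sourceFeature_le _ m i).trans (by
      simp only [← ofReal_waiting_succ]
      exact lintegral_waiting_le mode ξ π hT hC (i + 1)))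
  choose α hα0 hα using fun (L : ℕ) (m : Fin M) => exists_tendsto_hyperfilter (mode := mode)
    (ξ := ξ) (π := π) (μT := μT) (μC := μC) (F := delayFeature L) (m := m)
    (ENNReal.natCast_ne_top L) (fun i => (lintegral_sourceFeature_le _ m i).trans
      ((lintegral_mono fun ω => min_le_right _ _).trans (by simp)))
  have hkey : ∀ m L, (mean μT).toReal + ∑ m', (ν m' + α L m') + γ m ≤ (A m).toReal * δ m :=
    fun m L => limits_le hT hC hτ hκ hNS (hAt m) (hA m) hν0 (hα0 L) (hδ0 m) (hγ0 m) L (hδ m)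
      (hγ m) hν (hα L)
  have hτ0 : 0 < (mean μT).toReal := ENNReal.toReal_pos (mean_ne_zero hT) hτ
  have hsum0 : ∀ L, 0 ≤ ∑ m', (ν m' + α L m') := fun L =>
    Finset.sum_nonneg fun m _ => add_nonneg (hν0 m) (hα0 L m)
  -- A zero delivery rate would make the right side of `hkey` vanish, whereas the left side is at
  -- least the positive mean transmission time.
  have hδpos : ∀ m, 0 < δ m := by
    intro m
    refine lt_of_le_of_ne (hδ0 m) fun h => ?_
    have := hkey m 0
    rw [← h, mul_zero] at this
    linarith [hsum0 0, hγ0 m]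
  have hαmono : ∀ m, Monotone fun L => α L m := by
    intro m L L' hLL
    refine (ENNReal.ofReal_le_ofReal_iff (hα0 L' m)).1
      (le_of_tendsto_of_tendsto' (hα L m) (hα L' m) fun N => ?_)
    refine ENNReal.div_le_div_right (Finset.sum_le_sum fun i _ => lintegral_mono fun ω => ?_) _
    simp only [sourceFeature, delayFeature]
    split_ifs
    · exact min_le_min_left _ (by exact_mod_cast hLL)
    · exact le_rfl
  have hαbdd : ∀ m, BddAbove (Set.range fun L => α L m) := by
    intro m
    refine ⟨(A m).toReal * δ m, ?_⟩
    rintro _ ⟨L, rfl⟩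
    have h1 : ν m + α L m ≤ ∑ m', (ν m' + α L m') :=
      Finset.single_le_sum (f := fun m' => ν m' + α L m')
        (fun m' _ => add_nonneg (hν0 m') (hα0 L m')) (Finset.mem_univ m)
    simp only
    linarith [hkey m L, hν0 m, hγ0 m]
  -- Delay mass that escapes to infinity is lost here; this is why the rules may do strictly better
  -- than π.
  choose a ha using fun m => (⟨_, tendsto_atTop_ciSup (hαmono m) (hαbdd m)⟩ :
    ∃ a, Tendsto (fun L => α L m) atTop (𝓝 a))
  have ha0 : ∀ m, 0 ≤ a m := fun m => ge_of_tendsto' (ha m) fun L => hα0 L m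
  have haα : ∀ m L, α L m ≤ a m := fun m L => (hαmono m).ge_of_tendsto (ha m) L
  set r : ℕ → Fin M → Rule := averageRule mode ξ π μT μC with hr
  have hclose : ∀ {F : ℝ × ℝ × ℝ → ℝ → ENNReal} {v : ℝ} {m : Fin M}, 0 ≤ v →
      (Measurable fun p : (ℝ × ℝ × ℝ) × ℝ => F p.1 p.2) →
      Tendsto (fun N : ℕ => total mode ξ π μT μC F m N / N) (hyperfilter ℕ)
        (𝓝 (ENNReal.ofReal v)) → ∀ K : ℕ, ∀ᶠ N in (hyperfilter ℕ : Filter ℕ),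
        |(value mode μT μC F (r N m)).toReal - v / f m| < 1 / ((K : ℝ) + 1) := by
    intro F v m hv0 hF hv K
    have h1 := (ENNReal.tendsto_toReal ENNReal.ofReal_ne_top).comp
      (tendsto_value_averageRule hf hξ hF hv)
    rw [ENNReal.toReal_ofReal (div_nonneg hv0 (hf m).le)] at h1
    exact (Metric.tendsto_nhds.1 h1 (1 / ((K : ℝ) + 1)) (by positivity)).mono fun N hN => by
      rw [Real.dist_eq] at hN
      exact hN
  -- Diagonal choice: one N for all sources, all features and all caps up to K, as these are
  -- finitely many conditions along the ultrafilter.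
  have hex : ∀ K : ℕ, ∃ N, ∀ m,
      |(value mode μT μC (deliveredFeature mode) (r N m)).toReal - δ m / f m| <
        1 / ((K : ℝ) + 1) ∧
      |(value mode μT μC (systemFeature mode) (r N m)).toReal - γ m / f m| < 1 / ((K : ℝ) + 1) ∧
      |(value mode μT μC (waitingFeature mode) (r N m)).toReal - ν m / f m| < 1 / ((K : ℝ) + 1) ∧
      ∀ L ∈ Finset.range (K + 1),
        |(value mode μT μC (delayFeature L) (r N m)).toReal - α L m / f m| <
          1 / ((K : ℝ) + 1) := by
    intro K
    refine (eventually_all.2 fun m => ?_ : ∀ᶠ N in (hyperfilter ℕ : Filter ℕ), ∀ m, _).exists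
    exact (hclose (hδ0 m) (measurable_deliveredFeature mode) (hδ m) K).and
      ((hclose (hγ0 m) (measurable_systemFeature mode) (hγ m) K).and
        ((hclose (hν0 m) (measurable_waitingFeature mode) (hν m) K).and
          ((Finset.eventually_all _).2 fun L _ =>
            hclose (hα0 L m) (measurable_delayFeature L) (hα L m) K)))
  choose N hNd hNg hNw hNa using fun K => by simpa only [forall_and] using hex K
  have hcapfin : ∀ (L : ℕ) (ρ : Rule), value mode μT μC (delayFeature L) ρ ≠ ⊤ := fun L ρ =>
    ne_top_of_le_ne_top (ENNReal.natCast_ne_top L) (value_delay_le _ _)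
  have hcapK : ∀ m, Tendsto (fun K : ℕ => value mode μT μC (delayFeature K) (r (N K) m)) atTop
      (𝓝 (ENNReal.ofReal (a m / f m))) := fun m =>
    tendsto_ofReal_of_abs_lt (fun K => hcapfin K _) ((ha m).div_const (f m)) 0
      fun K _ => hNa K m K (Finset.self_mem_range_succ K)
  have hcapL : ∀ m (L : ℕ), Tendsto (fun K : ℕ => value mode μT μC (delayFeature L) (r (N K) m))
      atTop (𝓝 (ENNReal.ofReal (α L m / f m))) := fun m L =>
    tendsto_ofReal_of_abs_lt (fun K => hcapfin L _) tendsto_const_nhds L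
      fun K hK => hNa K m L (Finset.mem_range.2 (by omega))
  have hη := tendsto_excessMean hκ
  have hηfin : ∀ K : ℕ, excessMean μC K ≠ ⊤ := fun K =>
    ne_top_of_le_ne_top hκ (lintegral_mono fun c => tsub_le_self)
  refine ⟨fun m => δ m / f m, fun m => γ m / f m, fun m => ν m / f m, fun m => a m / f m,
    fun K m => (r (N K) m).trunc K (Nat.cast_nonneg K), fun m => div_pos (hδpos m) (hf m),
    fun m => div_nonneg (hγ0 m) (hf m).le, fun m => div_nonneg (hν0 m) (hf m).le,
    fun m => div_nonneg (ha0 m) (hf m).le, fun m => ?_, fun m => ?_, fun m => ?_, fun m => ?_,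
    fun K m => ?_, fun ε hε => ?_, fun m => ?_⟩
  · simp only [value_trunc mode μT μC hT hC (truncInvariant_delivered mode)]
    exact tendsto_ofReal_of_abs_lt
      (fun K => ne_top_of_le_ne_top ENNReal.one_ne_top (value_delivered_le _))
      tendsto_const_nhds 0 fun K _ => hNd K m
  · simp only [value_trunc mode μT μC hT hC (truncInvariant_system mode)]
    exact tendsto_ofReal_of_abs_lt (fun K => ne_top_of_le_ne_top hbd (value_system_le hT hC _))
      tendsto_const_nhds 0 fun K _ => hNg K m
  · simp only [value_trunc mode μT μC hT hC (truncInvariant_waiting mode)]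
    exact tendsto_ofReal_of_abs_lt (fun K => ne_top_of_le_ne_top hκ (value_waiting_le hT hC _))
      tendsto_const_nhds 0 fun K _ => hNw K m
  · have hup := (hcapK m).add hη
    rw [add_zero] at hup
    exact tendsto_of_tendsto_of_tendsto_of_le_of_le (hcapK m) hup
      (fun K => value_delay_le_trunc K _) (fun K => value_delay_trunc_le K _)
  · exact ne_top_of_le_ne_top (ENNReal.add_ne_top.2 ⟨hcapfin K _, hηfin K⟩)
      (value_delay_trunc_le K _)
  · have hsmall : ∀ᶠ L : ℕ in atTop, ∀ m,
        ENNReal.ofReal (a m / f m) - ENNReal.ofReal (α L m / f m) < ε := by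
      refine eventually_all.2 fun m => ?_
      have h1 := ENNReal.Tendsto.sub (tendsto_const_nhds (x := ENNReal.ofReal (a m / f m)))
        (ENNReal.tendsto_ofReal ((ha m).div_const (f m))) (Or.inl ENNReal.ofReal_ne_top)
      rw [tsub_self] at h1
      exact h1.eventually_lt_const (pos_iff_ne_zero.2 hε)
    obtain ⟨L, hL⟩ := hsmall.exists
    refine ⟨L, ENNReal.natCast_ne_top L, eventually_all.2 fun m => ?_⟩
    have h2 := (ENNReal.Tendsto.sub (hcapK m) (hcapL m L) (Or.inl ENNReal.ofReal_ne_top)).add hη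
    rw [add_zero] at h2
    filter_upwards [h2.eventually_lt_const (hL m), eventually_ge_atTop L] with K h3 hK
    exact (value_excess_trunc_le hK _).trans h3.le
  · have hlim : Tendsto (fun L => (mean μT).toReal + ∑ m', (ν m' + α L m') + γ m) atTop
        (𝓝 ((mean μT).toReal + ∑ m', (ν m' + a m') + γ m)) :=
      ((tendsto_finsetSum _ fun m' _ => (ha m').const_add _).const_add _).add_const _
    have h1 := le_of_tendsto' hlim fun L => hkey m L
    have h2 : ∀ m' (x : ℝ), f m' * (x / f m') = x := fun m' x => mul_div_cancel₀ x (hf m').ne'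
    simp only [mul_add, h2]
    simpa only using h1

end LimitRules


/-! ### The rule that waits for the end of the computation. -/

section FullRule

variable {mode : Mode} {μT μC : Measure ℝ}
  [IsProbabilityMeasure μT] [IsProbabilityMeasure μC]

theorem deliveredFeature_full {z : ℝ × ℝ × ℝ} (hz : FreshPos z) {y : ℝ} (hy : 0 ≤ y) :
    deliveredFeature mode z (max (observed mode z).2 0 + y) = 1 := by
  cases mode with
  | nonpreemptive => rfl
  | preemptive =>
    have h1 := le_max_left z.2.1 0
    have h2 := hz.2.2
    exact if_pos (show z.2.1 ≤ max z.2.1 0 + y + z.2.2 by linarith)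

theorem waitingFeature_full {z : ℝ × ℝ × ℝ} (hz : FreshPos z) {y : ℝ} (hy : 0 ≤ y) :
    waitingFeature mode z (max (observed mode z).2 0 + y) = 0 := by
  cases mode with
  | nonpreemptive =>
    have h1 := le_max_left z.1 0
    have h2 := hz.2.1
    simp only [waitingFeature, observed]
    rw [max_eq_left (by linarith), ENNReal.ofReal_zero]
  | preemptive => rfl

theorem value_delivered_full (hT : ∀ᵐ t ∂μT, 0 < t) (hC : ∀ᵐ c ∂μC, 0 < c) {y : ℝ}
    (hy : 0 ≤ y) : value mode μT μC (deliveredFeature mode) (Rule.full y hy) = 1 := by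
  have : value mode μT μC (deliveredFeature mode) (Rule.full y hy) =
      value mode μT μC (fun _ _ => 1) (Rule.full y hy) := by
    refine lintegral_congr_ae ?_
    filter_upwards [ae_freshPos_prod mode μT μC hT hC] with p hp
    exact deliveredFeature_full hp hy
  rw [this]
  simp [value]

theorem value_waiting_full (hT : ∀ᵐ t ∂μT, 0 < t) (hC : ∀ᵐ c ∂μC, 0 < c) {y : ℝ}
    (hy : 0 ≤ y) : value mode μT μC (waitingFeature mode) (Rule.full y hy) = 0 := by
  have : value mode μT μC (waitingFeature mode) (Rule.full y hy) =
      value mode μT μC (fun _ _ => 0) (Rule.full y hy) := by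
    refine lintegral_congr_ae ?_
    filter_upwards [ae_freshPos_prod mode μT μC hT hC] with p hp
    exact waitingFeature_full hp hy
  rw [this]
  simp [value]

theorem value_system_full (hT : ∀ᵐ t ∂μT, 0 < t) (hC : ∀ᵐ c ∂μC, 0 < c) {y : ℝ}
    (hy : 0 ≤ y) :
    value mode μT μC (systemFeature mode) (Rule.full y hy) = mean μT + mean μC := by
  have hm1 : Measurable fun z => ENNReal.ofReal (freshT mode z) :=
    (measurable_freshT mode).ennreal_ofReal
  have hm : Measurable fun z => ENNReal.ofReal (freshT mode z) + ENNReal.ofReal (freshC mode z) :=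
    hm1.add (measurable_freshC mode).ennreal_ofReal
  have : value mode μT μC (systemFeature mode) (Rule.full y hy) =
      ∫⁻ z, (ENNReal.ofReal (freshT mode z) + ENNReal.ofReal (freshC mode z))
        ∂(freshLaw mode μT μC) := by
    rw [← lintegral_prod_fresh hm]
    refine lintegral_congr_ae ?_
    filter_upwards [ae_freshPos_prod mode μT μC hT hC] with p hp
    simp only [systemFeature, Rule.full, deliveredFeature_full hp hy, waitingFeature_full hp hy,
      one_mul, add_zero]
  rw [this, lintegral_add_left hm1, lintegral_freshT mode μT μC ENNReal.measurable_ofReal,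
    lintegral_freshC mode μT μC ENNReal.measurable_ofReal]
  rfl

theorem ofReal_full_act {y : ℝ} (hy : 0 ≤ y) (u : unitInterval) (t c : ℝ) :
    ENNReal.ofReal ((Rule.full y hy).act u t c) = ENNReal.ofReal c + ENNReal.ofReal y := by
  simp only [Rule.full]
  rw [ENNReal.ofReal_add (le_max_right _ _) hy, ENNReal.ofReal_max, ENNReal.ofReal_zero, max_zero]

theorem value_delay_full {y : ℝ} (hy : 0 ≤ y) :
    value mode μT μC (delayFeature ⊤) (Rule.full y hy) = mean μC + ENNReal.ofReal y := by
  have hm : Measurable fun z => ENNReal.ofReal (observed mode z).2 :=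
    (measurable_snd.comp (measurable_observed mode)).ennreal_ofReal
  simp only [value, delayFeature, min_top_right, ofReal_full_act]
  rw [lintegral_add_right _ measurable_const, lintegral_prod_fresh hm,
    lintegral_observed mode μT μC ENNReal.measurable_ofReal]
  simp [mean]

theorem value_excess_full_le {y : ℝ} (hy : 0 ≤ y) (B : ENNReal) :
    value mode μT μC (fun _ θ => ENNReal.ofReal θ - (B + ENNReal.ofReal y)) (Rule.full y hy) ≤
      excessMean μC B := by
  have hm : Measurable fun z => ENNReal.ofReal (observed mode z).2 - B :=
    (measurable_snd.comp (measurable_observed mode)).ennreal_ofReal.sub measurable_const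
  simp only [value, ofReal_full_act]
  rw [excessMean, ← lintegral_observed mode μT μC (h := fun c => ENNReal.ofReal c - B)
    (by fun_prop), ← lintegral_prod_fresh hm]
  refine lintegral_mono fun p => ?_
  rw [ENNReal.add_sub_add_eq_sub_right ENNReal.ofReal_ne_top]

theorem tendsto_value_mix {F : ℝ × ℝ × ℝ → ℝ → ENNReal}
    (hF : Measurable fun p : (ℝ × ℝ × ℝ) × ℝ => F p.1 p.2) {r₁ : Rule} {r₂ : ℕ → Rule} {v₁ v₂ : ℝ}
    (hv₁ : 0 ≤ v₁) (hv₂ : 0 ≤ v₂) (l : unitInterval)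
    (h₁ : value mode μT μC F r₁ = ENNReal.ofReal v₁)
    (h₂ : Tendsto (fun n => value mode μT μC F (r₂ n)) atTop (𝓝 (ENNReal.ofReal v₂))) :
    Tendsto (fun n => value mode μT μC F (Rule.mix l r₁ (r₂ n))) atTop
      (𝓝 (ENNReal.ofReal (l * v₁ + (1 - l) * v₂))) := by
  have hl : (0 : ℝ) ≤ 1 - l := sub_nonneg.2 l.2.2
  simp only [value_mix mode μT μC hF, h₁]
  rw [ENNReal.ofReal_add (mul_nonneg l.2.1 hv₁) (mul_nonneg hl hv₂), ENNReal.ofReal_mul l.2.1,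
    ENNReal.ofReal_mul hl]
  exact (ENNReal.Tendsto.const_mul h₂ (Or.inr ENNReal.ofReal_ne_top)).const_add _

end FullRule

/-- Any value of the objective above the one of a given policy is attained by using, with some
probability, a rule that always waits for the end of the computation. -/
theorem exists_mixture {ι : Type*} [Fintype ι] [Nonempty ι] {c f d g w a : ι → ℝ} {τ κ P : ℝ}
    (hc : ∀ m, 0 < c m) (hf : ∀ m, 0 < f m) (hd : ∀ m, 0 < d m)
    (hP : ∑ m, c m * ((τ + ∑ m', f m' * (w m' + a m') + f m * g m) / (f m * d m)) ≤ P) :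
    ∃ l ∈ Set.Icc (0 : ℝ) 1, ∃ y, 0 ≤ y ∧
      ∑ m, c m * ((τ + ∑ m', f m' * ((l * 0 + (1 - l) * w m') + (l * (κ + y) + (1 - l) * a m')) +
        f m * (l * (τ + κ) + (1 - l) * g m)) / (f m * (l * 1 + (1 - l) * d m))) = P := by
  set h : ℝ → ℝ → ℝ := fun l y =>
    ∑ m, c m * ((τ + ∑ m', f m' * ((l * 0 + (1 - l) * w m') + (l * (κ + y) + (1 - l) * a m')) +
        f m * (l * (τ + κ) + (1 - l) * g m)) / (f m * (l * 1 + (1 - l) * d m))) with hh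
  have h0 : ∀ y, h 0 y =
      ∑ m, c m * ((τ + ∑ m', f m' * (w m' + a m') + f m * g m) / (f m * d m)) := by
    intro y
    simp [hh]
  rcases hP.eq_or_lt with hP | hP
  · exact ⟨0, ⟨le_rfl, zero_le_one⟩, 0, le_rfl, (h0 0).trans hP⟩
  · have hcont : Tendsto (fun l => h l 0) (𝓝 0) (𝓝 (h 0 0)) := by
      refine tendsto_finsetSum _ fun m _ => Tendsto.const_mul _ (Tendsto.div ?_ ?_ ?_)
      · exact Continuous.tendsto' (by fun_prop) _ _ rfl
      · exact Continuous.tendsto' (by fun_prop) _ _ rfl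
      · simpa using ⟨(hf m).ne', (hd m).ne'⟩
    -- A small l > 0 keeps the objective below P and makes it depend on y.
    have hev : ∀ᶠ l : ℝ in 𝓝[>] 0, 0 < l ∧ l < 1 ∧ h l 0 < P := by
      refine (eventually_mem_nhdsWithin (a := (0 : ℝ)) (s := Set.Ioi 0)).and
        (((eventually_lt_nhds one_pos).and ?_).filter_mono nhdsWithin_le_nhds)
      exact hcont.eventually_lt_const (by rw [h0]; exact hP)
    obtain ⟨l, hl0, hl1, hlP⟩ := hev.exists
    have hden : ∀ m, 0 < f m * (l * 1 + (1 - l) * d m) := fun m =>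
      mul_pos (hf m) (add_pos (by linarith) (mul_pos (by linarith) (hd m)))
    set s : ℝ := ∑ m, c m * ((∑ m', f m' * l) / (f m * (l * 1 + (1 - l) * d m))) with hs
    have hs0 : 0 < s :=
      Finset.sum_pos (fun m _ => mul_pos (hc m) (div_pos (Finset.sum_pos
        (fun m' _ => mul_pos (hf m') hl0) Finset.univ_nonempty) (hden m))) Finset.univ_nonempty
    have hlin : ∀ y, h l y = h l 0 + y * s := by
      intro y
      simp only [hh, hs]
      rw [Finset.mul_sum _ _ y, ← Finset.sum_add_distrib]
      refine Finset.sum_congr rfl fun m _ => ?_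
      have : ∑ m', f m' * ((l * 0 + (1 - l) * w m') + (l * (κ + y) + (1 - l) * a m')) =
          ∑ m', f m' * ((l * 0 + (1 - l) * w m') + (l * (κ + 0) + (1 - l) * a m')) +
            y * ∑ m', f m' * l := by
        rw [Finset.mul_sum, ← Finset.sum_add_distrib]
        exact Finset.sum_congr rfl fun m' _ => by ring
      rw [this]
      ring
    refine ⟨l, ⟨hl0.le, hl1.le⟩, (P - h l 0) / s, div_nonneg (by linarith) hs0.le, ?_⟩
    change h l _ = P
    rw [hlin, div_mul_cancel₀ _ hs0.ne']
    ring

/-! ### Infinite and finite values of the objective. -/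

section Main

variable {M : ℕ} {mode : Mode} {μT μC : Measure ℝ}
  [IsProbabilityMeasure μT] [IsProbabilityMeasure μC]

/-- Rule n waits at least n, so every cap L is reached from step L on, and
`exists_total_le_lastTime` gives lower bounds proportional to L. -/
theorem exists_sampler_infinite (hT : ∀ᵐ t ∂μT, 0 < t) (hC : ∀ᵐ c ∂μC, 0 < c)
    (hτ : mean μT ≠ ⊤) (hκ : mean μC ≠ ⊤) {f : Fin M → ℝ} (hf : ∀ m, 0 < f m)
    {ξ : Scheduler M} (hξ : HasSchedulingFrequency mode μT μC ξ f) :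
    ∃ π : Sampler M, NoStarvation mode μT μC ξ π ∧
      ∀ m, HasAveragePeakAge mode μT μC ξ π m ⊤ := by
  set ρ : ℕ → Fin M → Rule := fun n _ => Rule.full n (Nat.cast_nonneg n) with hρ
  have h0 : ∀ m u t c, (ρ 0 m).act u t c = max c 0 := by
    intro m u t c
    simp [hρ, Rule.full]
  have hNS : NoStarvation mode μT μC ξ (ruleSampler mode ρ) := by
    refine noStarvation_ruleSampler ρ hf hξ h0 (q := 2⁻¹) (by simp) (by simp)
      (Eventually.of_forall fun n m => ?_)
    rw [value_delivered_full hT hC]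
    exact le_add_self
  refine ⟨ruleSampler mode ρ, hNS, fun m => ?_⟩
  rw [HasAveragePeakAge, ENNReal.tendsto_nhds_top_iff_nat]
  intro n
  -- The additional 1 absorbs the error term of the lower bound.
  obtain ⟨L, hL⟩ := exists_nat_gt (((n : ℝ) + 1) / f m)
  rw [div_lt_iff₀ (hf m), mul_comm] at hL
  have hcap : Tendsto (fun k => value mode μT μC (delayFeature L) (ρ k m)) atTop
      (𝓝 (ENNReal.ofReal L)) := by
    refine tendsto_const_nhds.congr' ?_
    filter_upwards [eventually_ge_atTop L] with k hk
    have hle : ∀ u t c, (L : ENNReal) ≤ ENNReal.ofReal ((ρ k m).act u t c) := by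
      intro u t c
      simp only [hρ, ofReal_full_act, ENNReal.ofReal_natCast]
      exact le_add_left (by exact_mod_cast hk)
    simp only [value, delayFeature, min_eq_right (hle _ _ _)]
    simp
  have htot := tendsto_total_ruleSampler hf hξ h0 (measurable_delayFeature L) m
    (fun k => ne_top_of_le_ne_top (ENNReal.natCast_ne_top L) (value_delay_le _ _))
    (Nat.cast_nonneg L) hcap
  obtain ⟨e, he, hineq⟩ := exists_total_le_lastTime hT hC hτ hκ hNS L m
  have hbig : ((n : ENNReal) + 1) < ENNReal.ofReal (f m * L) := by
    have : ((n : ENNReal) + 1) = ENNReal.ofReal (n + 1) := by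
      rw [ENNReal.ofReal_add (Nat.cast_nonneg n) zero_le_one, ENNReal.ofReal_natCast,
        ENNReal.ofReal_one]
    rw [this]
    exact (ENNReal.ofReal_lt_ofReal_iff (lt_of_le_of_lt (by positivity) hL)).2 hL
  filter_upwards [htot.eventually_const_lt hbig, ENNReal.tendsto_nhds_zero.1 he 1 one_pos,
    eventually_gt_atTop 0] with N h1 h2 hN
  have h3 : (n : ENNReal) + 1 < lastTime mode μT μC ξ (ruleSampler mode ρ) m N / N + 1 := by
    refine h1.trans_le (le_trans ?_ ((hineq N hN).trans (add_le_add le_rfl h2)))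
    exact le_add_left (Finset.single_le_sum
      (f := fun m' => total mode ξ (ruleSampler mode ρ) μT μC (delayFeature L) m' N / N)
      (fun _ _ => zero_le) (Finset.mem_univ m))
  refine (lt_of_add_lt_add_right h3).trans_le ?_
  rw [lintegral_peakSum mode ξ _ hT hC, lintegral_deliveredCount]
  refine ENNReal.div_le_div le_add_self ?_
  have hD : total mode ξ (ruleSampler mode ρ) μT μC (deliveredFeature mode) m N / N ≤ 1 :=
    total_div_le (fun i => (lintegral_sourceFeature_le _ m i).trans
      ((lintegral_mono fun ω => deliveredFeature_le_one _ _ _).trans (by simp))) N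
  rwa [ENNReal.div_le_iff (by exact_mod_cast hN.ne') (ENNReal.natCast_ne_top N), one_mul] at hD

/-- The rules extracted from π under ξ₁, mixed with the waiting rule, are run under ξ₂. Only the
weighted sum is matched; the individual averages may change. -/
theorem exists_sampler_finite (hT : ∀ᵐ t ∂μT, 0 < t) (hC : ∀ᵐ c ∂μC, 0 < c)
    (hτ : mean μT ≠ ⊤) (hκ : mean μC ≠ ⊤) [Nonempty (Fin M)] {c f : Fin M → ℝ}
    (hc : ∀ m, 0 < c m) (hf : ∀ m, 0 < f m)
    {ξ₁ ξ₂ : Scheduler M} (hξ₁ : HasSchedulingFrequency mode μT μC ξ₁ f)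
    (hξ₂ : HasSchedulingFrequency mode μT μC ξ₂ f) {π : Sampler M}
    (hNS : NoStarvation mode μT μC ξ₁ π) {A : Fin M → ENNReal} (hAt : ∀ m, A m ≠ ⊤)
    (hA : ∀ m, HasAveragePeakAge mode μT μC ξ₁ π m (A m)) :
    ∃ π' : Sampler M, NoStarvation mode μT μC ξ₂ π' ∧ HasWeightedPeakAge mode μT μC c ξ₂ π'
      (∑ m, ENNReal.ofReal (c m) * A m) := by
  obtain ⟨d, g, w, a, r, hd0, hg0, hw0, ha0, hd, hg, hw, ha, hfin, hUI, hle⟩ :=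
    exists_limit_rules hT hC hτ hκ hf hξ₁ hNS hAt hA
  set τ := (mean μT).toReal with hτdef
  set κ := (mean μC).toReal with hκdef
  have hτ0 : 0 ≤ τ := ENNReal.toReal_nonneg
  have hκ0 : 0 ≤ κ := ENNReal.toReal_nonneg
  have hτr : mean μT = ENNReal.ofReal τ := (ENNReal.ofReal_toReal hτ).symm
  have hκr : mean μC = ENNReal.ofReal κ := (ENNReal.ofReal_toReal hκ).symm
  obtain ⟨l, hl, y, hy, hP⟩ := exists_mixture (κ := κ) (P := ∑ m, c m * (A m).toReal)
    (τ := τ) (g := g) (w := w) (a := a) hc hf hd0 (by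
      refine Finset.sum_le_sum fun m _ => mul_le_mul_of_nonneg_left ?_ (hc m).le
      rw [div_le_iff₀ (mul_pos (hf m) (hd0 m))]
      exact hle m)
  have hl1 : 0 ≤ 1 - l := sub_nonneg.2 hl.2
  set q : ℕ → Fin M → Rule := fun n m => Rule.mix ⟨l, hl⟩ (Rule.full y hy) (r n m) with hq
  -- Changing the rule at step 0 secures `h0` and affects no limit.
  set ρ : ℕ → Fin M → Rule := fun n m => if n = 0 then Rule.full 0 le_rfl else q n m with hρ
  have h0 : ∀ m u t c, (ρ 0 m).act u t c = max c 0 := by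
    intro m u t c
    simp [hρ, Rule.full]
  have hρq : ∀ᶠ n in atTop, ∀ m, ρ n m = q n m := by
    filter_upwards [eventually_ne_atTop 0] with n hn m
    simp [hρ, hn]
  have hlim : ∀ {F : ℝ × ℝ × ℝ → ℝ → ENNReal} {v₁ v₂ : ℝ} (m : Fin M),
      (Measurable fun p : (ℝ × ℝ × ℝ) × ℝ => F p.1 p.2) → 0 ≤ v₁ → 0 ≤ v₂ →
      value mode μT μC F (Rule.full y hy) = ENNReal.ofReal v₁ →
      Tendsto (fun n => value mode μT μC F (r n m)) atTop (𝓝 (ENNReal.ofReal v₂)) →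
      Tendsto (fun n => value mode μT μC F (ρ n m)) atTop
        (𝓝 (ENNReal.ofReal (l * v₁ + (1 - l) * v₂))) := by
    intro F v₁ v₂ m hF hv₁ hv₂ h1 h2
    refine (tendsto_value_mix hF hv₁ hv₂ ⟨l, hl⟩ h1 h2).congr' ?_
    filter_upwards [hρq] with n hn
    rw [hn]
  have hmixle : ∀ {F : ℝ × ℝ × ℝ → ℝ → ENNReal},
      (Measurable fun p : (ℝ × ℝ × ℝ) × ℝ => F p.1 p.2) → ∀ n m,
      value mode μT μC F (q n m) ≤
        value mode μT μC F (Rule.full y hy) + value mode μT μC F (r n m) := by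
    intro F hF n m
    simp only [hq, value_mix mode μT μC hF]
    refine add_le_add (mul_le_of_le_one_left zero_le ?_) (mul_le_of_le_one_left zero_le ?_)
    · exact ENNReal.ofReal_le_one.2 hl.2
    · exact ENNReal.ofReal_le_one.2 (by simpa using hl.1)
  have hperf : NoStarvation mode μT μC ξ₂ (ruleSampler mode ρ) ∧
      ∀ m, HasAveragePeakAge mode μT μC ξ₂ (ruleSampler mode ρ) m (ENNReal.ofReal
        ((τ + ∑ m', f m' * ((l * 0 + (1 - l) * w m') + (l * (κ + y) + (1 - l) * a m')) +
          f m * (l * (τ + κ) + (1 - l) * g m)) / (f m * (l * 1 + (1 - l) * d m)))) := by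
    refine performance_ruleSampler hT hC hτ hκ hf hξ₂ h0
      (d := fun m => l * 1 + (1 - l) * d m) (g := fun m => l * (τ + κ) + (1 - l) * g m)
      (w := fun m => l * 0 + (1 - l) * w m) (a := fun m => l * (κ + y) + (1 - l) * a m)
      (fun m => ?_) (fun m => ?_) (fun m => ?_) (fun m => ?_) (fun m => ?_) (fun m => ?_)
      (fun m => ?_) (fun m => ?_) (fun n m => ?_) (fun ε hε => ?_)
    · rcases hl.1.eq_or_lt with h | h
      · rw [← h]; simpa using hd0 m
      · exact add_pos_of_pos_of_nonneg (by linarith) (mul_nonneg hl1 (hd0 m).le)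
    · exact add_nonneg (mul_nonneg hl.1 (add_nonneg hτ0 hκ0)) (mul_nonneg hl1 (hg0 m))
    · exact add_nonneg (by simp) (mul_nonneg hl1 (hw0 m))
    · exact add_nonneg (mul_nonneg hl.1 (add_nonneg hκ0 hy)) (mul_nonneg hl1 (ha0 m))
    · exact hlim m (measurable_deliveredFeature mode) zero_le_one (hd0 m).le
        (by rw [value_delivered_full hT hC, ENNReal.ofReal_one]) (hd m)
    · exact hlim m (measurable_systemFeature mode) (add_nonneg hτ0 hκ0) (hg0 m)
        (by rw [value_system_full hT hC, hτr, hκr, ENNReal.ofReal_add hτ0 hκ0]) (hg m)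
    · exact hlim m (measurable_waitingFeature mode) le_rfl (hw0 m)
        (by rw [value_waiting_full hT hC, ENNReal.ofReal_zero]) (hw m)
    · exact hlim m (measurable_delayFeature ⊤) (add_nonneg hκ0 hy) (ha0 m)
        (by rw [value_delay_full, hκr, ENNReal.ofReal_add hκ0 hy]) (ha m)
    · by_cases hn : n = 0
      · simp only [hρ, if_pos hn, value_delay_full]
        exact ENNReal.add_ne_top.2 ⟨hκ, ENNReal.ofReal_ne_top⟩
      · simp only [hρ, if_neg hn]
        refine ne_top_of_le_ne_top (ENNReal.add_ne_top.2 ⟨?_, hfin n m⟩)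
          (hmixle (measurable_delayFeature ⊤) n m)
        rw [value_delay_full]
        exact ENNReal.add_ne_top.2 ⟨hκ, ENNReal.ofReal_ne_top⟩
    · have hε2 := (ENNReal.half_pos hε).ne'
      obtain ⟨B₁, hB₁, h1⟩ := exists_lintegral_tsub_le ENNReal.measurable_ofReal hκ hε2
      obtain ⟨B₂, hB₂, h2⟩ := hUI (ε / 2) hε2
      refine ⟨B₁ + ENNReal.ofReal y + B₂, by simp [hB₁, hB₂], ?_⟩
      filter_upwards [h2, hρq] with n h3 h4 m
      rw [h4, ← ENNReal.add_halves ε]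
      refine (hmixle (by fun_prop) n m).trans (add_le_add ?_ ?_)
      · exact (value_mono fun z u => tsub_le_tsub_left le_self_add _).trans
          ((value_excess_full_le hy B₁).trans h1)
      · exact (value_mono fun z u => tsub_le_tsub_left le_add_self _).trans (h3 m)
  refine ⟨ruleSampler mode ρ, hperf.1, _, hperf.2, ?_⟩
  have hX : ∀ m, 0 ≤ (τ + ∑ m', f m' * ((l * 0 + (1 - l) * w m') +
      (l * (κ + y) + (1 - l) * a m')) + f m * (l * (τ + κ) + (1 - l) * g m)) /
      (f m * (l * 1 + (1 - l) * d m)) := by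
    intro m
    refine div_nonneg (add_nonneg (add_nonneg hτ0 (Finset.sum_nonneg fun m' _ => ?_)) ?_) ?_
    · exact mul_nonneg (hf m').le (add_nonneg (add_nonneg (by simp) (mul_nonneg hl1 (hw0 m')))
        (add_nonneg (mul_nonneg hl.1 (add_nonneg hκ0 hy)) (mul_nonneg hl1 (ha0 m'))))
    · exact mul_nonneg (hf m).le (add_nonneg (mul_nonneg hl.1 (add_nonneg hτ0 hκ0))
        (mul_nonneg hl1 (hg0 m)))
    · exact mul_nonneg (hf m).le (add_nonneg (mul_nonneg hl.1 zero_le_one)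
        (mul_nonneg hl1 (hd0 m).le))
  have e1 : ∀ m, ENNReal.ofReal (c m) * A m = ENNReal.ofReal (c m * (A m).toReal) := fun m => by
    rw [ENNReal.ofReal_mul (hc m).le, ENNReal.ofReal_toReal (hAt m)]
  simp only [e1, ← ENNReal.ofReal_mul (hc _).le]
  rw [← ENNReal.ofReal_sum_of_nonneg fun m _ => mul_nonneg (hc m).le ENNReal.toReal_nonneg,
    ← ENNReal.ofReal_sum_of_nonneg fun m _ => mul_nonneg (hc m).le (hX m), hP]

end Main

end PeakAge

theorem theorem1 {M : ℕ} (mode : PeakAge.Mode)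
    (μT μC : Measure ℝ) [IsProbabilityMeasure μT] [IsProbabilityMeasure μC]
    (hT_pos : ∀ᵐ t ∂μT, 0 < t) (hT_int : Integrable (fun t : ℝ => t) μT)
    (hC_pos : ∀ᵐ c ∂μC, 0 < c) (hC_int : Integrable (fun c : ℝ => c) μC)
    (w : Fin M → ℝ) (hw_pos : ∀ m, 0 < w m) (hw_sum : ∑ m, w m = 1)
    (f : Fin M → ℝ) (hf_pos : ∀ m, 0 < f m)
    (ξ₁ ξ₂ : PeakAge.Scheduler M)
    (hξ₁ : PeakAge.HasSchedulingFrequency mode μT μC ξ₁ f)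
    (hξ₂ : PeakAge.HasSchedulingFrequency mode μT μC ξ₂ f)
    (π : PeakAge.Sampler M)
    (hπ : mode = PeakAge.Mode.preemptive → PeakAge.NoStarvation mode μT μC ξ₁ π)
    (P : ENNReal) (hP : PeakAge.HasWeightedPeakAge mode μT μC w ξ₁ π P) :
    ∃ π' : PeakAge.Sampler M,
      PeakAge.NoStarvation mode μT μC ξ₂ π' ∧
      PeakAge.HasWeightedPeakAge mode μT μC w ξ₂ π' P := by
  have hτ : PeakAge.mean μT ≠ ⊤ := hT_int.lintegral_lt_top.ne
  have hκ : PeakAge.mean μC ≠ ⊤ := hC_int.lintegral_lt_top.ne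
  have hM : Nonempty (Fin M) := by
    by_contra h
    rw [not_nonempty_iff] at h
    simp at hw_sum
  by_cases hPt : P = ⊤
  · obtain ⟨π', hNS, hage⟩ :=
      PeakAge.exists_sampler_infinite hT_pos hC_pos hτ hκ hf_pos hξ₂
    refine ⟨π', hNS, fun _ => ⊤, hage, ?_⟩
    rw [hPt, eq_comm, ENNReal.sum_eq_top]
    obtain ⟨m⟩ := hM
    exact ⟨m, Finset.mem_univ m, ENNReal.mul_top (ENNReal.ofReal_pos.2 (hw_pos m)).ne'⟩
  · obtain ⟨A, hA, rfl⟩ := hP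
    have hNS : PeakAge.NoStarvation mode μT μC ξ₁ π := by
      cases mode with
      | nonpreemptive => exact PeakAge.noStarvation_nonpreemptive hf_pos hξ₁ π
      | preemptive => exact hπ rfl
    have hAt : ∀ m, A m ≠ ⊤ := by
      intro m hm
      refine hPt (ENNReal.sum_eq_top.2 ⟨m, Finset.mem_univ m, ?_⟩)
      rw [hm, ENNReal.mul_top (ENNReal.ofReal_pos.2 (hw_pos m)).ne']
    exact PeakAge.exists_sampler_finite hT_pos hC_pos hτ hκ hw_pos hf_pos hξ₁ hξ₂ hNS hAt hA
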